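/- Let $M(c)=(M^{2n+1},\phi,\xi,\eta,g)$ be a Sasakian space form (a Sasakian manifold of constant $\phi$-sectional curvature $c$) with $c\neq 1$, with Levi-Civita connection $\nabla$. Conventions: $d\eta(X,Y)=\tfrac12\big(X\eta(Y)-Y\eta(X)-\eta([X,Y])\big)$, and Sasakian means contact metric, $d\eta(X,Y)=g(X,\phi Y)$, and normal, $N_\phi=-2\,d\eta\otimes\xi$, so that $\nabla_X\xi=-\phi X$. Let $I\subset\mathbb R$ be a non-empty open interval and let $\gamma:I\to M(c)$ be a smooth Legendre curve (that is, $\eta(\gamma')=0$), parametrized by arc length, which is a Frenet curve of osculating order $r\geq 1$: there are smooth orthonormal vector fields $E_1=T=\gamma',E_2,\dots,E_r$ along $\gamma$ and smooth positive functions $k_1,\dots,k_{r-1}$ on $I$ with $$\nabla_TE_i=-k_{i-1}E_{i-1}+k_iE_{i+1}\qquad(1\le i\le r),$$ where the term $k_{i-1}E_{i-1}$ is omitted for $i=1$ and the term $k_iE_{i+1}$ for $i=r$. Assume that $\phi T\perp E_2$ along $\gamma$ if $r\geq 2$ (no condition if $r=1$). Let $\delta_1,\delta_2\in\mathbb R$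 with $\delta_2\neq 0$. The curve $\gamma$ is called interpolating sesqui-harmonic (for $\delta_1,\delta_2$) if for every compact interval $[a,b]\subset I$ it is a critical point of $$\delta_1\int_a^b\|\gamma'\|^2\,dt+\delta_2\int_a^b\|\nabla_{\gamma'}\gamma'\|^2\,dt$$ under smooth variations that are supported in a compact subset of $(a,b)$. (1) If $c\leq -3$ and $\delta_1/\delta_2\geq 0$, then $\gamma$ is interpolating sesqui-harmonic if and only if it is a geodesic. (2) If $c>-3$, $\delta_1/\delta_2<0$ and $\gamma$ is not a geodesic, then $\gamma$ is interpolating sesqui-harmonic if and only if either (a) $r=2$, $n\geq 2$ and $\gamma$ is a circle ($k_1$ is constant) with $k_1^2=\frac{c+3}{4}-\frac{\delta_1}{\delta_2}$; or (b) $r=3$, $n\geq 3$ and $\gamma$ is a helix ($k_1$ and $k_2$ are constant) with $k_1^2+k_2^2=\frac{c+3}{4}-\frac{\delta_1}{\delta_2}$. In case (a) the vectors $T,E_2,\phi T,\nabla_T\phi T,\xi$ are linearly independent at every point of $\gamma$, and in case (b) the vectors $T,E_2,E_3,\phi T,\nabla_T\phi T,\xi$ are linearly independent at every point of $\gamma$.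 -/

import Mathlib

open Bundle Manifold Set MeasureTheory
open scoped ContDiff Topology RealInnerProductSpace

noncomputable section

namespace Sasaki

section Connection

variable {d : ℕ} {M : Type*} [TopologicalSpace M] [ChartedSpace (EuclideanSpace ℝ (Fin d)) M]
  [IsManifold (𝓡 d) ∞ M]

/-- A vector field, defined on all of `M`, which is smooth at the point `x`. -/
def SmoothFieldAt (X : ∀ x : M, TangentSpace (𝓡 d) x) (x : M) : Prop :=
  ContMDiffAt (𝓡 d) (𝓡 d).tangent ∞ (fun y ↦ (⟨y, X y⟩ : TangentBundle (𝓡 d) M)) x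

/-- The Levi-Civita connection: the smooth, torsion-free, metric connection on `TM`. -/
structure IsLeviCivita [RiemannianBundle (fun x : M ↦ TangentSpace (𝓡 d) x)]
    [IsContMDiffRiemannianBundle (𝓡 d) ∞ (EuclideanSpace ℝ (Fin d))
      (fun x : M ↦ TangentSpace (𝓡 d) x)]
    (cov : CovariantDerivative (𝓡 d) (EuclideanSpace ℝ (Fin d))
      (fun x : M ↦ TangentSpace (𝓡 d) x)) : Prop where
  smooth : cov.ContMDiffCovariantDerivative ∞
  torsion_eq_zero : cov.torsion = 0
  metric :
    haveI : IsContMDiffRiemannianBundle (𝓡 d) 1 (EuclideanSpace ℝ (Fin d))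
        (fun x : M ↦ TangentSpace (𝓡 d) x) :=
      IsContMDiffRiemannianBundle.of_le (n := ∞) (by norm_cast)
    cov.IsMetricCompatible

/-- The curvature operator
`R(X, Y) Z = ∇_X ∇_Y Z - ∇_Y ∇_X Z - ∇_[X, Y] Z` on vector fields
(`cov Z x v` is `∇_v Z` at `x`). -/
def curvature
    (cov : CovariantDerivative (𝓡 d) (EuclideanSpace ℝ (Fin d))
      (fun x : M ↦ TangentSpace (𝓡 d) x))
    (X Y Z : ∀ x : M, TangentSpace (𝓡 d) x) (x : M) : TangentSpace (𝓡 d) x :=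
  cov (fun y ↦ cov Z y (Y y)) x (X x) - cov (fun y ↦ cov Z y (X y)) x (Y x)
    - cov Z x (VectorField.mlieBracket (𝓡 d) X Y x)

/-- The velocity `γ'(t)` of a curve. -/
def velocity (γ : ℝ → M) (t : ℝ) : TangentSpace (𝓡 d) (γ t) :=
  mfderiv 𝓘(ℝ, ℝ) (𝓡 d) γ t (1 : ℝ)

/-- A vector field along `γ` which is smooth over `J`. -/
def SmoothAlong (γ : ℝ → M) (V : ∀ t, TangentSpace (𝓡 d) (γ t)) (J : Set ℝ) : Prop :=
  ContMDiffOn 𝓘(ℝ, ℝ) (𝓡 d).tangent ∞ (fun t ↦ (⟨γ t, V t⟩ : TangentBundle (𝓡 d) M)) J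

/-- The covariant derivative `∇_{γ'} V` of a vector field `V` along a curve `γ`. If
`s₁, …, s_d` is the coordinate frame of `TM` around `γ(t)` and `V = ∑ Vⁱ (sᵢ ∘ γ)` near `t`,
then `∇_{γ'} V = ∑ ((Vⁱ)' sᵢ + Vⁱ ∇_{γ'} sᵢ)` at `t`. -/
def covAlong
    (cov : CovariantDerivative (𝓡 d) (EuclideanSpace ℝ (Fin d))
      (fun x : M ↦ TangentSpace (𝓡 d) x))
    (γ : ℝ → M) (V : ∀ t, TangentSpace (𝓡 d) (γ t)) (t : ℝ) : TangentSpace (𝓡 d) (γ t) :=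
  let e := trivializationAt (EuclideanSpace ℝ (Fin d)) (fun x : M ↦ TangentSpace (𝓡 d) x) (γ t)
  let b := (EuclideanSpace.basisFun (Fin d) ℝ).toBasis
  let coeff : Fin d → ℝ → ℝ := fun i u ↦ e.localFrameCoeff (𝓡 d) b i (γ u) (V u)
  ∑ i, (deriv (coeff i) t • e.localFrame b i (γ t)
    + coeff i t • cov (e.localFrame b i) (γ t) (velocity γ t))

/-- The tension field `τ(γ) = ∇_{γ'} γ'` of a curve. -/
def tension
    (cov : CovariantDerivative (𝓡 d) (EuclideanSpace ℝ (Fin d))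
      (fun x : M ↦ TangentSpace (𝓡 d) x))
    (γ : ℝ → M) (t : ℝ) : TangentSpace (𝓡 d) (γ t) :=
  covAlong cov γ (velocity γ) t

/-- `γ` is a geodesic over `J`. -/
def IsGeodesicOn
    (cov : CovariantDerivative (𝓡 d) (EuclideanSpace ℝ (Fin d))
      (fun x : M ↦ TangentSpace (𝓡 d) x))
    (γ : ℝ → M) (J : Set ℝ) : Prop :=
  ∀ t ∈ J, tension cov γ t = 0

end Connection

section Curves

variable {d : ℕ} {M : Type*} [TopologicalSpace M] [ChartedSpace (EuclideanSpace ℝ (Fin d)) M]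
  [IsManifold (𝓡 d) ∞ M] [RiemannianBundle (fun x : M ↦ TangentSpace (𝓡 d) x)]

/-- The functional `δ₁ ∫ |dγ|² + δ₂ ∫ |τ(γ)|²` over `[a, b]`. -/
def sesquiEnergy
    (cov : CovariantDerivative (𝓡 d) (EuclideanSpace ℝ (Fin d))
      (fun x : M ↦ TangentSpace (𝓡 d) x))
    (δ₁ δ₂ : ℝ) (γ : ℝ → M) (a b : ℝ) : ℝ :=
  δ₁ * (∫ t in a..b, ‖velocity (d := d) γ t‖ ^ 2) + δ₂ * ∫ t in a..b, ‖tension cov γ t‖ ^ 2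

/-- `F`, defined on `(-ε, ε) × J`, is a smooth variation of `γ` that is supported in a compact
part of the open interval `(a, b)`; `F s t` is the point at time `t` of the `s`-th curve. -/
structure IsVariation (F : ℝ → ℝ → M) (ε : ℝ) (γ : ℝ → M) (J : Set ℝ) (a b : ℝ) : Prop where
  pos : 0 < ε
  smooth : ContMDiffOn 𝓘(ℝ, ℝ × ℝ) (𝓡 d) ∞ (Function.uncurry F) (Ioo (-ε) ε ×ˢ J)
  initial : ∀ t ∈ J, F 0 t = γ t
  support : ∃ K : Set ℝ, IsCompact K ∧ K ⊆ Ioo a b ∧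
    ∀ s ∈ Ioo (-ε) ε, ∀ t ∈ J \ K, F s t = γ t

/-- `γ : J → M` is interpolating sesqui-harmonic: it is a critical point of the functional
`δ₁ ∫ |dγ|² + δ₂ ∫ |τ(γ)|²` over every compact `[a, b] ⊆ J`, under compactly supported
variations. -/
def IsSesquiHarmonic
    (cov : CovariantDerivative (𝓡 d) (EuclideanSpace ℝ (Fin d))
      (fun x : M ↦ TangentSpace (𝓡 d) x))
    (δ₁ δ₂ : ℝ) (γ : ℝ → M) (J : Set ℝ) : Prop :=
  ∀ a b : ℝ, a < b → Icc a b ⊆ J → ∀ (F : ℝ → ℝ → M) (ε : ℝ),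
    IsVariation (d := d) F ε γ J a b →
      HasDerivAt (fun s ↦ sesquiEnergy cov δ₁ δ₂ (F s) a b) 0 0

/-- `γ : J → M` is a curve parametrized by arc length which is a Frenet curve of osculating order
`r`, with Frenet frame `E 1 = γ', …, E r` and curvatures `k 1, …, k (r - 1) > 0`:
`∇_T E₁ = k₁ E₂`, `∇_T Eᵢ = -kᵢ₋₁ Eᵢ₋₁ + kᵢ Eᵢ₊₁` for `1 < i < r` and
`∇_T E_r = -k_{r-1} E_{r-1}`. Values of `E` and `k` at other indices are irrelevant. -/
structure IsFrenetCurve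
    (cov : CovariantDerivative (𝓡 d) (EuclideanSpace ℝ (Fin d))
      (fun x : M ↦ TangentSpace (𝓡 d) x))
    (γ : ℝ → M) (J : Set ℝ) (r : ℕ) (E : ℕ → ∀ t, TangentSpace (𝓡 d) (γ t))
    (k : ℕ → ℝ → ℝ) : Prop where
  smooth_curve : ContMDiffOn 𝓘(ℝ, ℝ) (𝓡 d) ∞ γ J
  one_le : 1 ≤ r
  le_dim : r ≤ d
  smooth_frame : ∀ i, 1 ≤ i → i ≤ r → SmoothAlong γ (E i) J
  smooth_curvature : ∀ i, 1 ≤ i → i < r → ContDiffOn ℝ ∞ (k i) J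
  orthonormal : ∀ t ∈ J, ∀ i j, 1 ≤ i → i ≤ r → 1 ≤ j → j ≤ r →
    ⟪E i t, E j t⟫ = if i = j then (1 : ℝ) else 0
  frame_one : ∀ t ∈ J, E 1 t = velocity γ t
  curvature_pos : ∀ t ∈ J, ∀ i, 1 ≤ i → i < r → 0 < k i t
  frenet : ∀ t ∈ J, ∀ i, 1 ≤ i → i ≤ r →
    covAlong cov γ (E i) t =
      (if 1 < i then -(k (i - 1) t • E (i - 1) t) else 0)
        + (if i < r then k i t • E (i + 1) t else 0)

/-- A Frenet curve of osculating order `r` is a circle: `r = 2` and `k₁` is constant. -/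
def IsCircle (J : Set ℝ) (r : ℕ) (k : ℕ → ℝ → ℝ) : Prop :=
  r = 2 ∧ ∃ κ : ℝ, ∀ t ∈ J, k 1 t = κ

/-- A Frenet curve of osculating order `r` is a helix: `r ≥ 3` and `k₁, …, k_{r-1}` are
constant. -/
def IsHelix (J : Set ℝ) (r : ℕ) (k : ℕ → ℝ → ℝ) : Prop :=
  3 ≤ r ∧ ∀ i, 1 ≤ i → i < r → ∃ κ : ℝ, ∀ t ∈ J, k i t = κ

end Curves

section Contact

variable (d : ℕ) (M : Type*) [TopologicalSpace M] [ChartedSpace (EuclideanSpace ℝ (Fin d)) M]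
  [IsManifold (𝓡 d) ∞ M] [RiemannianBundle (fun x : M ↦ TangentSpace (𝓡 d) x)]

/-- An almost contact metric structure `(φ, ξ, η, g)`, where `g` is the Riemannian metric
of `M`. -/
structure AlmostContactMetric where
  φ : ∀ x : M, TangentSpace (𝓡 d) x →L[ℝ] TangentSpace (𝓡 d) x
  ξ : ∀ x : M, TangentSpace (𝓡 d) x
  η : ∀ x : M, TangentSpace (𝓡 d) x →L[ℝ] ℝ
  smooth_φ : ContMDiff (𝓡 d)
    ((𝓡 d).prod 𝓘(ℝ, EuclideanSpace ℝ (Fin d) →L[ℝ] EuclideanSpace ℝ (Fin d))) ∞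
    (fun x ↦ TotalSpace.mk' (EuclideanSpace ℝ (Fin d) →L[ℝ] EuclideanSpace ℝ (Fin d))
      (E := fun x : M ↦ TangentSpace (𝓡 d) x →L[ℝ] TangentSpace (𝓡 d) x) x (φ x))
  smooth_ξ : ContMDiff (𝓡 d) (𝓡 d).tangent ∞ (fun x ↦ (⟨x, ξ x⟩ : TangentBundle (𝓡 d) M))
  smooth_η : ContMDiff (𝓡 d) ((𝓡 d).prod 𝓘(ℝ, EuclideanSpace ℝ (Fin d) →L[ℝ] ℝ)) ∞
    (fun x ↦ TotalSpace.mk' (EuclideanSpace ℝ (Fin d) →L[ℝ] ℝ)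
      (E := fun x : M ↦ TangentSpace (𝓡 d) x →L[ℝ] Trivial M ℝ x) x (η x))
  φ_φ : ∀ (x : M) (v : TangentSpace (𝓡 d) x), φ x (φ x v) = -v + η x v • ξ x
  η_ξ : ∀ x : M, η x (ξ x) = 1
  inner_φ_φ : ∀ (x : M) (v w : TangentSpace (𝓡 d) x),
    ⟪φ x v, φ x w⟫ = ⟪v, w⟫ - η x v * η x w

variable {d M}

namespace AlmostContactMetric

variable (S : AlmostContactMetric d M)

/-- `dη(X, Y) = ½ (X η(Y) - Y η(X) - η([X, Y]))`. The factor `½` is the convention under which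
a contact metric structure satisfies `dη(X, Y) = g(X, φ Y)` and a Sasakian one
`∇_X ξ = -φ X`. -/
def dη (X Y : ∀ x : M, TangentSpace (𝓡 d) x) (x : M) : ℝ :=
  (1 / 2 : ℝ) * (mvfderiv (𝓡 d) (fun y ↦ S.η y (Y y)) x (X x)
    - mvfderiv (𝓡 d) (fun y ↦ S.η y (X y)) x (Y x)
    - S.η x (VectorField.mlieBracket (𝓡 d) X Y x))

/-- The Nijenhuis tensor
`N_φ(X, Y) = φ² [X, Y] + [φ X, φ Y] - φ [φ X, Y] - φ [X, φ Y]`. -/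
def nijenhuis (X Y : ∀ x : M, TangentSpace (𝓡 d) x) (x : M) : TangentSpace (𝓡 d) x :=
  S.φ x (S.φ x (VectorField.mlieBracket (𝓡 d) X Y x))
    + VectorField.mlieBracket (𝓡 d) (fun y ↦ S.φ y (X y)) (fun y ↦ S.φ y (Y y)) x
    - S.φ x (VectorField.mlieBracket (𝓡 d) (fun y ↦ S.φ y (X y)) Y x)
    - S.φ x (VectorField.mlieBracket (𝓡 d) X (fun y ↦ S.φ y (Y y)) x)

/-- A Sasakian structure: contact metric, `dη(X, Y) = g(X, φ Y)`, and normal,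
`N_φ = -2 dη ⊗ ξ`. -/
structure IsSasakian : Prop where
  contact : ∀ (x : M) (X Y : ∀ x : M, TangentSpace (𝓡 d) x),
    SmoothFieldAt X x → SmoothFieldAt Y x → S.dη X Y x = ⟪X x, S.φ x (Y x)⟫
  normal : ∀ (x : M) (X Y : ∀ x : M, TangentSpace (𝓡 d) x),
    SmoothFieldAt X x → SmoothFieldAt Y x → S.nijenhuis X Y x = (-2 * S.dη X Y x) • S.ξ x

/-- Every `φ`-section, i.e. every plane spanned by orthonormal vectors `v, φ v` with `v ⊥ ξ`, has
sectional curvature `g(R(v, φ v) φ v, v) = c`. -/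
def HasPhiSectionalCurvature
    (cov : CovariantDerivative (𝓡 d) (EuclideanSpace ℝ (Fin d))
      (fun x : M ↦ TangentSpace (𝓡 d) x)) (c : ℝ) : Prop :=
  ∀ (x : M) (X : ∀ x : M, TangentSpace (𝓡 d) x), SmoothFieldAt X x →
    S.η x (X x) = 0 → ‖X x‖ = 1 →
      ⟪curvature cov X (fun y ↦ S.φ y (X y)) (fun y ↦ S.φ y (X y)) x, X x⟫ = c

/-- `M(c)`: a Sasakian space form of constant `φ`-sectional curvature `c`. -/
structure IsSasakianSpaceForm
    (cov : CovariantDerivative (𝓡 d) (EuclideanSpace ℝ (Fin d))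
      (fun x : M ↦ TangentSpace (𝓡 d) x)) (c : ℝ) : Prop where
  sasakian : S.IsSasakian
  curvature_eq : S.HasPhiSectionalCurvature cov c

/-- `γ` is a Legendre curve: an integral curve of the contact distribution `η = 0`. -/
def IsLegendre (γ : ℝ → M) (J : Set ℝ) : Prop :=
  ∀ t ∈ J, S.η (γ t) (velocity γ t) = 0

/-- The vector field `φ T` along `γ`, where `T = γ'`. -/
def φT (γ : ℝ → M) (t : ℝ) : TangentSpace (𝓡 d) (γ t) :=
  S.φ (γ t) (velocity γ t)

end AlmostContactMetric

end Contact

end Sasaki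

end

/-! The Euler-Lagrange equation of the functional is computed, the curvature is shown to enter it
only through one constant, and the equation is then read off in the Frenet frame.

Let τ = ∇_T T, and let V be the field of a variation. The derivative of the functional is 2∫ (δ₁⟨∇_T
V, T⟩ + δ₂⟨∇_T²V + R(V, T)T, τ⟩). If g(R(v, T)T, τ) = κ g(v, τ) for every v, integration by parts
turns this into 2∫⟨V, δ₂(∇_T²τ + κτ) − δ₁τ⟩ (`IsVariation.hasDerivAt_sesquiEnergy`). By the
fundamental lemma of the calculus of variations, being critical means that this field vanishes
(`isSesquiHarmonic_iff`).

The constant is κ = (c + 3)/4. The contact and normality conditions give (∇_u φ)v = g(u, v)ξ − η(v)u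
and ∇_u ξ = −φu (`nabla_phi_of_normal`, `IsLocalSasakian.nabla_phi_and_nabla_xi`). Differentiating
once more gives R(u, v)ξ and the commutator of R(u, v) with φ. On ker η the difference between R and
the model tensor of a Sasakian space form is curvature-like and φ-invariant and has vanishing
φ-sectional curvatures. As in Kähler geometry, all its sectional curvatures then vanish
(`biquadratic_eq_zero_of_holomorphic_eq_zero`). Polarization gives the eigenvalue (c + 3)/4 for
horizontal vectors orthogonal to T and φT (`IsLocalSasakian.curvature_eq_of_phiSectional`). The
field τ = k₁E₂ is such a vector: it is orthogonal to φT by assumption, and horizontal because g(T,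
ξ) = 0 can be differentiated.

In the Frenet frame the equation has components along E₁, …, E₄ only. They say that k₁ is constant,
that k₁² + k₂² = κ − δ₁/δ₂, that k₂ is constant and that k₁k₂k₃ = 0, so r ≤ 3
(`IsFrenetCurve.eulerLagrange_eq_zero_iff`). The left side of the second relation is positive unless
the curve is a geodesic, which settles the case c ≤ −3. Differentiating orthogonality relations
shows that five (r = 2) or six (r = 3) vectors are linearly independent, and these must fit into
dimension 2n + 1.

All local identities are proved in a chart, for fields on an open set of a vector space.
`isLocalMetric_coord`, `AlmostContactMetric.isLocalSasakian_coord` and `covAlong_eq` carry them to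
the manifold. -/

set_option linter.unusedSectionVars false

noncomputable section

namespace Sasaki

/-! ### Pointwise algebra of curvature tensors and of normal contact metric structures -/

section Algebra

variable {V : Type*} [NormedAddCommGroup V] [NormedSpace ℝ V]

/-- A curvature-like tensor all of whose holomorphic sectional curvatures vanish is zero on pairs. -/
lemma biquadratic_eq_zero_of_holomorphic_eq_zero {D : V → V → V → V → ℝ} {H : Submodule ℝ V}
    {J : V →L[ℝ] V} (hJ : ∀ u ∈ H, J u ∈ H) (hJJ : ∀ u ∈ H, J (J u) = -u)
    (add₁ : ∀ a a' b e f, D (a + a') b e f = D a b e f + D a' b e f)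
    (skew : ∀ a b e f, D a b e f = -D b a e f) (pair : ∀ a b e f, D a b e f = D e f a b)
    (bianchi : ∀ a b e f, D a b e f + D b e a f + D e a b f = 0)
    (inv : ∀ a ∈ H, ∀ b ∈ H, ∀ e ∈ H, ∀ f ∈ H, D a b (J e) (J f) = D a b e f)
    (hol : ∀ u ∈ H, D u (J u) (J u) u = 0) {u v : V} (hu : u ∈ H) (hv : v ∈ H) :
    D u v v u = 0 := by
  have skew' : ∀ a b e f, D a b e f = -D a b f e := fun a b e f ↦ by rw [pair, skew, pair]
  have add₃ : ∀ a b e e' f, D a b (e + e') f = D a b e f + D a b e' f := fun a b e e' f ↦ by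
    rw [pair, add₁, pair e, pair e']
  have add₂ : ∀ a b b' e f, D a (b + b') e f = D a b e f + D a b' e f := fun a b b' e f ↦ by
    rw [skew, add₁, skew a b, skew a b']; ring
  have add₄ : ∀ a b e f f', D a b e (f + f') = D a b e f + D a b e f' := fun a b e f f' ↦ by
    rw [pair, add₂, pair e, pair a b e f']
  have zero₁ : ∀ b e f, D 0 b e f = 0 := fun b e f ↦ by
    have := add₁ 0 0 b e f
    rw [add_zero] at this; linarith
  have neg₁ : ∀ a b e f, D (-a) b e f = -D a b e f := fun a b e f ↦ by
    have := add₁ a (-a) b e f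
    rw [add_neg_cancel, zero₁] at this; linarith
  have neg₂ : ∀ a b e f, D a (-b) e f = -D a b e f := fun a b e f ↦ by
    rw [skew, neg₁, skew a b]
  have neg₃ : ∀ a b e f, D a b (-e) f = -D a b e f := fun a b e f ↦ by
    rw [pair, neg₁, pair a b]
  have neg₄ : ∀ a b e f, D a b e (-f) = -D a b e f := fun a b e f ↦ by
    rw [pair, neg₂, pair a b]
  have inv' : ∀ a ∈ H, ∀ b ∈ H, ∀ e ∈ H, ∀ f ∈ H, D (J a) (J b) e f = D a b e f :=
    fun a ha b hb e he f hf ↦ by rw [pair, inv e he f hf a ha b hb, pair]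
  have main : ∀ x ∈ H, ∀ y ∈ H, D x y y x + 3 * D x (J y) (J y) x = 0 := by
    intro x hx y hy
    have hJx := hJ x hx
    have hJy := hJ y hy
    -- In the sum of the conditions at x + y and x − y the terms of odd degree in y cancel. Bianchi
    -- and the invariance under J bring the remaining ones to two kinds.
    have k1 := hol (x + y) (H.add_mem hx hy)
    have k2 := hol (x + -y) (H.add_mem hx (H.neg_mem hy))
    have kx := hol x hx
    have ky := hol y hy
    simp only [map_add, map_neg, add₁, add₂, add₃, add₄, neg₁, neg₂, neg₃, neg₄] at k1 k2
    have b1 := bianchi x (J x) (J y) y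
    have e1 : D (J x) (J y) x y = D x y x y := inv' x hx y hy x hx y hy
    have s1 : D x y x y = -D x y y x := by rw [pair x y x y, skew x y x y, pair]
    have e2 : D x (J y) (J x) y = D x (J y) (J y) x := by
      rw [← inv x hx _ hJy _ hJx y hy, hJJ x hx, neg₃, pair, skew, pair, neg_neg]
    have s2 : D (J y) x (J x) y = -D x (J y) (J x) y := skew _ _ _ _
    have e3 : D y (J x) (J y) x = D x (J y) (J x) y := by
      rw [pair, skew, skew', neg_neg]
    have e4 : D y (J x) (J x) y = D x (J y) (J y) x := by
      rw [← inv' y hy _ hJx _ hJx y hy, hJJ x hx, neg₂, ← inv _ hJy x hx _ hJx y hy, hJJ x hx, neg₃,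
        neg_neg, pair]
    have e5 : D y (J y) (J x) x = D x (J x) (J y) y := by
      rw [pair, skew, skew', neg_neg]
    linarith
  -- With K = D u v v u and K' = D u (J v) (J v) u this is the system K + 3K' = 0, K' + 3K = 0; the
  -- second equation uses J² = −1.
  have h1 := main u hu v hv
  have h2 := main u hu (J v) (hJ v hv)
  rw [hJJ v hv, neg₂, neg₃, neg_neg] at h2
  linarith

/-- The four-term symmetry of a curvature tensor follows from skew-symmetry and Bianchi. -/
lemma pair_symm_of_bianchi {D : V → V → V → V → ℝ}
    (skew : ∀ a b e f, D a b e f = -D b a e f) (skew' : ∀ a b e f, D a b e f = -D a b f e)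
    (bianchi : ∀ a b e f, D a b e f + D b e a f + D e a b f = 0) (a b e f : V) :
    D a b e f = D e f a b := by
  -- The octahedron argument: four Bianchi identities, one for each letter in the last slot,
  -- combined by means of the two skew symmetries.
  linarith [bianchi a b e f, bianchi b e f a, bianchi e f a b, bianchi f a b e,
    skew a b e f, skew' a b e f, skew e f a b, skew' e f a b, skew b e a f, skew' b e a f,
    skew b e f a, skew e a b f, skew' e a b f, skew e f b a, skew' e f b a,
    skew f b e a, skew' f b e a, skew f a b e, skew' f a b e, skew f a e b, skew a e f b, skew a b f e,
    skew' a b f e, skew' b f a e, skew b f a e, skew b f e a, skew' a e f b, skew a e b f, skew' e a f b]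

/-- Pointwise algebra of a contact metric normal structure: `P u v` stands for `(∇_u φ) v`
and `X u` for `∇_u ξ`. -/
lemma nabla_phi_of_normal {g : V →L[ℝ] V →L[ℝ] ℝ} {φ : V →L[ℝ] V} {ξ : V} {η : V →L[ℝ] ℝ}
    {P : V → V → V} {X : V → V}
    (symm : ∀ u v, g u v = g v u) (nondeg : ∀ u, (∀ v, g u v = 0) → u = 0)
    (φφ : ∀ v, φ (φ v) = -v + η v • ξ) (ηξ : η ξ = 1) (φξ : φ ξ = 0) (ηφ : ∀ v, η (φ v) = 0)
    (gξ : ∀ v, g v ξ = η v) (gφφ : ∀ v w, g (φ v) (φ w) = g v w - η v * η w)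
    (skew : ∀ v w, g (φ v) w = -g v (φ w))
    (Pφ : ∀ u v, P u (φ v) + φ (P u v) = g v (X u) • ξ + η v • X u)
    (Pskew : ∀ u v w, g (P u v) w = -g v (P u w)) (Pξ : ∀ u, P u ξ = -φ (X u))
    (Xξ : ∀ u, g ξ (X u) = 0) (dη : ∀ u v, g v (X u) - g u (X v) = 2 * g u (φ v))
    (closed : ∀ u v w, g (P u v) w + g (P v w) u + g (P w u) v = 0)
    (normal : ∀ u v, P (φ u) v - P (φ v) u + φ (P v u) - φ (P u v) = (-2 * g u (φ v)) • ξ) :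
    (∀ u v, P u v = g u v • ξ - η v • u) ∧ ∀ u, X u = -φ u := by
  have hP : ∀ u v w, g (P u v) w = η w * g u v - η v * g u w := by
    intro u v w
    have a1 : ∀ p q s, g (P p (φ q)) s = -g (φ (P p q)) s + g q (X p) * η s + η q * g s (X p) := by
      intro p q s
      have := congrArg (fun z ↦ g z s) (Pφ p q)
      simp only [map_add, map_smul, add_apply, smul_apply, smul_eq_mul] at this
      rw [symm ξ s, gξ, symm (X p) s] at this
      linarith
    have a2 : ∀ p q, η (P p q) = -g (φ q) (X p) := by
      intro p q
      rw [← gξ, Pskew, Pξ, map_neg, skew]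
    have a3 : ∀ p q s, g (φ (P p q)) (φ s) = g (P p q) s + g (φ q) (X p) * η s := by
      intro p q s
      rw [gφφ, a2]; ring
    -- The classical formula for 2 g((∇_u φ)v, w): the fundamental form is closed at (u, φv, φw) and
    -- at (u, v, w), and normality at (v, w) is paired with φu, which kills its ξ-component. The
    -- leftover ∇ξ terms carry a factor η and are evaluated by `dη`.
    have c1 := closed u (φ v) (φ w)
    have c2 := closed u v w
    have n1 := congrArg (fun z ↦ g z (φ u)) (normal v w)
    have ξφ : g ξ (φ u) = 0 := by rw [symm, gξ, ηφ]
    simp only [map_add, map_sub, map_smul, add_apply, sub_apply, smul_apply, smul_eq_mul, ξφ, mul_zero] at n1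
    rw [a3, a3] at n1
    have b1 := a1 u v (φ w)
    rw [a3, ηφ] at b1
    have b2 := a1 (φ v) w u
    have b3 := a1 (φ w) v u
    have k1 := skew (P (φ v) w) u
    have k2 := skew (P (φ w) v) u
    have p1 := Pskew (φ w) u (φ v)
    have p2 := Pskew w u v
    have p3 := symm u (P (φ w) (φ v))
    have p4 := symm u (P w v)
    have d1 := dη (φ v) u
    have d2 := dη (φ w) u
    have d3 := dη (φ v) w
    have d4 := dη (φ w) v
    rw [gφφ] at d1 d2 d3 d4
    have s1 := symm v w
    have s2 := symm v u
    have s3 := symm w u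
    rw [s1] at d3
    rw [s2] at d1
    rw [s3] at d2
    linear_combination (1 / 2) * n1 + (1 / 2) * c2 - (1 / 2) * c1 + (1 / 2) * b1 + (1 / 2) * b2
      - (1 / 2) * b3 + (1 / 2) * p1 - (1 / 2) * k1 + (1 / 2) * k2 - (1 / 2) * p2
      - (1 / 2) * p3 + (1 / 2) * p4 + (1 / 2) * η w * d1 - (1 / 2) * η v * d2
      + (1 / 2) * η u * d3 - (1 / 2) * η u * d4
  have hP' : ∀ u v, P u v = g u v • ξ - η v • u := by
    intro u v
    rw [← sub_eq_zero]
    refine nondeg _ fun w ↦ ?_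
    simp only [map_sub, map_smul, sub_apply, smul_apply, smul_eq_mul, hP]
    rw [symm ξ w, gξ]; ring
  refine ⟨hP', fun u ↦ ?_⟩
  -- The formula for (∇_u φ)ξ determines φ(∇_u ξ). A second application of φ recovers ∇_u ξ itself,
  -- since ∇_u ξ ⊥ ξ.
  have h1 : φ (X u) = u - η u • ξ := by
    have h := Pξ u
    rw [hP', ηξ, gξ, one_smul] at h
    rw [← neg_eq_iff_eq_neg.2 h]; abel
  have h2 := φφ (X u)
  rw [h1, map_sub, map_smul, φξ, smul_zero, sub_zero, ← gξ, symm, Xξ, zero_smul, add_zero] at h2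
  rw [h2, neg_neg]

end Algebra

section

set_option maxSynthPendingDepth 3

/-! ### First-order jets of functions of one variable -/

section Jet

variable {W W₁ W₂ : Type*} [NormedAddCommGroup W] [NormedSpace ℝ W] [NormedAddCommGroup W₁]
  [NormedSpace ℝ W₁] [NormedAddCommGroup W₂] [NormedSpace ℝ W₂]

/-- The function `f` has value `a` and derivative `a'` at `t`. -/
def HasJet (f : ℝ → W) (t : ℝ) (a a' : W) : Prop := f t = a ∧ HasDerivAt f a' t

namespace HasJet

variable {t : ℝ}

lemma unique {f : ℝ → W} {a a' b b' : W} (h : HasJet f t a a') (h' : HasJet f t b b') : a' = b' :=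
  h.2.unique h'.2

lemma congr {f g : ℝ → W} {a a' : W} (h : HasJet f t a a') (he : g =ᶠ[𝓝 t] f) :
    HasJet g t a a' :=
  ⟨he.self_of_nhds.trans h.1, h.2.congr_of_eventuallyEq he⟩

lemma const (a : W) : HasJet (fun _ ↦ a) t a 0 := ⟨rfl, hasDerivAt_const _ _⟩

lemma add {f g : ℝ → W} {a a' b b' : W} (h : HasJet f t a a') (h' : HasJet g t b b') :
    HasJet (fun s ↦ f s + g s) t (a + b) (a' + b') :=
  ⟨congrArg₂ _ h.1 h'.1, h.2.add h'.2⟩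

lemma sub {f g : ℝ → W} {a a' b b' : W} (h : HasJet f t a a') (h' : HasJet g t b b') :
    HasJet (fun s ↦ f s - g s) t (a - b) (a' - b') :=
  ⟨congrArg₂ _ h.1 h'.1, h.2.sub h'.2⟩

lemma neg {f : ℝ → W} {a a' : W} (h : HasJet f t a a') : HasJet (fun s ↦ -f s) t (-a) (-a') :=
  ⟨congrArg _ h.1, h.2.neg⟩

lemma smul {f : ℝ → ℝ} {g : ℝ → W} {a a' : ℝ} {b b' : W} (h : HasJet f t a a')
    (h' : HasJet g t b b') : HasJet (fun s ↦ f s • g s) t (a • b) (a' • b + a • b') := by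
  refine ⟨congrArg₂ _ h.1 h'.1, ?_⟩
  rw [← h.1, ← h'.1, add_comm]
  exact h.2.smul h'.2

lemma mul {f g : ℝ → ℝ} {a a' b b' : ℝ} (h : HasJet f t a a')
    (h' : HasJet g t b b') : HasJet (fun s ↦ f s * g s) t (a * b) (a' * b + a * b') :=
  h.smul h'

lemma eval {f : ℝ → W₁ →L[ℝ] W} {a a' : W₁ →L[ℝ] W} (h : HasJet f t a a') (v : W₁) :
    HasJet (fun s ↦ f s v) t (a v) (a' v) :=
  ⟨congrArg (fun L ↦ L v) h.1, ((ContinuousLinearMap.apply ℝ W v).hasFDerivAt.comp_hasDerivAt t h.2)⟩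

lemma apply {f : ℝ → W₁ →L[ℝ] W} {p : ℝ → W₁} {a a' : W₁ →L[ℝ] W} {b b' : W₁}
    (h : HasJet f t a a') (h' : HasJet p t b b') :
    HasJet (fun s ↦ f s (p s)) t (a b) (a' b + a b') := by
  refine ⟨congrArg₂ (fun (L : W₁ →L[ℝ] W) v ↦ L v) h.1 h'.1, ?_⟩
  rw [← h.1, ← h'.1]
  exact h.2.clm_apply h'.2

lemma apply₂ {f : ℝ → W₁ →L[ℝ] W₂ →L[ℝ] W} {p : ℝ → W₁} {q : ℝ → W₂}
    {a a' : W₁ →L[ℝ] W₂ →L[ℝ] W} {b b' : W₁} {e e' : W₂}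
    (h : HasJet f t a a') (h' : HasJet p t b b') (h'' : HasJet q t e e') :
    HasJet (fun s ↦ f s (p s) (q s)) t (a b e) (a' b e + a b' e + a b e') :=
  (h.apply h').apply h''

end HasJet

end Jet

/-! ### Riemannian metrics and curvature on an open set of a vector space -/

section Local

variable {V : Type*} [NormedAddCommGroup V] [NormedSpace ℝ V]

/-- A Riemannian metric `g` on an open set of a vector space, with the connection form `Γ` of its
Levi-Civita connection: `∇_w u = D_w u + Γ(w, u)`. -/
structure IsLocalMetric (Ω : Set V) (g : V → V →L[ℝ] V →L[ℝ] ℝ)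
    (Γ : V → V →L[ℝ] V →L[ℝ] V) : Prop where
  isOpen : IsOpen Ω
  smooth_g : ContDiffOn ℝ ∞ g Ω
  smooth_Γ : ContDiffOn ℝ ∞ Γ Ω
  symm : ∀ y ∈ Ω, ∀ u v, g y u v = g y v u
  pos : ∀ y ∈ Ω, ∀ u, u ≠ 0 → 0 < g y u u
  torsion_free : ∀ y ∈ Ω, ∀ u v, Γ y u v = Γ y v u
  metric : ∀ y ∈ Ω, ∀ u v w, fderiv ℝ g y u v w = g y (Γ y u v) w + g y v (Γ y u w)

/-- The curvature operator `R(u, v) w` of the connection with connection form `Γ`. -/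
def localCurvature (Γ : V → V →L[ℝ] V →L[ℝ] V) (y u v w : V) : V :=
  fderiv ℝ Γ y u v w - fderiv ℝ Γ y v u w + Γ y u (Γ y v w) - Γ y v (Γ y u w)

/-- A Sasakian structure on an open set of a vector space. -/
structure IsLocalSasakian (Ω : Set V) (g : V → V →L[ℝ] V →L[ℝ] ℝ) (Γ : V → V →L[ℝ] V →L[ℝ] V)
    (φ : V → V →L[ℝ] V) (ξ : V → V) (η : V → V →L[ℝ] ℝ) : Prop extends IsLocalMetric Ω g Γ where
  smooth_φ : ContDiffOn ℝ ∞ φ Ω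
  smooth_ξ : ContDiffOn ℝ ∞ ξ Ω
  smooth_η : ContDiffOn ℝ ∞ η Ω
  φ_φ : ∀ y ∈ Ω, ∀ v, φ y (φ y v) = -v + η y v • ξ y
  η_ξ : ∀ y ∈ Ω, η y (ξ y) = 1
  g_φ_φ : ∀ y ∈ Ω, ∀ v w, g y (φ y v) (φ y w) = g y v w - η y v * η y w
  contact : ∀ y ∈ Ω, ∀ u v, 1 / 2 * (fderiv ℝ η y u v - fderiv ℝ η y v u) = g y u (φ y v)
  normal : ∀ y ∈ Ω, ∀ u v, fderiv ℝ φ y (φ y u) v - fderiv ℝ φ y (φ y v) u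
    + φ y (fderiv ℝ φ y v u) - φ y (fderiv ℝ φ y u v) = (-2 * g y u (φ y v)) • ξ y

namespace IsLocalMetric

variable {Ω : Set V} {g : V → V →L[ℝ] V →L[ℝ] ℝ} {Γ : V → V →L[ℝ] V →L[ℝ] V}
  (h : IsLocalMetric Ω g Γ) {y : V}
include h

lemma nhds (hy : y ∈ Ω) : Ω ∈ 𝓝 y := h.isOpen.mem_nhds hy

lemma contDiffAt {W : Type*} [NormedAddCommGroup W] [NormedSpace ℝ W] {f : V → W}
    (hf : ContDiffOn ℝ ∞ f Ω) (hy : y ∈ Ω) : ContDiffAt ℝ ∞ f y := hf.contDiffAt (h.nhds hy)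

lemma jet {W : Type*} [NormedAddCommGroup W] [NormedSpace ℝ W] {f : V → W}
    (hf : ContDiffOn ℝ ∞ f Ω) (hy : y ∈ Ω) (u : V) :
    HasJet (fun t : ℝ ↦ f (y + t • u)) 0 (f y) (fderiv ℝ f y u) :=
  ⟨by simp, ((h.contDiffAt hf hy).differentiableAt (by simp)).hasFDerivAt.hasLineDerivAt u⟩

lemma contDiffOn_fderiv {W : Type*} [NormedAddCommGroup W] [NormedSpace ℝ W] {f : V → W}
    (hf : ContDiffOn ℝ ∞ f Ω) : ContDiffOn ℝ ∞ (fderiv ℝ f) Ω :=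
  hf.fderiv_of_isOpen h.isOpen (by simp)

lemma fderiv_fderiv_symm {W : Type*} [NormedAddCommGroup W] [NormedSpace ℝ W] {f : V → W}
    (hf : ContDiffOn ℝ ∞ f Ω) (hy : y ∈ Ω) (u v : V) :
    fderiv ℝ (fderiv ℝ f) y u v = fderiv ℝ (fderiv ℝ f) y v u :=
  (h.contDiffAt hf hy).isSymmSndFDerivAt (by simp; exact ENat.LEInfty.out) u v

/-- The device for differentiating structure equations: the jet of each side is assembled from
product rules along a line, and because Ω is open the identity holds along a short piece of that
line. -/
lemma jet_eq {W : Type*} [NormedAddCommGroup W] [NormedSpace ℝ W] {f₁ f₂ : V → W}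
    (he : ∀ y ∈ Ω, f₁ y = f₂ y) (hy : y ∈ Ω) {u : V} {a a' b b' : W}
    (h₁ : HasJet (fun t : ℝ ↦ f₁ (y + t • u)) 0 a a')
    (h₂ : HasJet (fun t : ℝ ↦ f₂ (y + t • u)) 0 b b') : a' = b' := by
  refine h₁.unique (h₂.congr ?_)
  have hc : ContinuousAt (fun t : ℝ ↦ y + t • u) 0 := by fun_prop
  have hn : Ω ∈ 𝓝 (y + (0 : ℝ) • u) := by simpa using h.nhds hy
  filter_upwards [hc.preimage_mem_nhds hn] with t ht
  exact he _ ht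

lemma nondeg (hy : y ∈ Ω) {u : V} (hu : ∀ v, g y u v = 0) : u = 0 := by
  by_contra hne
  exact (h.pos y hy u hne).ne' (hu u)

lemma curvature_skew (u v w : V) : localCurvature Γ y u v w = -localCurvature Γ y v u w := by
  simp only [localCurvature]; abel

lemma fderiv_symm (hy : y ∈ Ω) (u v w : V) : fderiv ℝ Γ y u v w = fderiv ℝ Γ y u w v := by
  have hΓ := h.jet h.smooth_Γ hy u
  exact h.jet_eq (fun z hz ↦ h.torsion_free z hz v w) hy ((hΓ.eval v).eval w) ((hΓ.eval w).eval v)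

lemma bianchi (hy : y ∈ Ω) (u v w : V) : localCurvature Γ y u v w + localCurvature Γ y v w u
    + localCurvature Γ y w u v = 0 := by
  simp only [localCurvature]
  rw [h.fderiv_symm hy u v w, h.fderiv_symm hy v w u, h.fderiv_symm hy w u v,
    h.torsion_free y hy v w, h.torsion_free y hy u w, h.torsion_free y hy u v]
  abel

/-- Metric compatibility is differentiated a second time and antisymmetrized in the two directions.
The second derivatives of g cancel, and what remains is the curvature. -/
lemma curvature_skew' (hy : y ∈ Ω) (u v w z : V) :
    g y (localCurvature Γ y u v w) z = -g y (localCurvature Γ y u v z) w := by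
  have key (a b : V) := h.jet_eq (u := a) (fun p hp ↦ h.metric p hp b w z) hy
    ((((h.jet (h.contDiffOn_fderiv h.smooth_g) hy a).eval b).eval w).eval z)
    ((((h.jet h.smooth_g hy a).apply (((h.jet h.smooth_Γ hy a).eval b).eval w)).eval z).add
      (((h.jet h.smooth_g hy a).eval w).apply (((h.jet h.smooth_Γ hy a).eval b).eval z)))
  have k1 := key u v
  have k2 := key v u
  have hs : fderiv ℝ (fderiv ℝ g) y u v w z = fderiv ℝ (fderiv ℝ g) y v u w z := by
    rw [h.fderiv_fderiv_symm h.smooth_g hy]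
  simp only [add_apply, h.metric y hy] at k1 k2
  rw [h.symm y hy _ w]
  simp only [localCurvature, map_add, map_sub, add_apply, sub_apply]
  linarith

lemma curvature_pair (hy : y ∈ Ω) (u v w z : V) :
    g y (localCurvature Γ y u v w) z = g y (localCurvature Γ y w z u) v := by
  refine pair_symm_of_bianchi (D := fun u v w z ↦ g y (localCurvature Γ y u v w) z)
    (fun a b e f ↦ ?_) (h.curvature_skew' hy) (fun a b e f ↦ ?_) u v w z
  · rw [h.curvature_skew a b e, map_neg]; rfl
  · rw [← add_apply, ← map_add, ← add_apply, ← map_add, h.bianchi hy]; simp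

lemma curvature_add (u u' v w : V) : localCurvature Γ y (u + u') v w =
    localCurvature Γ y u v w + localCurvature Γ y u' v w := by
  simp only [localCurvature, map_add, add_apply]; abel

lemma curvature_smul (a : ℝ) (u v w : V) : localCurvature Γ y (a • u) v w =
    a • localCurvature Γ y u v w := by
  simp only [localCurvature, map_smul, smul_apply, smul_sub, smul_add]

end IsLocalMetric
end Local

end

/-! ### Covariant derivatives of the structure tensors of a Sasakian structure -/

section

set_option maxSynthPendingDepth 3

namespace IsLocalSasakian

variable {V : Type*} [NormedAddCommGroup V] [NormedSpace ℝ V]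
  {Ω : Set V} {g : V → V →L[ℝ] V →L[ℝ] ℝ} {Γ : V → V →L[ℝ] V →L[ℝ] V}
  {φ : V → V →L[ℝ] V} {ξ : V → V} {η : V → V →L[ℝ] ℝ}
  (h : IsLocalSasakian Ω g Γ φ ξ η) {y : V}
include h

/-- From φ²ξ = 0, the formula for φ² applied to φξ shows that φξ = aξ for some a. Then φ²ξ = a²ξ, so
a = 0. -/
lemma φ_ξ (hy : y ∈ Ω) : φ y (ξ y) = 0 := by
  have h1 : φ y (φ y (ξ y)) = 0 := by rw [h.φ_φ y hy, h.η_ξ y hy]; simp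
  have h2 := h.φ_φ y hy (φ y (ξ y))
  rw [h1, map_zero] at h2
  have h3 : φ y (ξ y) = η y (φ y (ξ y)) • ξ y := by
    rw [eq_comm, neg_add_eq_zero] at h2; exact h2
  obtain ⟨a, ha⟩ : ∃ a : ℝ, φ y (ξ y) = a • ξ y := ⟨_, h3⟩
  rw [ha, map_smul, ha, smul_smul] at h1
  have h5 := congrArg (η y) h1
  rw [map_smul, h.η_ξ y hy, map_zero, smul_eq_mul, mul_one, mul_self_eq_zero] at h5
  rw [ha, h5, zero_smul]

lemma η_φ (hy : y ∈ Ω) (v : V) : η y (φ y v) = 0 := by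
  have h1 := h.φ_φ y hy (φ y v)
  rw [h.φ_φ y hy v, map_add, map_neg, map_smul, h.φ_ξ hy, smul_zero, add_zero, left_eq_add] at h1
  have h2 := congrArg (η y) h1
  rwa [map_smul, h.η_ξ y hy, map_zero, smul_eq_mul, mul_one] at h2

lemma g_ξ (hy : y ∈ Ω) (v : V) : g y v (ξ y) = η y v := by
  have h1 := h.g_φ_φ y hy v (ξ y)
  rw [h.φ_ξ hy, map_zero, h.η_ξ y hy] at h1
  linarith

lemma skew (hy : y ∈ Ω) (v w : V) : g y (φ y v) w = -g y v (φ y w) := by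
  have h1 := h.g_φ_φ y hy (φ y v) w
  rw [h.η_φ hy, h.φ_φ y hy, map_add, map_neg, map_smul, add_apply, neg_apply, smul_apply,
    h.symm y hy (ξ y), h.g_ξ hy, h.η_φ hy, smul_zero] at h1
  linarith

/-- The hypotheses of `nabla_phi_of_normal` are derivatives of the structure equations; metric
compatibility and vanishing torsion turn the partial derivatives into covariant ones. -/
lemma nabla_phi_and_nabla_xi (hy : y ∈ Ω) :
    (∀ u v, fderiv ℝ φ y u v + Γ y u (φ y v) - φ y (Γ y u v) = g y u v • ξ y - η y v • u) ∧
      ∀ u, fderiv ℝ ξ y u + Γ y u (ξ y) = -φ y u := by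
  have jφ := h.jet h.smooth_φ hy
  have jξ := h.jet h.smooth_ξ hy
  have jη := h.jet h.smooth_η hy
  have jg := h.jet h.smooth_g hy
  have m := h.metric y hy
  have sy := h.symm y hy
  have e1 (u v) := h.jet_eq (u := u) (fun z hz ↦ h.φ_φ z hz v) hy
    ((jφ u).apply ((jφ u).eval v)) ((HasJet.const (-v)).add (((jη u).eval v).smul (jξ u)))
  have e2 (u v) := h.jet_eq (u := u) (fun z hz ↦ h.g_ξ hz v) hy
    (((jg u).eval v).apply (jξ u)) ((jη u).eval v)
  have e3 (u v w) := h.jet_eq (u := u) (fun z hz ↦ h.skew hz v w) hy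
    (((jg u).apply ((jφ u).eval v)).eval w) (((jg u).eval v).apply ((jφ u).eval w)).neg
  have e4 (u) := h.jet_eq (u := u) (fun z hz ↦ h.φ_ξ hz) hy
    ((jφ u).apply (jξ u)) (HasJet.const 0)
  have e5 (u) := h.jet_eq (u := u) (fun z hz ↦ h.η_ξ z hz) hy
    ((jη u).apply (jξ u)) (HasJet.const 1)
  have jη' (u) := h.jet (h.contDiffOn_fderiv h.smooth_η) hy u
  have e6 (u v w) := h.jet_eq (u := u) (fun z hz ↦ h.contact z hz v w) hy
    ((HasJet.const (1 / 2 : ℝ)).mul ((((jη' u).eval v).eval w).sub (((jη' u).eval w).eval v)))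
    (((jg u).eval v).apply ((jφ u).eval w))
  -- As η is the metric dual of ξ, ∇ξ is the dual of ∇η. This links ∇ξ to the contact condition,
  -- which is stated for derivatives of η.
  have B (u v) : g y v (fderiv ℝ ξ y u + Γ y u (ξ y)) = fderiv ℝ η y u v - η y (Γ y u v) := by
    rw [map_add, ← e2, m, ← h.g_ξ hy (Γ y u v)]; ring
  refine nabla_phi_of_normal (P := fun u v ↦ fderiv ℝ φ y u v + Γ y u (φ y v) - φ y (Γ y u v))
    (X := fun u ↦ fderiv ℝ ξ y u + Γ y u (ξ y)) sy (fun _ ↦ h.nondeg hy) (h.φ_φ y hy)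
    (h.η_ξ y hy) (h.φ_ξ hy) (h.η_φ hy) (h.g_ξ hy) (h.g_φ_φ y hy) (h.skew hy) ?_ ?_ ?_ ?_ ?_ ?_ ?_
  · intro u v
    have := e1 u v
    rw [B]
    simp only [map_add, map_sub, map_neg, map_smul, h.φ_φ y hy] at this ⊢
    rw [zero_add] at this
    linear_combination (norm := module) this
  · intro u v w
    have := e3 u v w
    simp only [map_add, map_sub, add_apply, sub_apply, m, h.skew hy] at this ⊢
    have s1 := h.skew hy (Γ y u v) w
    have s2 := h.skew hy v (Γ y u w)
    linarith
  · intro u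
    have := e4 u
    simp only [h.φ_ξ hy, map_zero, add_zero, map_add] at this ⊢
    linear_combination (norm := module) this
  · intro u
    have := e5 u
    rw [map_add, sy, h.g_ξ hy, sy, h.g_ξ hy]
    have b := B u (ξ y)
    rw [map_add, sy, h.g_ξ hy, sy, h.g_ξ hy] at b
    linarith
  · intro u v
    rw [B, B, h.torsion_free y hy u v]
    linarith [h.contact y hy u v]
  · intro u v w
    have k1 := e6 u w v
    have k2 := e6 v u w
    have k3 := e6 w v u
    -- The fundamental form is dη, hence closed: in the cyclic sum of the differentiated contact
    -- condition the second derivatives of η cancel in pairs.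
    have s1 : fderiv ℝ (fderiv ℝ η) y u v w = fderiv ℝ (fderiv ℝ η) y v u w := by
      rw [h.fderiv_fderiv_symm h.smooth_η hy]
    have s2 : fderiv ℝ (fderiv ℝ η) y v w u = fderiv ℝ (fderiv ℝ η) y w v u := by
      rw [h.fderiv_fderiv_symm h.smooth_η hy]
    have s3 : fderiv ℝ (fderiv ℝ η) y w u v = fderiv ℝ (fderiv ℝ η) y u w v := by
      rw [h.fderiv_fderiv_symm h.smooth_η hy]
    have t (a b e) : g y e (φ y (Γ y a b)) = -g y (Γ y a b) (φ y e) := by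
      rw [sy _ (φ y e), h.skew hy, neg_neg]
    simp only [m] at k1 k2 k3
    rw [sy _ w, sy _ u, sy _ v]
    simp only [map_add, map_sub, t]
    rw [h.torsion_free y hy w v] at k3
    rw [h.torsion_free y hy v u] at k2
    rw [h.torsion_free y hy u w] at k1
    linarith
  · intro u v
    have := h.normal y hy u v
    simp only [map_add, map_sub, h.φ_φ y hy]
    rw [h.torsion_free y hy (φ y u) (φ y v), h.torsion_free y hy (φ y u) v,
      h.torsion_free y hy (φ y v) u, h.torsion_free y hy v u]
    linear_combination (norm := module) this

end IsLocalSasakian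

end

/-! ### Curvature of Sasakian structures and of Sasakian space forms -/

section

set_option maxSynthPendingDepth 3

namespace IsLocalSasakian

variable {V : Type*} [NormedAddCommGroup V] [NormedSpace ℝ V]
  {Ω : Set V} {g : V → V →L[ℝ] V →L[ℝ] ℝ} {Γ : V → V →L[ℝ] V →L[ℝ] V}
  {φ : V → V →L[ℝ] V} {ξ : V → V} {η : V → V →L[ℝ] ℝ}
  (h : IsLocalSasakian Ω g Γ φ ξ η) {y : V}
include h

lemma fderiv_φ (hy : y ∈ Ω) (u v : V) :
    fderiv ℝ φ y u v = g y u v • ξ y - η y v • u - Γ y u (φ y v) + φ y (Γ y u v) := by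
  rw [← (h.nabla_phi_and_nabla_xi hy).1 u v]; abel

lemma fderiv_ξ (hy : y ∈ Ω) (u : V) : fderiv ℝ ξ y u = -φ y u - Γ y u (ξ y) := by
  rw [← (h.nabla_phi_and_nabla_xi hy).2 u]; abel

lemma fderiv_η (hy : y ∈ Ω) (u v : V) : fderiv ℝ η y u v = η y (Γ y u v) - g y v (φ y u) := by
  have e2 := h.jet_eq (u := u) (fun z hz ↦ h.g_ξ hz v) hy
    (((h.jet h.smooth_g hy u).eval v).apply (h.jet h.smooth_ξ hy u))
    ((h.jet h.smooth_η hy u).eval v)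
  rw [← e2, h.metric y hy, h.fderiv_ξ hy, ← h.g_ξ hy]
  simp only [map_sub, map_neg]; ring

/-- Ricci identity: differentiating ∇ξ = −φ and antisymmetrizing gives R(u, v)ξ = (∇_v φ)u − (∇_u
φ)v, where the ξ-components cancel by the symmetry of g. -/
lemma curvature_ξ (hy : y ∈ Ω) (u v : V) :
    localCurvature Γ y u v (ξ y) = η y v • u - η y u • v := by
  have key (a b) := h.jet_eq (u := a) (fun z hz ↦ h.fderiv_ξ hz b) hy
    ((h.jet (h.contDiffOn_fderiv h.smooth_ξ) hy a).eval b)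
    (((h.jet h.smooth_φ hy a).eval b).neg.sub
      (((h.jet h.smooth_Γ hy a).eval b).apply (h.jet h.smooth_ξ hy a)))
  have k1 := key u v
  have k2 := key v u
  rw [h.fderiv_fderiv_symm h.smooth_ξ hy v u] at k2
  rw [k1] at k2
  simp only [h.fderiv_φ hy, h.fderiv_ξ hy, map_sub, map_neg] at k2
  rw [h.torsion_free y hy v u, h.symm y hy v u] at k2
  simp only [localCurvature]
  linear_combination (norm := module) -k2

/-- Ricci identity for φ: the commutator of R(u, v) with φ is the antisymmetrized covariant
derivative of (∇_v φ)w = g(v, w)ξ − η(w)v. -/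
lemma curvature_φ (hy : y ∈ Ω) (u v w : V) :
    localCurvature Γ y u v (φ y w) = φ y (localCurvature Γ y u v w) - g y v w • φ y u
      + g y (φ y u) w • v + g y u w • φ y v - g y (φ y v) w • u := by
  have key (a b) := h.jet_eq (u := a) (fun z hz ↦ h.fderiv_φ hz b w) hy
    (((h.jet (h.contDiffOn_fderiv h.smooth_φ) hy a).eval b).eval w)
    (((((((h.jet h.smooth_g hy a).eval b).eval w).smul (h.jet h.smooth_ξ hy a)).sub
      (((h.jet h.smooth_η hy a).eval w).smul (HasJet.const b))).sub
      (((h.jet h.smooth_Γ hy a).eval b).apply ((h.jet h.smooth_φ hy a).eval w))).add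
      ((h.jet h.smooth_φ hy a).apply (((h.jet h.smooth_Γ hy a).eval b).eval w)))
  have k1 := key u v
  have k2 := key v u
  rw [h.fderiv_fderiv_symm h.smooth_φ hy v u] at k2
  rw [k1] at k2
  simp only [h.fderiv_φ hy, h.fderiv_ξ hy, h.fderiv_η hy, h.metric y hy, map_sub, map_add,
    map_smul] at k2
  have s1 : g y w (φ y u) = g y (φ y u) w := h.symm y hy _ _
  have s2 : g y w (φ y v) = g y (φ y v) w := h.symm y hy _ _
  rw [h.torsion_free y hy v u, s1, s2] at k2
  simp only [localCurvature, map_add, map_sub]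
  linear_combination (norm := module) -k2

/-- The curvature of a Sasakian space form on an anti-invariant horizontal plane. -/
theorem curvature_eq_of_phiSectional {c : ℝ} (hy : y ∈ Ω)
    (hc : ∀ u, η y u = 0 → g y u u = 1 →
      g y (localCurvature Γ y u (φ y u) (φ y u)) u = c)
    {u w : V} (hu : η y u = 0) (hw : η y w = 0) (huw : g y w (φ y u) = 0) (v : V) :
    g y (localCurvature Γ y v u u) w = (c + 3) / 4 * (g y u u * g y v w - g y v u * g y u w) := by
  have sy := h.symm y hy
  have sk := h.skew hy
  have Rs := h.curvature_skew (Γ := Γ) (y := y)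
  have Rs' := h.curvature_skew' hy
  have Rp := h.curvature_pair hy
  have hφφ : ∀ a, η y a = 0 → φ y (φ y a) = -a := fun a ha ↦ by rw [h.φ_φ y hy, ha]; simp
  have gφφ : ∀ a, η y a = 0 → ∀ b, g y (φ y a) (φ y b) = g y a b := fun a ha b ↦ by
    rw [h.g_φ_φ y hy, ha]; simp
  -- Two conditions fix the constants: (c + 3)/4 − (c − 1)/4 = 1 compensates the extra terms of
  -- `curvature_φ`, so that D is φ-invariant on ker η, and (c + 3)/4 + 3(c − 1)/4 = c makes its
  -- φ-sectional curvatures vanish.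
  let D : V → V → V → V → ℝ := fun a b e f ↦ g y (localCurvature Γ y a b e) f
    - (c + 3) / 4 * (g y b e * g y a f - g y a e * g y b f)
    - (c - 1) / 4 * (g y a (φ y e) * g y (φ y b) f - g y b (φ y e) * g y (φ y a) f
      + 2 * g y a (φ y b) * g y (φ y e) f)
  have hol1 : ∀ a, η y a = 0 →
      g y (localCurvature Γ y a (φ y a) (φ y a)) a = c * g y a a ^ 2 := by
    intro a ha
    by_cases h0 : a = 0
    · subst h0; simp
    have hp := h.pos y hy a h0
    set s := Real.sqrt (g y a a) with hs
    have hs0 : s ≠ 0 := (Real.sqrt_pos.2 hp).ne'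
    have hss : s * s = g y a a := Real.mul_self_sqrt hp.le
    have h1 := hc (s⁻¹ • a) (by rw [map_smul, ha, smul_zero]) (by
      simp only [map_smul, smul_apply, smul_eq_mul]
      rw [← hss]; field_simp)
    have h2 : localCurvature Γ y (s⁻¹ • a) (φ y (s⁻¹ • a)) (φ y (s⁻¹ • a)) =
        s⁻¹ • s⁻¹ • s⁻¹ • localCurvature Γ y a (φ y a) (φ y a) := by
      simp only [localCurvature, map_smul, smul_apply, smul_sub, smul_add]
    rw [h2] at h1
    simp only [map_smul, smul_apply, smul_eq_mul] at h1
    rw [← h1, ← hss]; field_simp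
  have an (a b : V) : g y a (φ y b) = -g y b (φ y a) := by rw [← sk, sy]
  have an0 (a : V) : g y a (φ y a) = 0 := by linarith [an a a]
  have Dskew : ∀ a b e f, D a b e f = -D b a e f := by
    intro a b e f
    simp only [D, sk, an b a]
    rw [Rs b a e, map_neg, neg_apply]
    ring
  have Dpair : ∀ a b e f, D a b e f = D e f a b := by
    intro a b e f
    simp only [D, sk, an e a, an f a, an e b, an f b, sy e a, sy f a, sy e b, sy f b]
    rw [Rp a b e f]
    ring
  have Dadd : ∀ a a' b e f, D (a + a') b e f = D a b e f + D a' b e f := by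
    intro a a' b e f
    simp only [D, h.curvature_add, map_add, add_apply]; ring
  have Dskew' : ∀ a b e f, D a b e f = -D a b f e := fun a b e f ↦ by rw [Dpair, Dskew, Dpair]
  have main : ∀ a, η y a = 0 → D a u u a = 0 := by
    intro a ha
    refine biquadratic_eq_zero_of_holomorphic_eq_zero (D := D) (H := LinearMap.ker (η y).toLinearMap)
      (J := φ y) (fun a _ ↦ h.η_φ hy a) hφφ Dadd Dskew Dpair ?_ ?_ ?_ ha hu
    · intro a b e f
      have hb : g y (localCurvature Γ y a b e) f + g y (localCurvature Γ y b e a) f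
          + g y (localCurvature Γ y e a b) f = 0 := by
        rw [← add_apply, ← map_add, ← add_apply, ← map_add, h.bianchi hy]; simp
      simp only [D, sk, an b a, an e a, an e b, sy b a, sy e a, sy e b]
      linear_combination hb
    · intro a ha b hb e he f hf
      have hf' : η y f = 0 := hf
      have he' : η y e = 0 := he
      have h1 : g y (φ y (localCurvature Γ y a b e)) (φ y f) = g y (localCurvature Γ y a b e) f := by
        rw [h.g_φ_φ y hy, hf', mul_zero, sub_zero]
      simp only [D, h.curvature_φ hy, map_add, map_sub, map_smul, add_apply, sub_apply, smul_apply,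
        smul_eq_mul, h1]
      simp only [sk, hφφ e he', hφφ f hf', map_neg, neg_apply]
      ring
    · intro a ha
      have ha' : η y a = 0 := ha
      simp only [D]
      rw [hol1 a ha', gφφ a ha', hφφ a ha', an0]
      simp only [sk, map_neg, neg_apply, an0]
      ring
  -- Polarization of the quadratic form a ↦ D a u u a, which comes from a symmetric bilinear form by
  -- the pair symmetry.
  have polar : ∀ a b, η y a = 0 → η y b = 0 → D a u u b = 0 := by
    intro a b ha hb
    have k := main (a + b) (by rw [map_add, ha, hb, add_zero])
    have k1 : D (a + b) u u (a + b) = D a u u a + D b u u a + (D a u u b + D b u u b) := by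
      rw [Dadd, Dpair a, Dpair b, Dskew u (a + b), Dskew u (a + b), Dadd, Dadd, Dskew' a u a u,
        Dskew' b u a u, Dskew' a u b u, Dskew' b u b u]
      ring
    have k2 : D b u u a = D a u u b := by
      rw [Dpair, Dskew, Dpair, Dskew, neg_neg, Dpair]
    linarith [main a ha, main b hb]
  have hw' : g y (φ y u) w = 0 := by rw [sy, huw]
  -- Only the horizontal part of v matters, because the ξ-part contributes nothing by `curvature_ξ`.
  -- The (c − 1)/4 part of the model drops out since w ⊥ φu.
  have vh : η y (v - η y v • ξ y) = 0 := by rw [map_sub, map_smul, h.η_ξ y hy]; simp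
  have k := polar _ w vh hw
  have e1 : localCurvature Γ y v u u = localCurvature Γ y (v - η y v • ξ y) u u
      + η y v • localCurvature Γ y (ξ y) u u := by
    rw [← h.curvature_smul, ← h.curvature_add, sub_add_cancel]
  have e2 : g y (localCurvature Γ y (ξ y) u u) w = 0 := by
    rw [Rp, h.curvature_ξ hy, hu, hw]; simp
  have e3 : g y (ξ y) w = 0 := by rw [sy, h.g_ξ hy, hw]
  have e4 : g y (ξ y) u = 0 := by rw [sy, h.g_ξ hy, hu]
  simp only [D, hw', an0, map_sub, map_smul, sub_apply, smul_apply, smul_eq_mul, e3, e4] at k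
  rw [e1, map_add, add_apply, map_smul, smul_apply, e2, smul_zero]
  linarith

end IsLocalSasakian

end

/-! ### First variation of the energy and bienergy densities in a vector space -/

section

set_option maxSynthPendingDepth 3

section FlatVariation

variable {V : Type*} [NormedAddCommGroup V] [NormedSpace ℝ V]

/-- The covariant derivative of `v` along the curve `c`, for the connection form `Γ`. -/
def flatCov (Γ : V → V →L[ℝ] V →L[ℝ] V) (c v : ℝ → V) (t : ℝ) : V :=
  deriv v t + Γ (c t) (deriv c t) (v t)

lemma IsLocalMetric.hasDerivAt_metric {Ω : Set V} {g : V → V →L[ℝ] V →L[ℝ] ℝ}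
    {Γ : V → V →L[ℝ] V →L[ℝ] V} (h : IsLocalMetric Ω g Γ) {c v w : ℝ → V} {t : ℝ}
    (hc : DifferentiableAt ℝ c t) (hv : DifferentiableAt ℝ v t) (hw : DifferentiableAt ℝ w t)
    (hy : c t ∈ Ω) :
    HasDerivAt (fun s ↦ g (c s) (v s) (w s))
      (g (c t) (flatCov Γ c v t) (w t) + g (c t) (v t) (flatCov Γ c w t)) t := by
  have hg : HasDerivAt (fun s ↦ g (c s)) (fderiv ℝ g (c t) (deriv c t)) t :=
    ((h.contDiffAt h.smooth_g hy).differentiableAt (by simp)).hasFDerivAt.comp_hasDerivAt t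
      hc.hasDerivAt
  refine ((hg.clm_apply hv.hasDerivAt).clm_apply hw.hasDerivAt).congr_deriv ?_
  simp only [flatCov, map_add, add_apply, h.metric _ hy]
  ring

variable {W : Type*} [NormedAddCommGroup W] [NormedSpace ℝ W] {U : Set (ℝ × ℝ)} {s t : ℝ}

lemma hasDerivAt_snd {f : ℝ × ℝ → W} (hf : DifferentiableAt ℝ f (s, t)) :
    HasDerivAt (fun u ↦ f (s, u)) (fderiv ℝ f (s, t) (0, 1)) t :=
  hf.hasFDerivAt.comp_hasDerivAt t ((hasDerivAt_const t s).prodMk (hasDerivAt_id t))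

lemma hasDerivAt_fst {f : ℝ × ℝ → W} (hf : DifferentiableAt ℝ f (s, t)) :
    HasDerivAt (fun r ↦ f (r, t)) (fderiv ℝ f (s, t) (1, 0)) s :=
  hf.hasFDerivAt.comp_hasDerivAt s ((hasDerivAt_id s).prodMk (hasDerivAt_const s t))

lemma differentiableAt_of_mem {f : ℝ × ℝ → W} (hU : IsOpen U) (hf : ContDiffOn ℝ ∞ f U)
    (h : (s, t) ∈ U) : DifferentiableAt ℝ f (s, t) :=
  (hf.contDiffAt (hU.mem_nhds h)).differentiableAt (by simp)

lemma contDiffOn_fderiv_plane {f : ℝ × ℝ → W} (hU : IsOpen U) (hf : ContDiffOn ℝ ∞ f U) :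
    ContDiffOn ℝ ∞ (fderiv ℝ f) U :=
  hf.fderiv_of_isOpen hU (by simp)

lemma eventually_mem_snd (hU : IsOpen U) (h : (s, t) ∈ U) : ∀ᶠ u in 𝓝 t, (s, u) ∈ U := by
  have hc : ContinuousAt (fun u : ℝ ↦ (s, u)) t := by fun_prop
  exact hc.preimage_mem_nhds (hU.mem_nhds h)

lemma eventually_mem_fst (hU : IsOpen U) (h : (s, t) ∈ U) : ∀ᶠ r in 𝓝 s, (r, t) ∈ U := by
  have hc : ContinuousAt (fun r : ℝ ↦ (r, t)) s := by fun_prop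
  exact hc.preimage_mem_nhds (hU.mem_nhds h)

lemma deriv_snd {f : ℝ × ℝ → V} (hU : IsOpen U) (hf : ContDiffOn ℝ ∞ f U) (h : (s, t) ∈ U) :
    deriv (fun u ↦ f (s, u)) t = fderiv ℝ f (s, t) (0, 1) :=
  (hasDerivAt_snd (differentiableAt_of_mem hU hf h)).deriv

lemma deriv_deriv_snd {f : ℝ × ℝ → V} (hU : IsOpen U) (hf : ContDiffOn ℝ ∞ f U)
    (h : (s, t) ∈ U) :
    deriv (deriv fun u ↦ f (s, u)) t = fderiv ℝ (fderiv ℝ f) (s, t) (0, 1) (0, 1) := by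
  have h1 : (deriv fun u ↦ f (s, u)) =ᶠ[𝓝 t] fun u ↦ fderiv ℝ f (s, u) (0, 1) := by
    filter_upwards [eventually_mem_snd hU h] with u hu
    exact deriv_snd hU hf hu
  rw [h1.deriv_eq]
  exact ((hasDerivAt_snd (differentiableAt_of_mem hU (contDiffOn_fderiv_plane hU hf) h)).clm_apply
    (hasDerivAt_const t _)).deriv.trans (by simp)

/-- The coordinate expression of the tension field of the curves `f (s, ·)`. -/
lemma flatCov_deriv {f : ℝ × ℝ → V} (hU : IsOpen U) (hf : ContDiffOn ℝ ∞ f U)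
    (h : (s, t) ∈ U) (Γ : V → V →L[ℝ] V →L[ℝ] V) :
    flatCov Γ (fun u ↦ f (s, u)) (deriv fun u ↦ f (s, u)) t =
      fderiv ℝ (fderiv ℝ f) (s, t) (0, 1) (0, 1)
        + Γ (f (s, t)) (fderiv ℝ f (s, t) (0, 1)) (fderiv ℝ f (s, t) (0, 1)) := by
  rw [flatCov, deriv_deriv_snd hU hf h, deriv_snd hU hf h]

variable {Ω : Set V} {g : V → V →L[ℝ] V →L[ℝ] ℝ} {Γ : V → V →L[ℝ] V →L[ℝ] V}

lemma IsLocalMetric.contDiffAt_energy (h : IsLocalMetric Ω g Γ) {f : ℝ × ℝ → V} (hU : IsOpen U)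
    (hf : ContDiffOn ℝ ∞ f U) {p : ℝ × ℝ} (hp : p ∈ U) (hy : f p ∈ Ω) :
    ContDiffAt ℝ ∞ (fun q ↦ g (f q) (fderiv ℝ f q (0, 1)) (fderiv ℝ f q (0, 1))) p := by
  have h0 := hf.contDiffAt (hU.mem_nhds hp)
  have h1 := ((contDiffOn_fderiv_plane hU hf).contDiffAt (hU.mem_nhds hp)).clm_apply
    (contDiffAt_const (c := ((0 : ℝ), (1 : ℝ))))
  exact (((h.contDiffAt h.smooth_g hy).comp p h0).clm_apply h1).clm_apply h1

lemma IsLocalMetric.contDiffAt_bienergy (h : IsLocalMetric Ω g Γ) {f : ℝ × ℝ → V} (hU : IsOpen U)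
    (hf : ContDiffOn ℝ ∞ f U) {p : ℝ × ℝ} (hp : p ∈ U) (hy : f p ∈ Ω) :
    ContDiffAt ℝ ∞ (fun q ↦ g (f q)
      (fderiv ℝ (fderiv ℝ f) q (0, 1) (0, 1)
        + Γ (f q) (fderiv ℝ f q (0, 1)) (fderiv ℝ f q (0, 1)))
      (fderiv ℝ (fderiv ℝ f) q (0, 1) (0, 1)
        + Γ (f q) (fderiv ℝ f q (0, 1)) (fderiv ℝ f q (0, 1)))) p := by
  have h0 := hf.contDiffAt (hU.mem_nhds hp)
  have h1 := ((contDiffOn_fderiv_plane hU hf).contDiffAt (hU.mem_nhds hp)).clm_apply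
    (contDiffAt_const (c := ((0 : ℝ), (1 : ℝ))))
  have h2 := (((contDiffOn_fderiv_plane hU (contDiffOn_fderiv_plane hU hf)).contDiffAt
    (hU.mem_nhds hp)).clm_apply (contDiffAt_const (c := ((0 : ℝ), (1 : ℝ))))).clm_apply
    (contDiffAt_const (c := ((0 : ℝ), (1 : ℝ))))
  have h3 := h2.add ((((h.contDiffAt h.smooth_Γ hy).comp p h0).clm_apply h1).clm_apply h1)
  exact (((h.contDiffAt h.smooth_g hy).comp p h0).clm_apply h3).clm_apply h3

/-- The underlying identity is ∇_s ∂_t f = ∇_t ∂_s f, from symmetric second partials and vanishing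
torsion. The field S only has to agree with ∂_s f along the slice near t, so that a field along the
curve can be inserted later. -/
lemma IsLocalMetric.hasDerivAt_energy (h : IsLocalMetric Ω g Γ) {f : ℝ × ℝ → V} (hU : IsOpen U)
    (hf : ContDiffOn ℝ ∞ f U) (hp : (s, t) ∈ U) (hy : f (s, t) ∈ Ω) {S : ℝ → V}
    (hS : ∀ᶠ u in 𝓝 t, S u = fderiv ℝ f (s, u) (1, 0)) :
    HasDerivAt (fun r ↦ g (f (r, t)) (fderiv ℝ f (r, t) (0, 1)) (fderiv ℝ f (r, t) (0, 1)))
      (2 * g (f (s, t)) (flatCov Γ (fun u ↦ f (s, u)) S t) (deriv (fun u ↦ f (s, u)) t)) s := by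
  have hA := contDiffOn_fderiv_plane hU hf
  have dA := differentiableAt_of_mem hU hA hp
  have df := differentiableAt_of_mem hU hf hp
  have d1 : HasDerivAt (fun r ↦ fderiv ℝ f (r, t) (0, 1)) (fderiv ℝ (fderiv ℝ f) (s, t) (1, 0) (0, 1)) s :=
    ((hasDerivAt_fst dA).clm_apply (hasDerivAt_const s _)).congr_deriv (by simp)
  have d2 : HasDerivAt (fun u ↦ fderiv ℝ f (s, u) (1, 0)) (fderiv ℝ (fderiv ℝ f) (s, t) (0, 1) (1, 0)) t :=
    ((hasDerivAt_snd dA).clm_apply (hasDerivAt_const t _)).congr_deriv (by simp)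
  have sym : fderiv ℝ (fderiv ℝ f) (s, t) (0, 1) (1, 0) = fderiv ℝ (fderiv ℝ f) (s, t) (1, 0) (0, 1) :=
    (hf.contDiffAt (hU.mem_nhds hp)).isSymmSndFDerivAt (by simp; exact ENat.LEInfty.out) _ _
  have key := h.hasDerivAt_metric (hasDerivAt_fst df).differentiableAt d1.differentiableAt
    d1.differentiableAt hy
  refine key.congr_deriv ?_
  have hS' : deriv S t = fderiv ℝ (fderiv ℝ f) (s, t) (1, 0) (0, 1) := by
    rw [Filter.EventuallyEq.deriv_eq hS, d2.deriv, sym]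
  simp only [flatCov]
  rw [d1.deriv, hS', (hasDerivAt_fst df).deriv, deriv_snd hU hf hp, hS.self_of_nhds,
    h.torsion_free _ hy (fderiv ℝ f (s, t) (0, 1)), h.symm _ hy (fderiv ℝ f (s, t) (0, 1))]
  ring

/-- The underlying identity is ∇_s ∇_t ∂_t f = ∇_t ∇_t ∂_s f + R(∂_s f, ∂_t f)∂_t f. The third
partials of f agree on both sides, and the difference of the derivatives of Γ supplies the
curvature. -/
lemma IsLocalMetric.hasDerivAt_bienergy (h : IsLocalMetric Ω g Γ) {f : ℝ × ℝ → V}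
    (hU : IsOpen U) (hf : ContDiffOn ℝ ∞ f U) (hp : (s, t) ∈ U) (hy : f (s, t) ∈ Ω) {S : ℝ → V}
    (hS : ∀ᶠ u in 𝓝 t, S u = fderiv ℝ f (s, u) (1, 0)) :
    HasDerivAt (fun r ↦ g (f (r, t))
      (fderiv ℝ (fderiv ℝ f) (r, t) (0, 1) (0, 1)
        + Γ (f (r, t)) (fderiv ℝ f (r, t) (0, 1)) (fderiv ℝ f (r, t) (0, 1)))
      (fderiv ℝ (fderiv ℝ f) (r, t) (0, 1) (0, 1)
        + Γ (f (r, t)) (fderiv ℝ f (r, t) (0, 1)) (fderiv ℝ f (r, t) (0, 1))))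
      (2 * (g (f (s, t)) (flatCov Γ (fun u ↦ f (s, u)) (flatCov Γ (fun u ↦ f (s, u)) S) t)
          (flatCov Γ (fun u ↦ f (s, u)) (deriv fun u ↦ f (s, u)) t)
        + g (f (s, t)) (localCurvature Γ (f (s, t)) (S t) (deriv (fun u ↦ f (s, u)) t)
          (deriv (fun u ↦ f (s, u)) t))
          (flatCov Γ (fun u ↦ f (s, u)) (deriv fun u ↦ f (s, u)) t))) s := by
  have hA := contDiffOn_fderiv_plane hU hf
  have hB := contDiffOn_fderiv_plane hU hA
  have df := differentiableAt_of_mem hU hf hp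
  have dA := differentiableAt_of_mem hU hA hp
  have dB := differentiableAt_of_mem hU hB hp
  have dΓ := (h.contDiffAt h.smooth_Γ hy).differentiableAt (by simp)
  have symB : ∀ q ∈ U, fderiv ℝ (fderiv ℝ f) q (0, 1) (1, 0) = fderiv ℝ (fderiv ℝ f) q (1, 0) (0, 1) :=
    fun q hq ↦
    (hf.contDiffAt (hU.mem_nhds hq)).isSymmSndFDerivAt (by simp; exact ENat.LEInfty.out) _ _
  have symC : fderiv ℝ (fderiv ℝ (fderiv ℝ f)) (s, t) (0, 1) (1, 0) =
      fderiv ℝ (fderiv ℝ (fderiv ℝ f)) (s, t) (1, 0) (0, 1) :=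
    (hA.contDiffAt (hU.mem_nhds hp)).isSymmSndFDerivAt (by simp; exact ENat.LEInfty.out) _ _
  set y := f (s, t) with hy'
  set T := fderiv ℝ f (s, t) (0, 1) with hT
  set Z := fderiv ℝ f (s, t) (1, 0) with hZ
  set TT := fderiv ℝ (fderiv ℝ f) (s, t) (0, 1) (0, 1) with hTT
  set TZ := fderiv ℝ (fderiv ℝ f) (s, t) (0, 1) (1, 0) with hTZ
  set TTZ := fderiv ℝ (fderiv ℝ (fderiv ℝ f)) (s, t) (0, 1) (0, 1) (1, 0) with hTTZ
  -- jets in the direction of the variation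
  have jf : HasJet (fun r ↦ f (r, t)) s y Z := ⟨rfl, hasDerivAt_fst df⟩
  have jT : HasJet (fun r ↦ fderiv ℝ f (r, t) (0, 1)) s T TZ := by
    rw [hTZ, symB _ hp]
    exact HasJet.eval ⟨rfl, hasDerivAt_fst dA⟩ (0, 1)
  have symBC : fderiv ℝ (fderiv ℝ (fderiv ℝ f)) (s, t) (0, 1) (1, 0) (0, 1) = TTZ := by
    have j1 : HasJet (fun u ↦ fderiv ℝ (fderiv ℝ f) (s, u) (1, 0) (0, 1)) t _ _ :=
      HasJet.eval (HasJet.eval ⟨rfl, hasDerivAt_snd dB⟩ (1, 0)) (0, 1)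
    have j2 : HasJet (fun u ↦ fderiv ℝ (fderiv ℝ f) (s, u) (0, 1) (1, 0)) t _ _ :=
      HasJet.eval (HasJet.eval ⟨rfl, hasDerivAt_snd dB⟩ (0, 1)) (1, 0)
    refine j1.unique (j2.congr ?_)
    filter_upwards [eventually_mem_snd hU hp] with u hu
    exact (symB _ hu).symm
  have jTT : HasJet (fun r ↦ fderiv ℝ (fderiv ℝ f) (r, t) (0, 1) (0, 1)) s TT TTZ := by
    rw [← symBC, symC]
    exact HasJet.eval (HasJet.eval ⟨rfl, hasDerivAt_fst dB⟩ (0, 1)) (0, 1)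
  have jΓ : HasJet (fun r ↦ Γ (f (r, t))) s (Γ y) (fderiv ℝ Γ y Z) :=
    ⟨rfl, dΓ.hasFDerivAt.comp_hasDerivAt s jf.2⟩
  have jτ := jTT.add (jΓ.apply₂ jT jT)
  -- jets along the curve
  have kf : HasJet (fun u ↦ f (s, u)) t y T := ⟨rfl, hasDerivAt_snd df⟩
  have kT : HasJet (fun u ↦ fderiv ℝ f (s, u) (0, 1)) t T TT :=
    HasJet.eval ⟨rfl, hasDerivAt_snd dA⟩ (0, 1)
  have kZ : HasJet (fun u ↦ fderiv ℝ f (s, u) (1, 0)) t Z TZ :=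
    HasJet.eval ⟨rfl, hasDerivAt_snd dA⟩ (1, 0)
  have kTZ : HasJet (fun u ↦ fderiv ℝ (fderiv ℝ f) (s, u) (0, 1) (1, 0)) t TZ TTZ :=
    HasJet.eval (HasJet.eval ⟨rfl, hasDerivAt_snd dB⟩ (0, 1)) (1, 0)
  have kΓ : HasJet (fun u ↦ Γ (f (s, u))) t (Γ y) (fderiv ℝ Γ y T) :=
    ⟨rfl, dΓ.hasFDerivAt.comp_hasDerivAt t kf.2⟩
  have kD := kTZ.add (kΓ.apply₂ kT kZ)
  have hD : flatCov Γ (fun u ↦ f (s, u)) S =ᶠ[𝓝 t] fun u ↦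
      fderiv ℝ (fderiv ℝ f) (s, u) (0, 1) (1, 0)
        + Γ (f (s, u)) (fderiv ℝ f (s, u) (0, 1)) (fderiv ℝ f (s, u) (1, 0)) := by
    filter_upwards [hS.eventually_nhds, eventually_mem_snd hU hp] with u hu hu'
    have j2 : HasJet (fun u ↦ fderiv ℝ f (s, u) (1, 0)) u _ _ :=
      HasJet.eval ⟨rfl, hasDerivAt_snd (differentiableAt_of_mem hU hA hu')⟩ (1, 0)
    rw [flatCov, Filter.EventuallyEq.deriv_eq hu, hu.self_of_nhds, j2.2.deriv,
      deriv_snd hU hf hu']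
  have key := h.hasDerivAt_metric jf.2.differentiableAt jτ.2.differentiableAt
    jτ.2.differentiableAt hy
  refine key.congr_deriv ?_
  rw [flatCov_deriv hU hf hp, flatCov, flatCov, hD.deriv_eq, kD.2.deriv, hD.self_of_nhds,
    deriv_snd hU hf hp, jτ.2.deriv, jf.2.deriv, hS.self_of_nhds]
  simp only [← hy', ← hT, ← hZ, ← hTT, ← hTZ]
  rw [h.symm y hy (TT + Γ y T T), ← two_mul]
  simp only [localCurvature, map_add, map_sub, add_apply, sub_apply]
  rw [h.fderiv_symm hy T Z T, h.torsion_free y hy TZ T, h.torsion_free y hy Z TT,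
    h.torsion_free y hy Z T]
  ring

end FlatVariation

end

/-! ### Vector fields, brackets and connections in a chart -/

section Chart

variable {d : ℕ} {M : Type*} [TopologicalSpace M] [ChartedSpace (EuclideanSpace ℝ (Fin d)) M]
  [IsManifold (𝓡 d) ∞ M]

/-- The coordinates, in the chart at `x₀`, of a tangent vector at `x`. -/
def toCoord (x₀ x : M) : TangentSpace (𝓡 d) x →L[ℝ] EuclideanSpace ℝ (Fin d) :=
  (trivializationAt (EuclideanSpace ℝ (Fin d)) (fun x : M ↦ TangentSpace (𝓡 d) x)
    x₀).continuousLinearMapAt ℝ x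

/-- The tangent vector at `x` with given coordinates in the chart at `x₀`. -/
def ofCoord (x₀ x : M) : EuclideanSpace ℝ (Fin d) →L[ℝ] TangentSpace (𝓡 d) x :=
  (trivializationAt (EuclideanSpace ℝ (Fin d)) (fun x : M ↦ TangentSpace (𝓡 d) x) x₀).symmL ℝ x

/-- The vector field with given components in the chart at `x₀`. -/
def lift (x₀ : M) (u : EuclideanSpace ℝ (Fin d) → EuclideanSpace ℝ (Fin d)) (x : M) :
    TangentSpace (𝓡 d) x :=
  ofCoord x₀ x (u (extChartAt (𝓡 d) x₀ x))

/-- The domain of the chart at `x₀`. -/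
abbrev dom (d : ℕ) {M : Type*} [TopologicalSpace M] [ChartedSpace (EuclideanSpace ℝ (Fin d)) M]
  (x₀ : M) : Set M := (chartAt (EuclideanSpace ℝ (Fin d)) x₀).source

lemma mem_ext {x₀ x : M} (hx : x ∈ dom d x₀) : x ∈ (extChartAt (𝓡 d) x₀).source := by
  rwa [extChartAt_source]

lemma mem_base {x₀ x : M} (hx : x ∈ dom d x₀) :
    x ∈ (trivializationAt (EuclideanSpace ℝ (Fin d)) (fun x : M ↦ TangentSpace (𝓡 d) x)
      x₀).baseSet := by
  rwa [TangentBundle.trivializationAt_baseSet]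

lemma ofCoord_toCoord {x₀ x : M} (hx : x ∈ dom d x₀) (v : TangentSpace (𝓡 d) x) :
    ofCoord x₀ x (toCoord x₀ x v) = v :=
  Trivialization.symmL_continuousLinearMapAt _ (mem_base hx) v

lemma toCoord_ofCoord {x₀ x : M} (hx : x ∈ dom d x₀) (v : EuclideanSpace ℝ (Fin d)) :
    toCoord x₀ x (ofCoord x₀ x v) = v :=
  Trivialization.continuousLinearMapAt_symmL _ (mem_base hx) v

lemma toCoord_eq_mfderiv {x₀ x : M} (hx : x ∈ dom d x₀) :
    toCoord x₀ x = mfderiv (𝓡 d) 𝓘(ℝ, EuclideanSpace ℝ (Fin d)) (extChartAt (𝓡 d) x₀) x :=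
  TangentBundle.continuousLinearMapAt_trivializationAt hx

lemma snd_triv {x₀ x : M} (hx : x ∈ dom d x₀) (v : TangentSpace (𝓡 d) x) :
    (trivializationAt (EuclideanSpace ℝ (Fin d)) (fun x : M ↦ TangentSpace (𝓡 d) x) x₀
      ⟨x, v⟩).2 = toCoord x₀ x v := by
  rw [toCoord, Trivialization.continuousLinearMapAt_apply, Trivialization.linearMapAt_apply, if_pos (mem_base hx)]

lemma smooth_section_iff {x₀ x : M} (hx : x ∈ dom d x₀) {X : ∀ x : M, TangentSpace (𝓡 d) x} :
    SmoothFieldAt X x ↔ ContMDiffAt (𝓡 d) 𝓘(ℝ, EuclideanSpace ℝ (Fin d)) ∞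
      (fun y ↦ toCoord x₀ y (X y)) x := by
  rw [SmoothFieldAt]
  refine (Trivialization.contMDiffAt_section_iff (trivializationAt (EuclideanSpace ℝ (Fin d)) (fun x : M ↦ TangentSpace (𝓡 d) x) x₀) (mem_base hx)).trans ?_
  refine Filter.EventuallyEq.contMDiffAt_iff ?_
  filter_upwards [(chartAt (EuclideanSpace ℝ (Fin d)) x₀).open_source.mem_nhds hx] with y hy
  exact snd_triv hy _

lemma smoothFieldAt_lift {x₀ x : M} (hx : x ∈ dom d x₀)
    {u : EuclideanSpace ℝ (Fin d) → EuclideanSpace ℝ (Fin d)}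
    (hu : ContDiffAt ℝ ∞ u (extChartAt (𝓡 d) x₀ x)) : SmoothFieldAt (lift x₀ u) x := by
  rw [smooth_section_iff hx]
  refine (hu.contMDiffAt.comp x (contMDiffAt_extChartAt' hx)).congr_of_eventuallyEq ?_
  filter_upwards [(chartAt (EuclideanSpace ℝ (Fin d)) x₀).open_source.mem_nhds hx] with y hy
  simp [lift, toCoord_ofCoord hy]

/-- vector fields near a chart point are lifts -/
lemma symm_mem_dom {x₀ : M} {y : EuclideanSpace ℝ (Fin d)} (hy : y ∈ (extChartAt (𝓡 d) x₀).target) :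
    (extChartAt (𝓡 d) x₀).symm y ∈ dom d x₀ := by
  simpa [extChartAt_source] using (extChartAt (𝓡 d) x₀).map_target hy

lemma contMDiffAt_symm {x₀ : M} {y : EuclideanSpace ℝ (Fin d)} (hy : y ∈ (extChartAt (𝓡 d) x₀).target) :
    ContMDiffAt 𝓘(ℝ, EuclideanSpace ℝ (Fin d)) (𝓡 d) ∞ (extChartAt (𝓡 d) x₀).symm y :=
  (contMDiffOn_extChartAt_symm x₀).contMDiffAt ((isOpen_extChartAt_target x₀).mem_nhds hy)

lemma ofCoord_eq_mfderiv {x₀ : M} {y : EuclideanSpace ℝ (Fin d)} (hy : y ∈ (extChartAt (𝓡 d) x₀).target) :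
    ofCoord x₀ ((extChartAt (𝓡 d) x₀).symm y) = mfderiv 𝓘(ℝ, EuclideanSpace ℝ (Fin d)) (𝓡 d) (extChartAt (𝓡 d) x₀).symm y := by
  have := TangentBundle.symmL_trivializationAt (𝕜 := ℝ) (I := 𝓡 d) (symm_mem_dom hy)
  rw [(extChartAt (𝓡 d) x₀).right_inv hy] at this
  simpa only [ofCoord, mfderivWithin_univ, ModelWithCorners.range_eq_univ] using this

lemma mpullback_symm {x₀ : M} {y : EuclideanSpace ℝ (Fin d)} (hy : y ∈ (extChartAt (𝓡 d) x₀).target)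
    (Z : ∀ x : M, TangentSpace (𝓡 d) x) :
    VectorField.mpullback 𝓘(ℝ, EuclideanSpace ℝ (Fin d)) (𝓡 d) (extChartAt (𝓡 d) x₀).symm Z y =
      toCoord x₀ ((extChartAt (𝓡 d) x₀).symm y) (Z ((extChartAt (𝓡 d) x₀).symm y)) := by
  rw [VectorField.mpullback_apply, ← ofCoord_eq_mfderiv hy]
  have : (ofCoord x₀ ((extChartAt (𝓡 d) x₀).symm y)).inverse =
      toCoord x₀ ((extChartAt (𝓡 d) x₀).symm y) :=
    ContinuousLinearMap.inverse_eq
      (ContinuousLinearMap.ext fun v ↦ ofCoord_toCoord (symm_mem_dom hy) v)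
      (ContinuousLinearMap.ext fun v ↦ toCoord_ofCoord (symm_mem_dom hy) v)
  exact congrArg (fun L : TangentSpace (𝓡 d) ((extChartAt (𝓡 d) x₀).symm y) →L[ℝ]
    EuclideanSpace ℝ (Fin d) ↦ L (Z ((extChartAt (𝓡 d) x₀).symm y))) this

lemma SmoothFieldAt.mdifferentiableAt {X : ∀ x : M, TangentSpace (𝓡 d) x} {x : M}
    (h : SmoothFieldAt X x) : MDifferentiableAt (𝓡 d) (𝓡 d).tangent
      (fun y ↦ (⟨y, X y⟩ : TangentBundle (𝓡 d) M)) x :=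
  ContMDiffAt.mdifferentiableAt h (by simp)

lemma mlieBracket_eq_fderiv (u v : EuclideanSpace ℝ (Fin d) → EuclideanSpace ℝ (Fin d))
    (y : EuclideanSpace ℝ (Fin d)) :
    VectorField.mlieBracket 𝓘(ℝ, EuclideanSpace ℝ (Fin d)) u v y =
      fderiv ℝ v y (u y) - fderiv ℝ u y (v y) := by
  have h := congrFun (VectorField.mlieBracketWithin_eq_lieBracketWithin (𝕜 := ℝ) (V := u) (W := v)
    (s := univ)) y
  rw [VectorField.lieBracketWithin_univ] at h
  exact h

/-- The bracket is natural under pullback by the inverse chart, and there the pulled-back fields are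
just `u` and `v`. -/
lemma mlieBracket_lift {x₀ : M} {y : EuclideanSpace ℝ (Fin d)} (hy : y ∈ (extChartAt (𝓡 d) x₀).target)
    {u v : EuclideanSpace ℝ (Fin d) → EuclideanSpace ℝ (Fin d)}
    (hu : ContDiffAt ℝ ∞ u y) (hv : ContDiffAt ℝ ∞ v y) :
    VectorField.mlieBracket (𝓡 d) (lift x₀ u) (lift x₀ v) ((extChartAt (𝓡 d) x₀).symm y) =
      ofCoord x₀ ((extChartAt (𝓡 d) x₀).symm y) (fderiv ℝ v y (u y) - fderiv ℝ u y (v y)) := by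
  have hd := symm_mem_dom hy
  have hr := (extChartAt (𝓡 d) x₀).right_inv hy
  have hU : SmoothFieldAt (lift x₀ u) ((extChartAt (𝓡 d) x₀).symm y) :=
    smoothFieldAt_lift hd (by rwa [hr])
  have hV : SmoothFieldAt (lift x₀ v) ((extChartAt (𝓡 d) x₀).symm y) :=
    smoothFieldAt_lift hd (by rwa [hr])
  have : IsManifold (𝓡 d) (minSmoothness ℝ 2) M :=
    IsManifold.of_le (n := ∞) (by rw [minSmoothness_of_isRCLikeNormedField]; exact ENat.LEInfty.out)
  have : IsManifold (𝓡 d) (minSmoothness ℝ 3) M :=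
    IsManifold.of_le (n := ∞) (by rw [minSmoothness_of_isRCLikeNormedField]; exact ENat.LEInfty.out)
  have key := VectorField.mpullback_mlieBracket (n := ∞) hU.mdifferentiableAt hV.mdifferentiableAt
    (contMDiffAt_symm hy) (by rw [minSmoothness_of_isRCLikeNormedField]; exact ENat.LEInfty.out)
  have pb : ∀ w : EuclideanSpace ℝ (Fin d) → EuclideanSpace ℝ (Fin d),
      VectorField.mpullback 𝓘(ℝ, EuclideanSpace ℝ (Fin d)) (𝓡 d) (extChartAt (𝓡 d) x₀).symm
        (lift x₀ w) =ᶠ[𝓝 y] w := by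
    intro w
    filter_upwards [(isOpen_extChartAt_target (I := 𝓡 d) x₀).mem_nhds hy] with z hz
    rw [mpullback_symm hz, lift, toCoord_ofCoord (symm_mem_dom hz), (extChartAt (𝓡 d) x₀).right_inv hz]
  rw [mpullback_symm hy, (pb u).mlieBracket_vectorField_eq (pb v)] at key
  replace key := key.trans (mlieBracket_eq_fderiv u v y)
  rw [← ofCoord_toCoord hd (VectorField.mlieBracket (𝓡 d) (lift x₀ u) (lift x₀ v) ((extChartAt (𝓡 d) x₀).symm y)), key]

/-- The connection matrix of `cov` in the chart at `x₀`: `christoffel cov x₀ y w u` is the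
coordinate expression of `∇_w u` for constant `u`. -/
def christoffel (cov : CovariantDerivative (𝓡 d) (EuclideanSpace ℝ (Fin d))
      (fun x : M ↦ TangentSpace (𝓡 d) x)) (x₀ : M) (y : EuclideanSpace ℝ (Fin d)) :
    EuclideanSpace ℝ (Fin d) →L[ℝ] EuclideanSpace ℝ (Fin d) →L[ℝ] EuclideanSpace ℝ (Fin d) :=
  ∑ i, (ContinuousLinearMap.smulRightL ℝ (EuclideanSpace ℝ (Fin d)) (EuclideanSpace ℝ (Fin d))
      (EuclideanSpace.proj i)) ∘L
    (toCoord x₀ ((extChartAt (𝓡 d) x₀).symm y) ∘L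
      cov (lift x₀ fun _ ↦ EuclideanSpace.basisFun (Fin d) ℝ i) ((extChartAt (𝓡 d) x₀).symm y) ∘L
      ofCoord x₀ ((extChartAt (𝓡 d) x₀).symm y))

lemma christoffel_apply (cov : CovariantDerivative (𝓡 d) (EuclideanSpace ℝ (Fin d))
      (fun x : M ↦ TangentSpace (𝓡 d) x)) (x₀ : M) (y w u : EuclideanSpace ℝ (Fin d)) :
    christoffel cov x₀ y w u = ∑ i, u i • toCoord x₀ ((extChartAt (𝓡 d) x₀).symm y)
      (cov (lift x₀ fun _ ↦ EuclideanSpace.basisFun (Fin d) ℝ i) ((extChartAt (𝓡 d) x₀).symm y)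
      (ofCoord x₀ ((extChartAt (𝓡 d) x₀).symm y) w)) := by
  simp only [christoffel, sum_apply]
  rfl

/-- Expand the field in the chart-constant frame and apply the Leibniz rule to each term:
differentiating the coefficients gives the derivative of u, differentiating the frame gives
`christoffel`. -/
lemma cov_lift (cov : CovariantDerivative (𝓡 d) (EuclideanSpace ℝ (Fin d))
      (fun x : M ↦ TangentSpace (𝓡 d) x)) {x₀ : M} {y : EuclideanSpace ℝ (Fin d)}
    (hy : y ∈ (extChartAt (𝓡 d) x₀).target)
    {u : EuclideanSpace ℝ (Fin d) → EuclideanSpace ℝ (Fin d)} (hu : ContDiffAt ℝ ∞ u y)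
    (w : EuclideanSpace ℝ (Fin d)) :
    cov (lift x₀ u) ((extChartAt (𝓡 d) x₀).symm y) (ofCoord x₀ ((extChartAt (𝓡 d) x₀).symm y) w) =
      ofCoord x₀ ((extChartAt (𝓡 d) x₀).symm y) (fderiv ℝ u y w + christoffel cov x₀ y w (u y)) := by
  have hd := symm_mem_dom hy
  have hr := (extChartAt (𝓡 d) x₀).right_inv hy
  set x := (extChartAt (𝓡 d) x₀).symm y with hx
  have hcov := cov.isCovariantDerivativeOnUniv
  let b := EuclideanSpace.basisFun (Fin d) ℝ
  let f : Fin d → M → ℝ := fun i z ↦ u (extChartAt (𝓡 d) x₀ z) i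
  have hdec : lift x₀ u = ∑ i, f i • lift x₀ (fun _ ↦ b i) := by
    funext z
    simp only [Finset.sum_apply, Pi.smul_apply', f, lift, ← map_smul, ← map_sum]
    congr 1
    exact (EuclideanSpace.basisFun (Fin d) ℝ).sum_repr (u (extChartAt (𝓡 d) x₀ z)) |>.symm
  have hs : ∀ i, SmoothFieldAt (lift x₀ (fun _ ↦ b i)) x := fun i ↦
    smoothFieldAt_lift hd contDiffAt_const
  have hf : ∀ i, HasMFDerivAt (𝓡 d) 𝓘(ℝ, ℝ) (f i) x
      ((EuclideanSpace.proj i ∘L fderiv ℝ u y) ∘L (toCoord x₀ x)) := by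
    intro i
    rw [toCoord_eq_mfderiv hd]
    have h1 : HasFDerivAt (fun z ↦ u z i) (EuclideanSpace.proj i ∘L fderiv ℝ u y)
        (extChartAt (𝓡 d) x₀ x) := by
      rw [hr]
      exact (EuclideanSpace.proj i : EuclideanSpace ℝ (Fin d) →L[ℝ] ℝ).hasFDerivAt.comp y
        (hu.differentiableAt (by simp)).hasFDerivAt
    exact h1.hasMFDerivAt.comp x (mdifferentiableAt_extChartAt hd).hasMFDerivAt
  -- A connection is additive only on differentiable fields, so the induction carries the smoothness
  -- of the partial sums along.
  have hsum : ∀ (s : Finset (Fin d)), SmoothFieldAt (∑ i ∈ s, f i • lift x₀ (fun _ ↦ b i)) x ∧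
      cov (∑ i ∈ s, f i • lift x₀ (fun _ ↦ b i)) x =
        ∑ i ∈ s, cov (f i • lift x₀ (fun _ ↦ b i)) x := by
    intro s
    induction s using Finset.induction_on with
    | empty =>
      refine ⟨(contMDiff_zeroSection ℝ (fun x : M ↦ TangentSpace (𝓡 d) x)).contMDiffAt, ?_⟩
      simp
    | insert i s his ih =>
      have hfi : ContMDiffAt (𝓡 d) 𝓘(ℝ, ℝ) ∞ (f i) x := by
        have h1 : ContDiffAt ℝ ∞ (fun z ↦ u z i) (extChartAt (𝓡 d) x₀ x) := by
          rw [hr]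
          exact (EuclideanSpace.proj i : EuclideanSpace ℝ (Fin d) →L[ℝ] ℝ).contDiff.contDiffAt.comp y hu
        exact h1.contMDiffAt.comp x (contMDiffAt_extChartAt' hd)
      have hi : SmoothFieldAt (f i • lift x₀ (fun _ ↦ b i)) x := hfi.smul_section (hs i)
      rw [Finset.sum_insert his, Finset.sum_insert his]
      refine ⟨ContMDiffAt.add_section hi ih.1, ?_⟩
      rw [hcov.add hi.mdifferentiableAt ih.1.mdifferentiableAt, ih.2]
  rw [hdec, (hsum _).2, christoffel_apply]
  have hterm : ∀ i, cov (f i • lift x₀ (fun _ ↦ b i)) x (ofCoord x₀ x w) =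
      ofCoord x₀ x (fderiv ℝ u y w i • b i +
        u y i • toCoord x₀ x (cov (lift x₀ fun _ ↦ b i) x (ofCoord x₀ x w))) := by
    intro i
    rw [hcov.leibniz (hs i).mdifferentiableAt (hf i).mdifferentiableAt, mvfderiv, (hf i).mfderiv]
    simp only [map_add, map_smul, ofCoord_toCoord hd]
    have h1 : f i x = u y i := by simp only [f, hr]
    have h2 : (((EuclideanSpace.proj i ∘L fderiv ℝ u y) ∘L (toCoord x₀ x)) (ofCoord x₀ x w) : ℝ) =
        fderiv ℝ u y w i := by
      simp only [ContinuousLinearMap.comp_apply, toCoord_ofCoord hd]; rfl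
    rw [← h1, ← h2, add_comm]
    rfl
  rw [sum_apply, Finset.sum_congr rfl fun i _ ↦ hterm i, ← map_sum, Finset.sum_add_distrib]
  congr 2
  exact (EuclideanSpace.basisFun (Fin d) ℝ).sum_repr _

lemma lift_eventuallyEq {x₀ : M} {y : EuclideanSpace ℝ (Fin d)}
    (hy : y ∈ (extChartAt (𝓡 d) x₀).target) (X : ∀ x : M, TangentSpace (𝓡 d) x)
    (u : EuclideanSpace ℝ (Fin d) → EuclideanSpace ℝ (Fin d))
    (h : ∀ z ∈ (extChartAt (𝓡 d) x₀).target,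
      X ((extChartAt (𝓡 d) x₀).symm z) = ofCoord x₀ ((extChartAt (𝓡 d) x₀).symm z) (u z)) :
    X =ᶠ[𝓝 ((extChartAt (𝓡 d) x₀).symm y)] lift x₀ u := by
  filter_upwards [(chartAt (EuclideanSpace ℝ (Fin d)) x₀).open_source.mem_nhds
    (symm_mem_dom hy)] with x hx
  have h1 := h _ ((extChartAt (𝓡 d) x₀).map_source (mem_ext hx))
  rwa [(extChartAt (𝓡 d) x₀).left_inv (mem_ext hx)] at h1

/-- The covariant derivative of a field which is given in the chart at `x₀`. -/
lemma cov_eq_of_coord (cov : CovariantDerivative (𝓡 d) (EuclideanSpace ℝ (Fin d))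
      (fun x : M ↦ TangentSpace (𝓡 d) x)) {x₀ : M} {y : EuclideanSpace ℝ (Fin d)}
    (hy : y ∈ (extChartAt (𝓡 d) x₀).target) {X : ∀ x : M, TangentSpace (𝓡 d) x}
    {u : EuclideanSpace ℝ (Fin d) → EuclideanSpace ℝ (Fin d)} (hu : ContDiffAt ℝ ∞ u y)
    (h : ∀ z ∈ (extChartAt (𝓡 d) x₀).target,
      X ((extChartAt (𝓡 d) x₀).symm z) = ofCoord x₀ ((extChartAt (𝓡 d) x₀).symm z) (u z))
    (w : EuclideanSpace ℝ (Fin d)) :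
    cov X ((extChartAt (𝓡 d) x₀).symm y) (ofCoord x₀ ((extChartAt (𝓡 d) x₀).symm y) w) =
      ofCoord x₀ ((extChartAt (𝓡 d) x₀).symm y) (fderiv ℝ u y w + christoffel cov x₀ y w (u y)) := by
  have hs : SmoothFieldAt (lift x₀ u) ((extChartAt (𝓡 d) x₀).symm y) :=
    smoothFieldAt_lift (symm_mem_dom hy) (by rwa [(extChartAt (𝓡 d) x₀).right_inv hy])
  have he := lift_eventuallyEq hy X u h
  have hX : SmoothFieldAt X ((extChartAt (𝓡 d) x₀).symm y) := by
    refine ContMDiffAt.congr_of_eventuallyEq hs ?_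
    filter_upwards [he] with z hz
    rw [hz]
  rw [← cov_lift cov hy hu w, cov.isCovariantDerivativeOnUniv.congr_of_eventuallyEq
    hX.mdifferentiableAt hs.mdifferentiableAt Filter.univ_mem he]

variable [T2Space M]

/-- Smoothness of the connection is applied to fields that are smooth on all of M. A chart-constant
field is therefore cut off by a bump function, which leaves its germ at x unchanged. -/
lemma exists_global_extension {x₀ x : M} (hx : x ∈ dom d x₀) (v : EuclideanSpace ℝ (Fin d)) :
    ∃ X : ∀ x : M, TangentSpace (𝓡 d) x, (∀ z, SmoothFieldAt X z) ∧
      X =ᶠ[𝓝 x] lift x₀ fun _ ↦ v := by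
  have hmem : dom d x₀ ∈ 𝓝 x := (chartAt (EuclideanSpace ℝ (Fin d)) x₀).open_source.mem_nhds hx
  obtain ⟨ψ, hψ⟩ := (SmoothBumpFunction.nhds_basis_tsupport (I := 𝓡 d) x).mem_iff.1 hmem
  refine ⟨fun z ↦ ψ z • lift x₀ (fun _ ↦ v) z, fun z ↦ ?_, ?_⟩
  · refine ContMDiffOn.smul_section_of_tsupport (ψ := ψ) (V := fun x : M ↦ TangentSpace (𝓡 d) x)
      (n := ∞) (u := dom d x₀) ψ.contMDiff.contMDiffOn
      (chartAt (EuclideanSpace ℝ (Fin d)) x₀).open_source hψ.2 ?_ z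
    intro z hz
    exact (smoothFieldAt_lift hz contDiffAt_const).contMDiffWithinAt
  · filter_upwards [ψ.eventuallyEq_one] with z hz
    change ψ z • lift x₀ (fun _ ↦ v) z = _
    rw [hz]
    exact one_smul ℝ _

end Chart

/-! ### The metric, its connection and its curvature in coordinates -/

section Coordinates

variable {d : ℕ} {M : Type*} [TopologicalSpace M] [ChartedSpace (EuclideanSpace ℝ (Fin d)) M]
  [IsManifold (𝓡 d) ∞ M]

/-- The vector field `X` has the smooth components `u` in the chart at `x₀`. -/
structure HasCoord (x₀ : M) (X : ∀ x : M, TangentSpace (𝓡 d) x)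
    (u : EuclideanSpace ℝ (Fin d) → EuclideanSpace ℝ (Fin d)) : Prop where
  contDiffOn : ContDiffOn ℝ ∞ u (extChartAt (𝓡 d) x₀).target
  eq : ∀ y ∈ (extChartAt (𝓡 d) x₀).target,
    X ((extChartAt (𝓡 d) x₀).symm y) = ofCoord x₀ ((extChartAt (𝓡 d) x₀).symm y) (u y)

lemma target_mem_nhds {x₀ : M} {y : EuclideanSpace ℝ (Fin d)}
    (hy : y ∈ (extChartAt (𝓡 d) x₀).target) : (extChartAt (𝓡 d) x₀).target ∈ 𝓝 y :=
  (isOpen_extChartAt_target (I := 𝓡 d) x₀).mem_nhds hy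

lemma hasCoord_lift {x₀ : M} {u : EuclideanSpace ℝ (Fin d) → EuclideanSpace ℝ (Fin d)}
    (hu : ContDiffOn ℝ ∞ u (extChartAt (𝓡 d) x₀).target) : HasCoord x₀ (lift x₀ u) u :=
  ⟨hu, fun y hy ↦ by rw [lift, (extChartAt (𝓡 d) x₀).right_inv hy]⟩

/-- A function on `M` which is smooth on the chart domain is smooth in coordinates. -/
lemma contDiffOn_of_contMDiffAt {F : Type*} [NormedAddCommGroup F] [NormedSpace ℝ F] {x₀ : M}
    {f : M → F} {f' : EuclideanSpace ℝ (Fin d) → F}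
    (hf : ∀ x ∈ dom d x₀, ContMDiffAt (𝓡 d) 𝓘(ℝ, F) ∞ f x)
    (he : ∀ y ∈ (extChartAt (𝓡 d) x₀).target, f ((extChartAt (𝓡 d) x₀).symm y) = f' y) :
    ContDiffOn ℝ ∞ f' (extChartAt (𝓡 d) x₀).target := by
  have h1 : ContDiffOn ℝ ∞ (fun y ↦ f ((extChartAt (𝓡 d) x₀).symm y))
      (extChartAt (𝓡 d) x₀).target := fun y hy ↦
    ((hf _ (symm_mem_dom hy)).comp y (contMDiffAt_symm hy)).contDiffAt.contDiffWithinAt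
  exact h1.congr fun y hy ↦ (he y hy).symm

lemma hasCoord_of_smooth {x₀ : M} {X : ∀ x : M, TangentSpace (𝓡 d) x}
    (hX : ∀ x ∈ dom d x₀, SmoothFieldAt X x) :
    HasCoord x₀ X fun y ↦ toCoord x₀ ((extChartAt (𝓡 d) x₀).symm y)
      (X ((extChartAt (𝓡 d) x₀).symm y)) :=
  ⟨contDiffOn_of_contMDiffAt (f := fun x ↦ toCoord x₀ x (X x))
    (fun x hx ↦ (smooth_section_iff hx).1 (hX x hx)) fun _ _ ↦ rfl,
    fun _ hy ↦ (ofCoord_toCoord (symm_mem_dom hy) _).symm⟩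

lemma mvfderiv_eq_fderiv {F : Type*} [NormedAddCommGroup F] [NormedSpace ℝ F] {x₀ : M}
    {f : M → F} {f' : EuclideanSpace ℝ (Fin d) → F} {y : EuclideanSpace ℝ (Fin d)}
    (hy : y ∈ (extChartAt (𝓡 d) x₀).target) (hf : DifferentiableAt ℝ f' y)
    (he : ∀ y ∈ (extChartAt (𝓡 d) x₀).target, f ((extChartAt (𝓡 d) x₀).symm y) = f' y)
    (w : EuclideanSpace ℝ (Fin d)) :
    mvfderiv (𝓡 d) f ((extChartAt (𝓡 d) x₀).symm y)
      (ofCoord x₀ ((extChartAt (𝓡 d) x₀).symm y) w) = fderiv ℝ f' y w := by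
  have hd := symm_mem_dom hy
  have hr := (extChartAt (𝓡 d) x₀).right_inv hy
  set x := (extChartAt (𝓡 d) x₀).symm y with hx
  have h1 : HasMFDerivAt (𝓡 d) 𝓘(ℝ, F) (f' ∘ extChartAt (𝓡 d) x₀) x
      (fderiv ℝ f' y ∘L toCoord x₀ x) := by
    rw [toCoord_eq_mfderiv hd]
    have h2 : HasFDerivAt f' (fderiv ℝ f' y) (extChartAt (𝓡 d) x₀ x) := by
      rw [hr]; exact hf.hasFDerivAt
    exact h2.hasMFDerivAt.comp x (mdifferentiableAt_extChartAt hd).hasMFDerivAt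
  have h3 : HasMFDerivAt (𝓡 d) 𝓘(ℝ, F) f x (fderiv ℝ f' y ∘L toCoord x₀ x) := by
    refine h1.congr_of_eventuallyEq ?_
    filter_upwards [(chartAt (EuclideanSpace ℝ (Fin d)) x₀).open_source.mem_nhds hd] with z hz
    have := he _ ((extChartAt (𝓡 d) x₀).map_source (mem_ext hz))
    rwa [(extChartAt (𝓡 d) x₀).left_inv (mem_ext hz)] at this
  rw [mvfderiv, h3.mfderiv]
  exact congrArg (fderiv ℝ f' y) (toCoord_ofCoord hd w)

namespace HasCoord

variable {x₀ : M} {X Y Z : ∀ x : M, TangentSpace (𝓡 d) x}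
  {u v w : EuclideanSpace ℝ (Fin d) → EuclideanSpace ℝ (Fin d)} {y : EuclideanSpace ℝ (Fin d)}

lemma contDiffAt (h : HasCoord x₀ X u) (hy : y ∈ (extChartAt (𝓡 d) x₀).target) :
    ContDiffAt ℝ ∞ u y := h.contDiffOn.contDiffAt (target_mem_nhds hy)

lemma eventuallyEq (h : HasCoord x₀ X u) (hy : y ∈ (extChartAt (𝓡 d) x₀).target) :
    X =ᶠ[𝓝 ((extChartAt (𝓡 d) x₀).symm y)] lift x₀ u := lift_eventuallyEq hy X u h.eq

lemma smoothFieldAt (h : HasCoord x₀ X u) (hy : y ∈ (extChartAt (𝓡 d) x₀).target) :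
    SmoothFieldAt X ((extChartAt (𝓡 d) x₀).symm y) := by
  have hs : SmoothFieldAt (lift x₀ u) ((extChartAt (𝓡 d) x₀).symm y) :=
    smoothFieldAt_lift (symm_mem_dom hy)
      (by rw [(extChartAt (𝓡 d) x₀).right_inv hy]; exact h.contDiffAt hy)
  refine ContMDiffAt.congr_of_eventuallyEq hs ?_
  filter_upwards [h.eventuallyEq hy] with z hz
  rw [hz]

lemma smoothFieldAt' (h : HasCoord x₀ X u) {x : M} (hx : x ∈ dom d x₀) : SmoothFieldAt X x := by
  rw [← (extChartAt (𝓡 d) x₀).left_inv (mem_ext hx)]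
  exact h.smoothFieldAt ((extChartAt (𝓡 d) x₀).map_source (mem_ext hx))

lemma mlieBracket (hX : HasCoord x₀ X u) (hY : HasCoord x₀ Y v)
    (hy : y ∈ (extChartAt (𝓡 d) x₀).target) :
    VectorField.mlieBracket (𝓡 d) X Y ((extChartAt (𝓡 d) x₀).symm y) =
      ofCoord x₀ ((extChartAt (𝓡 d) x₀).symm y) (fderiv ℝ v y (u y) - fderiv ℝ u y (v y)) := by
  rw [(hX.eventuallyEq hy).mlieBracket_vectorField_eq (hY.eventuallyEq hy),
    mlieBracket_lift hy (hX.contDiffAt hy) (hY.contDiffAt hy)]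

lemma cov_apply (hX : HasCoord x₀ X u) (cov : CovariantDerivative (𝓡 d)
      (EuclideanSpace ℝ (Fin d)) (fun x : M ↦ TangentSpace (𝓡 d) x))
    (hy : y ∈ (extChartAt (𝓡 d) x₀).target) (w : EuclideanSpace ℝ (Fin d)) :
    cov X ((extChartAt (𝓡 d) x₀).symm y) (ofCoord x₀ ((extChartAt (𝓡 d) x₀).symm y) w) =
      ofCoord x₀ ((extChartAt (𝓡 d) x₀).symm y)
        (fderiv ℝ u y w + christoffel cov x₀ y w (u y)) :=
  cov_eq_of_coord cov hy (hX.contDiffAt hy) hX.eq w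

lemma cov (hX : HasCoord x₀ X u) (hY : HasCoord x₀ Y v) (cov : CovariantDerivative (𝓡 d)
      (EuclideanSpace ℝ (Fin d)) (fun x : M ↦ TangentSpace (𝓡 d) x))
    (hΓ : ContDiffOn ℝ ∞ (christoffel cov x₀) (extChartAt (𝓡 d) x₀).target) :
    HasCoord x₀ (fun x ↦ cov X x (Y x))
      fun y ↦ fderiv ℝ u y (v y) + christoffel cov x₀ y (v y) (u y) := by
  refine ⟨?_, fun y hy ↦ ?_⟩
  · exact ((hX.contDiffOn.fderiv_of_isOpen (isOpen_extChartAt_target _) (by simp)).clm_apply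
      hY.contDiffOn).add ((hΓ.clm_apply hY.contDiffOn).clm_apply hX.contDiffOn)
  · rw [hY.eq y hy, hX.cov_apply cov hy]

/-- Tensoriality: the derivatives of u and v cancel against the bracket term, the second derivatives
of w by their symmetry, and the first derivatives of w in pairs. -/
lemma curvature (hX : HasCoord x₀ X u) (hY : HasCoord x₀ Y v) (hZ : HasCoord x₀ Z w)
    (cov : CovariantDerivative (𝓡 d)
      (EuclideanSpace ℝ (Fin d)) (fun x : M ↦ TangentSpace (𝓡 d) x))
    (hΓ : ContDiffOn ℝ ∞ (christoffel cov x₀) (extChartAt (𝓡 d) x₀).target)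
    (hy : y ∈ (extChartAt (𝓡 d) x₀).target) :
    Sasaki.curvature cov X Y Z ((extChartAt (𝓡 d) x₀).symm y) =
      ofCoord x₀ ((extChartAt (𝓡 d) x₀).symm y)
        (localCurvature (christoffel cov x₀) y (u y) (v y) (w y)) := by
  rw [Sasaki.curvature, hX.eq y hy, hY.eq y hy, hX.mlieBracket hY hy,
    (hZ.cov hY cov hΓ).cov_apply cov hy, (hZ.cov hX cov hΓ).cov_apply cov hy, hZ.cov_apply cov hy,
    ← map_sub, ← map_sub]
  congr 1
  have dw : DifferentiableAt ℝ w y := (hZ.contDiffAt hy).differentiableAt (by simp)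
  have dfw : DifferentiableAt ℝ (fderiv ℝ w) y :=
    ((hZ.contDiffOn.fderiv_of_isOpen (m := ∞) (isOpen_extChartAt_target _) (by simp)).contDiffAt
      (target_mem_nhds hy)).differentiableAt (by simp)
  have dΓ : DifferentiableAt ℝ (christoffel cov x₀) y :=
    (hΓ.contDiffAt (target_mem_nhds hy)).differentiableAt (by simp)
  have key : ∀ {v : EuclideanSpace ℝ (Fin d) → EuclideanSpace ℝ (Fin d)}
      (_ : DifferentiableAt ℝ v y) (a : EuclideanSpace ℝ (Fin d)),
      fderiv ℝ (fun y ↦ fderiv ℝ w y (v y) + christoffel cov x₀ y (v y) (w y)) y a =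
      fderiv ℝ (fderiv ℝ w) y a (v y) + fderiv ℝ w y (fderiv ℝ v y a)
        + (fderiv ℝ (christoffel cov x₀) y a (v y) (w y)
          + christoffel cov x₀ y (fderiv ℝ v y a) (w y)
          + christoffel cov x₀ y (v y) (fderiv ℝ w y a)) := by
    intro v dv a
    have := (dfw.hasFDerivAt.clm_apply dv.hasFDerivAt).fun_add
      ((dΓ.hasFDerivAt.clm_apply dv.hasFDerivAt).clm_apply dw.hasFDerivAt)
    rw [HasFDerivAt.fderiv this]
    simp only [add_apply, ContinuousLinearMap.comp_apply, ContinuousLinearMap.flip_apply]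
    abel
  rw [key ((hY.contDiffAt hy).differentiableAt (by simp)),
    key ((hX.contDiffAt hy).differentiableAt (by simp))]
  have hs : fderiv ℝ (fderiv ℝ w) y (u y) (v y) = fderiv ℝ (fderiv ℝ w) y (v y) (u y) :=
    (hZ.contDiffAt hy).isSymmSndFDerivAt (by simp; exact ENat.LEInfty.out) _ _
  rw [hs]
  simp only [localCurvature, map_add, map_sub, sub_apply]
  abel

end HasCoord

section Christoffel
variable [T2Space M]

lemma contDiffOn_christoffel {cov : CovariantDerivative (𝓡 d) (EuclideanSpace ℝ (Fin d))
      (fun x : M ↦ TangentSpace (𝓡 d) x)} (hcov : cov.ContMDiffCovariantDerivative ∞) (x₀ : M) :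
    ContDiffOn ℝ ∞ (christoffel cov x₀) (extChartAt (𝓡 d) x₀).target := by
  rw [contDiffOn_clm_apply]
  intro w
  rw [contDiffOn_clm_apply]
  intro v
  have key : ∀ x ∈ dom d x₀, SmoothFieldAt
      (fun x ↦ cov (lift x₀ fun _ ↦ v) x (lift x₀ (fun _ ↦ w) x)) x := by
    intro x hx
    obtain ⟨X, hX, heX⟩ := exists_global_extension hx v
    have hT : ContMDiffAt (𝓡 d)
        ((𝓡 d).prod 𝓘(ℝ, EuclideanSpace ℝ (Fin d) →L[ℝ] EuclideanSpace ℝ (Fin d))) ∞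
      (fun x ↦ TotalSpace.mk' (EuclideanSpace ℝ (Fin d) →L[ℝ] EuclideanSpace ℝ (Fin d))
        (E := fun x : M ↦ TangentSpace (𝓡 d) x →L[ℝ] TangentSpace (𝓡 d) x) x (cov X x)) x := by
      have := hcov.contMDiff.contMDiff (σ := X) (fun z _ ↦ (hX z).contMDiffWithinAt) x (mem_univ x)
      exact this.contMDiffAt Filter.univ_mem
    have h2 := ContMDiffAt.clm_bundle_apply hT (smoothFieldAt_lift hx (u := fun _ ↦ w)
      contDiffAt_const)
    refine ContMDiffAt.congr_of_eventuallyEq h2 ?_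
    filter_upwards [heX.eventually_nhds, (chartAt (EuclideanSpace ℝ (Fin d)) x₀).open_source.mem_nhds hx]
      with z hz hz'
    have e : cov X z = cov (lift x₀ fun _ ↦ v) z :=
      cov.isCovariantDerivativeOnUniv.congr_of_eventuallyEq (hX z).mdifferentiableAt
        (smoothFieldAt_lift hz' contDiffAt_const).mdifferentiableAt Filter.univ_mem hz
    rw [e]
  refine (hasCoord_of_smooth key).contDiffOn.congr fun y hy ↦ ?_
  have h1 := (hasCoord_lift (x₀ := x₀) (u := fun _ ↦ v) contDiffOn_const).cov_apply cov hy w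
  have h2 := (hasCoord_lift (x₀ := x₀) (u := fun _ ↦ w) contDiffOn_const).eq y hy
  rw [h2, h1, toCoord_ofCoord (symm_mem_dom hy)]
  simp

end Christoffel

section Metric

variable [RiemannianBundle (fun x : M ↦ TangentSpace (𝓡 d) x)]

/-- The metric in the chart at `x₀`. -/
def coordMetric (x₀ : M) (y : EuclideanSpace ℝ (Fin d)) :
    EuclideanSpace ℝ (Fin d) →L[ℝ] EuclideanSpace ℝ (Fin d) →L[ℝ] ℝ :=
  LinearMap.toContinuousLinearMap (LinearMap.toContinuousLinearMap.toLinearMap ∘ₗ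
    LinearMap.mk₂ ℝ (fun u v ↦ ⟪ofCoord x₀ ((extChartAt (𝓡 d) x₀).symm y) u,
      ofCoord x₀ ((extChartAt (𝓡 d) x₀).symm y) v⟫)
      (fun a b c ↦ by rw [map_add, inner_add_left])
      (fun a b c ↦ by rw [map_smul, real_inner_smul_left]; rfl)
      (fun a b c ↦ by rw [map_add, inner_add_right])
      (fun a b c ↦ by rw [map_smul, real_inner_smul_right]; rfl))

lemma coordMetric_apply (x₀ : M) (y u v : EuclideanSpace ℝ (Fin d)) :
    coordMetric x₀ y u v = ⟪ofCoord x₀ ((extChartAt (𝓡 d) x₀).symm y) u,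
      ofCoord x₀ ((extChartAt (𝓡 d) x₀).symm y) v⟫ := rfl

variable [IsContMDiffRiemannianBundle (𝓡 d) ∞ (EuclideanSpace ℝ (Fin d))
      (fun x : M ↦ TangentSpace (𝓡 d) x)]

lemma HasCoord.inner_eq {x₀ : M} {X Y : ∀ x : M, TangentSpace (𝓡 d) x}
    {u v : EuclideanSpace ℝ (Fin d) → EuclideanSpace ℝ (Fin d)}
    (hX : HasCoord x₀ X u) (hY : HasCoord x₀ Y v) {y : EuclideanSpace ℝ (Fin d)}
    (hy : y ∈ (extChartAt (𝓡 d) x₀).target) :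
    ⟪X ((extChartAt (𝓡 d) x₀).symm y), Y ((extChartAt (𝓡 d) x₀).symm y)⟫ =
      coordMetric x₀ y (u y) (v y) := by
  rw [hX.eq y hy, hY.eq y hy, coordMetric_apply]

lemma contDiffOn_coordMetric (x₀ : M) :
    ContDiffOn ℝ ∞ (coordMetric x₀) (extChartAt (𝓡 d) x₀).target := by
  rw [contDiffOn_clm_apply]
  intro u
  rw [contDiffOn_clm_apply]
  intro v
  have hu := hasCoord_lift (x₀ := x₀) (u := fun _ ↦ u) contDiffOn_const
  have hv := hasCoord_lift (x₀ := x₀) (u := fun _ ↦ v) contDiffOn_const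
  exact contDiffOn_of_contMDiffAt (f := fun x ↦ ⟪lift x₀ (fun _ ↦ u) x, lift x₀ (fun _ ↦ v) x⟫)
    (fun x hx ↦ ContMDiffAt.inner_bundle (hu.smoothFieldAt' hx) (hv.smoothFieldAt' hx))
    fun y hy ↦ hu.inner_eq hv hy

variable [T2Space M] {cov : CovariantDerivative (𝓡 d) (EuclideanSpace ℝ (Fin d))
      (fun x : M ↦ TangentSpace (𝓡 d) x)}

/-- The axioms of the Levi-Civita connection are tested on chart-constant fields, whose brackets and
coordinate derivatives vanish. -/
lemma isLocalMetric_coord (hcov : IsLeviCivita cov) (x₀ : M) :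
    IsLocalMetric (extChartAt (𝓡 d) x₀).target (coordMetric x₀) (christoffel cov x₀) where
  isOpen := isOpen_extChartAt_target x₀
  smooth_g := contDiffOn_coordMetric x₀
  smooth_Γ := contDiffOn_christoffel hcov.smooth x₀
  symm y hy u v := by rw [coordMetric_apply, coordMetric_apply, real_inner_comm]
  pos y hy u hu := by
    rw [coordMetric_apply]
    refine real_inner_self_pos.2 fun h0 ↦ hu ?_
    rw [← toCoord_ofCoord (symm_mem_dom hy) u, h0, map_zero]
  torsion_free y hy u v := by
    have hu := hasCoord_lift (x₀ := x₀) (u := fun _ ↦ u) contDiffOn_const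
    have hv := hasCoord_lift (x₀ := x₀) (u := fun _ ↦ v) contDiffOn_const
    have h1 := (CovariantDerivative.torsion_eq_zero_iff (cov := cov)).1 hcov.torsion_eq_zero
      (hu.smoothFieldAt hy).mdifferentiableAt (hv.smoothFieldAt hy).mdifferentiableAt
    rw [hu.mlieBracket hv hy, hu.eq y hy, hv.eq y hy, hu.cov_apply cov hy, hv.cov_apply cov hy,
      ← map_sub] at h1
    have h2 := congrArg (toCoord x₀ ((extChartAt (𝓡 d) x₀).symm y)) h1
    rw [toCoord_ofCoord (symm_mem_dom hy), toCoord_ofCoord (symm_mem_dom hy)] at h2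
    simpa [sub_eq_zero] using h2
  metric y hy u v w := by
    have hu := hasCoord_lift (x₀ := x₀) (u := fun _ ↦ u) contDiffOn_const
    have hv := hasCoord_lift (x₀ := x₀) (u := fun _ ↦ v) contDiffOn_const
    have hw := hasCoord_lift (x₀ := x₀) (u := fun _ ↦ w) contDiffOn_const
    have : IsContMDiffRiemannianBundle (𝓡 d) 1 (EuclideanSpace ℝ (Fin d))
        (fun x : M ↦ TangentSpace (𝓡 d) x) :=
      IsContMDiffRiemannianBundle.of_le (n := ∞) (by norm_cast)
    have h1 := hcov.metric.mvfderiv_inner_eq (lift x₀ fun _ ↦ u)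
      (hv.smoothFieldAt hy).mdifferentiableAt (hw.smoothFieldAt hy).mdifferentiableAt
    have hd : DifferentiableAt ℝ (coordMetric x₀) y :=
      ((contDiffOn_coordMetric x₀).contDiffAt (target_mem_nhds hy)).differentiableAt (by simp)
    have hd' : HasFDerivAt (fun y ↦ coordMetric x₀ y v w)
        ((fderiv ℝ (coordMetric x₀) y).flip v |>.flip w) y := by
      have := (hd.hasFDerivAt.clm_apply (hasFDerivAt_const v y)).clm_apply (hasFDerivAt_const w y)
      simpa using this
    rw [hu.eq y hy, mvfderiv_eq_fderiv hy (f' := fun y ↦ coordMetric x₀ y v w)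
      hd'.differentiableAt (fun z hz ↦ hv.inner_eq hw hz), hd'.fderiv] at h1
    refine Eq.trans ?_ (h1.trans ?_)
    · rfl
    · change ⟪cov _ _ _, _⟫ + ⟪_, cov _ _ _⟫ = _
      rw [hu.eq y hy, hv.cov_apply cov hy, hw.cov_apply cov hy, hv.eq y hy, hw.eq y hy]
      simp [coordMetric_apply]

end Metric
end Coordinates

/-! ### Sasakian structures in coordinates -/

section SasakiCoordinates

variable {d : ℕ} {M : Type*} [TopologicalSpace M] [ChartedSpace (EuclideanSpace ℝ (Fin d)) M]
  [IsManifold (𝓡 d) ∞ M] [RiemannianBundle (fun x : M ↦ TangentSpace (𝓡 d) x)]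

namespace AlmostContactMetric

variable (S : AlmostContactMetric d M) (x₀ : M)

/-- The tensor `φ` in the chart at `x₀`. -/
def coordφ (y : EuclideanSpace ℝ (Fin d)) : EuclideanSpace ℝ (Fin d) →L[ℝ] EuclideanSpace ℝ (Fin d) :=
  toCoord x₀ ((extChartAt (𝓡 d) x₀).symm y) ∘L S.φ ((extChartAt (𝓡 d) x₀).symm y) ∘L
    ofCoord x₀ ((extChartAt (𝓡 d) x₀).symm y)

/-- The Reeb field in the chart at `x₀`. -/
def coordξ (y : EuclideanSpace ℝ (Fin d)) : EuclideanSpace ℝ (Fin d) :=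
  toCoord x₀ ((extChartAt (𝓡 d) x₀).symm y) (S.ξ ((extChartAt (𝓡 d) x₀).symm y))

/-- The contact form in the chart at `x₀`. -/
def coordη (y : EuclideanSpace ℝ (Fin d)) : EuclideanSpace ℝ (Fin d) →L[ℝ] ℝ :=
  S.η ((extChartAt (𝓡 d) x₀).symm y) ∘L ofCoord x₀ ((extChartAt (𝓡 d) x₀).symm y)

variable {x₀} {y : EuclideanSpace ℝ (Fin d)}

lemma φ_ofCoord (hy : y ∈ (extChartAt (𝓡 d) x₀).target) (v : EuclideanSpace ℝ (Fin d)) :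
    S.φ ((extChartAt (𝓡 d) x₀).symm y) (ofCoord x₀ ((extChartAt (𝓡 d) x₀).symm y) v) =
      ofCoord x₀ ((extChartAt (𝓡 d) x₀).symm y) (S.coordφ x₀ y v) :=
  (ofCoord_toCoord (symm_mem_dom hy) _).symm

lemma ξ_eq_ofCoord (hy : y ∈ (extChartAt (𝓡 d) x₀).target) :
    S.ξ ((extChartAt (𝓡 d) x₀).symm y) =
      ofCoord x₀ ((extChartAt (𝓡 d) x₀).symm y) (S.coordξ x₀ y) :=
  (ofCoord_toCoord (symm_mem_dom hy) _).symm

lemma η_ofCoord (v : EuclideanSpace ℝ (Fin d)) :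
    S.η ((extChartAt (𝓡 d) x₀).symm y) (ofCoord x₀ ((extChartAt (𝓡 d) x₀).symm y) v) =
      S.coordη x₀ y v := rfl

lemma smoothFieldAt_φ {X : ∀ x : M, TangentSpace (𝓡 d) x} {x : M} (hX : SmoothFieldAt X x) :
    SmoothFieldAt (fun z ↦ S.φ z (X z)) x :=
  ContMDiffAt.clm_bundle_apply (S.smooth_φ x) hX

lemma contMDiffAt_η {X : ∀ x : M, TangentSpace (𝓡 d) x} {x : M} (hX : SmoothFieldAt X x) :
    ContMDiffAt (𝓡 d) 𝓘(ℝ, ℝ) ∞ (fun z ↦ S.η z (X z)) x := by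
  have h1 := ContMDiffAt.clm_bundle_apply (E₂ := Bundle.Trivial M ℝ) (S.smooth_η x) hX
  rw [contMDiffAt_totalSpace] at h1
  exact h1.2

lemma contDiffOn_coordφ : ContDiffOn ℝ ∞ (S.coordφ x₀) (extChartAt (𝓡 d) x₀).target := by
  rw [contDiffOn_clm_apply]
  intro u
  have hu := hasCoord_lift (x₀ := x₀) (u := fun _ ↦ u) contDiffOn_const
  refine (hasCoord_of_smooth (x₀ := x₀) fun x hx ↦
    S.smoothFieldAt_φ (hu.smoothFieldAt' hx)).contDiffOn.congr fun z hz ↦ ?_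
  rw [hu.eq z hz]; rfl

lemma contDiffOn_coordξ : ContDiffOn ℝ ∞ (S.coordξ x₀) (extChartAt (𝓡 d) x₀).target :=
  (hasCoord_of_smooth (x₀ := x₀) fun x _ ↦ S.smooth_ξ x).contDiffOn

lemma contDiffOn_coordη : ContDiffOn ℝ ∞ (S.coordη x₀) (extChartAt (𝓡 d) x₀).target := by
  rw [contDiffOn_clm_apply]
  intro u
  have hu := hasCoord_lift (x₀ := x₀) (u := fun _ ↦ u) contDiffOn_const
  exact contDiffOn_of_contMDiffAt (f := fun x ↦ S.η x (lift x₀ (fun _ ↦ u) x))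
    (fun x hx ↦ S.contMDiffAt_η (hu.smoothFieldAt' hx)) fun z hz ↦ by rw [hu.eq z hz]; rfl

lemma _root_.Sasaki.HasCoord.φ {X : ∀ x : M, TangentSpace (𝓡 d) x}
    {u : EuclideanSpace ℝ (Fin d) → EuclideanSpace ℝ (Fin d)} (hX : HasCoord x₀ X u) :
    HasCoord x₀ (fun x ↦ S.φ x (X x)) fun y ↦ S.coordφ x₀ y (u y) :=
  ⟨S.contDiffOn_coordφ.clm_apply hX.contDiffOn, fun y hy ↦ by rw [hX.eq y hy, S.φ_ofCoord hy]⟩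

lemma mvfderiv_η {Y : ∀ x : M, TangentSpace (𝓡 d) x} {v : EuclideanSpace ℝ (Fin d)}
    (hY : HasCoord x₀ Y fun _ ↦ v) (hy : y ∈ (extChartAt (𝓡 d) x₀).target)
    (u : EuclideanSpace ℝ (Fin d)) :
    mvfderiv (𝓡 d) (fun x ↦ S.η x (Y x)) ((extChartAt (𝓡 d) x₀).symm y)
      (ofCoord x₀ ((extChartAt (𝓡 d) x₀).symm y) u) = fderiv ℝ (S.coordη x₀) y u v := by
  have hd : DifferentiableAt ℝ (S.coordη x₀) y :=
    (S.contDiffOn_coordη.contDiffAt (target_mem_nhds hy)).differentiableAt (by simp)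
  have hd' : HasFDerivAt (fun y ↦ S.coordη x₀ y v) ((fderiv ℝ (S.coordη x₀) y).flip v) y := by
    simpa using hd.hasFDerivAt.clm_apply (hasFDerivAt_const v y)
  rw [mvfderiv_eq_fderiv hy (f' := fun y ↦ S.coordη x₀ y v) hd'.differentiableAt
    (fun z hz ↦ by rw [hY.eq z hz]; rfl), hd'.fderiv]
  rfl

variable [IsContMDiffRiemannianBundle (𝓡 d) ∞ (EuclideanSpace ℝ (Fin d))
      (fun x : M ↦ TangentSpace (𝓡 d) x)] [T2Space M]
  {cov : CovariantDerivative (𝓡 d) (EuclideanSpace ℝ (Fin d))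
      (fun x : M ↦ TangentSpace (𝓡 d) x)}

/-- On chart-constant fields [X, Y] = 0, so dη and the Nijenhuis tensor reduce to first derivatives
of the components of η and φ. -/
lemma isLocalSasakian_coord (hcov : IsLeviCivita cov) (hS : S.IsSasakian) (x₀ : M) :
    IsLocalSasakian (extChartAt (𝓡 d) x₀).target (coordMetric x₀) (christoffel cov x₀)
      (S.coordφ x₀) (S.coordξ x₀) (S.coordη x₀) where
  toIsLocalMetric := isLocalMetric_coord hcov x₀
  smooth_φ := S.contDiffOn_coordφ
  smooth_ξ := S.contDiffOn_coordξ
  smooth_η := S.contDiffOn_coordη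
  φ_φ y hy v := by
    have h1 := congrArg (toCoord x₀ ((extChartAt (𝓡 d) x₀).symm y))
      (S.φ_φ _ (ofCoord x₀ ((extChartAt (𝓡 d) x₀).symm y) v))
    rw [S.φ_ofCoord hy, S.φ_ofCoord hy, toCoord_ofCoord (symm_mem_dom hy), map_add, map_neg,
      map_smul, toCoord_ofCoord (symm_mem_dom hy)] at h1
    exact h1
  η_ξ y hy := by
    rw [← S.η_ofCoord, ← S.ξ_eq_ofCoord hy, S.η_ξ]
  g_φ_φ y hy v w := by
    rw [coordMetric_apply, ← S.φ_ofCoord hy, ← S.φ_ofCoord hy, S.inner_φ_φ]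
    rfl
  contact y hy u v := by
    have hu := hasCoord_lift (x₀ := x₀) (u := fun _ ↦ u) contDiffOn_const
    have hv := hasCoord_lift (x₀ := x₀) (u := fun _ ↦ v) contDiffOn_const
    have h1 := hS.contact _ _ _ (hu.smoothFieldAt hy) (hv.smoothFieldAt hy)
    rw [dη, hu.mlieBracket hv hy, hu.inner_eq (HasCoord.φ S hv) hy, hu.eq y hy, hv.eq y hy,
      S.mvfderiv_η hv hy, S.mvfderiv_η hu hy] at h1
    rw [S.η_ofCoord] at h1
    simpa only [fderiv_fun_const, Pi.zero_apply, zero_apply, sub_zero, map_zero] using h1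
  normal y hy u v := by
    have hu := hasCoord_lift (x₀ := x₀) (u := fun _ ↦ u) contDiffOn_const
    have hv := hasCoord_lift (x₀ := x₀) (u := fun _ ↦ v) contDiffOn_const
    have h1 := hS.normal _ _ _ (hu.smoothFieldAt hy) (hv.smoothFieldAt hy)
    have hφ (w : EuclideanSpace ℝ (Fin d)) :
        HasFDerivAt (fun y ↦ S.coordφ x₀ y w) ((fderiv ℝ (S.coordφ x₀) y).flip w) y := by
      have hd : DifferentiableAt ℝ (S.coordφ x₀) y :=
        (S.contDiffOn_coordφ.contDiffAt (target_mem_nhds hy)).differentiableAt (by simp)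
      simpa using hd.hasFDerivAt.clm_apply (hasFDerivAt_const w y)
    rw [hS.contact _ _ _ (hu.smoothFieldAt hy) (hv.smoothFieldAt hy), nijenhuis,
      hu.mlieBracket hv hy, (HasCoord.φ S hu).mlieBracket (HasCoord.φ S hv) hy,
      (HasCoord.φ S hu).mlieBracket hv hy, hu.mlieBracket (HasCoord.φ S hv) hy,
      hu.inner_eq (HasCoord.φ S hv) hy, (hφ u).fderiv, (hφ v).fderiv, S.φ_ofCoord hy,
      S.φ_ofCoord hy, S.φ_ofCoord hy, S.φ_ofCoord hy, S.ξ_eq_ofCoord hy] at h1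
    have h2 := congrArg (toCoord x₀ ((extChartAt (𝓡 d) x₀).symm y)) h1
    simp only [map_add, map_sub, map_smul, toCoord_ofCoord (symm_mem_dom hy)] at h2
    simp only [fderiv_fun_const, Pi.zero_apply, zero_apply, map_zero, zero_sub, sub_zero, zero_add,
      sub_neg_eq_add, ContinuousLinearMap.flip_apply] at h2
    exact h2

lemma coord_phiSectional (hcov : IsLeviCivita cov) {c : ℝ} (hS : S.HasPhiSectionalCurvature cov c)
    (hy : y ∈ (extChartAt (𝓡 d) x₀).target) (u : EuclideanSpace ℝ (Fin d))
    (hu0 : S.coordη x₀ y u = 0) (hu1 : coordMetric x₀ y u u = 1) :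
    coordMetric x₀ y (localCurvature (christoffel cov x₀) y u (S.coordφ x₀ y u)
      (S.coordφ x₀ y u)) u = c := by
  have hu := hasCoord_lift (x₀ := x₀) (u := fun _ ↦ u) contDiffOn_const
  have h1 := hS ((extChartAt (𝓡 d) x₀).symm y) _ (hu.smoothFieldAt hy)
    (by rw [hu.eq y hy, S.η_ofCoord, hu0])
    (by
      rw [← sq_eq_sq₀ (norm_nonneg _) zero_le_one, ← real_inner_self_eq_norm_sq,
        hu.inner_eq hu hy, hu1, one_pow])
  rw [hu.curvature (HasCoord.φ S hu) (HasCoord.φ S hu) cov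
    (isLocalMetric_coord hcov x₀).smooth_Γ hy, hu.eq y hy] at h1
  exact h1

end AlmostContactMetric
end SasakiCoordinates

/-! ### Vector fields along a curve and chart independence of their covariant derivative -/

section Along

variable {d : ℕ} {M : Type*} [TopologicalSpace M] [ChartedSpace (EuclideanSpace ℝ (Fin d)) M]
  [IsManifold (𝓡 d) ∞ M]

/-- A vector field along `γ` which is smooth at `t`. -/
def SmoothAlongAt (γ : ℝ → M) (V : ∀ t, TangentSpace (𝓡 d) (γ t)) (t : ℝ) : Prop :=
  ContMDiffAt 𝓘(ℝ, ℝ) (𝓡 d).tangent ∞ (fun t ↦ (⟨γ t, V t⟩ : TangentBundle (𝓡 d) M)) t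

/-- The coordinates of a curve in the chart at `x₀`. -/
def curveCoord (d : ℕ) {M : Type*} [TopologicalSpace M]
    [ChartedSpace (EuclideanSpace ℝ (Fin d)) M] (x₀ : M) (γ : ℝ → M) (t : ℝ) :
    EuclideanSpace ℝ (Fin d) :=
  extChartAt (𝓡 d) x₀ (γ t)

/-- The components of a vector field along a curve in the chart at `x₀`. -/
def fieldCoord (x₀ : M) (γ : ℝ → M) (V : ∀ t, TangentSpace (𝓡 d) (γ t)) (t : ℝ) :
    EuclideanSpace ℝ (Fin d) :=
  toCoord x₀ (γ t) (V t)

lemma SmoothAlong.at {γ : ℝ → M} {V : ∀ t, TangentSpace (𝓡 d) (γ t)} {J : Set ℝ}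
    (h : SmoothAlong γ V J) (hJ : IsOpen J) {t : ℝ} (ht : t ∈ J) : SmoothAlongAt γ V t :=
  ContMDiffOn.contMDiffAt h (hJ.mem_nhds ht)

section Basic

variable {x₀ : M} {γ : ℝ → M} {t : ℝ} {V W : ∀ t, TangentSpace (𝓡 d) (γ t)}

lemma curveCoord_mem (hd : γ t ∈ dom d x₀) : curveCoord d x₀ γ t ∈ (extChartAt (𝓡 d) x₀).target :=
  (extChartAt (𝓡 d) x₀).map_source (mem_ext hd)

lemma symm_curveCoord (hd : γ t ∈ dom d x₀) :
    (extChartAt (𝓡 d) x₀).symm (curveCoord d x₀ γ t) = γ t :=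
  (extChartAt (𝓡 d) x₀).left_inv (mem_ext hd)

lemma eventually_mem_dom (hγ : ContinuousAt γ t) (hd : γ t ∈ dom d x₀) :
    ∀ᶠ s in 𝓝 t, γ s ∈ dom d x₀ :=
  hγ.preimage_mem_nhds ((chartAt (EuclideanSpace ℝ (Fin d)) x₀).open_source.mem_nhds hd)

lemma contDiffAt_curveCoord (hγ : ContMDiffAt 𝓘(ℝ, ℝ) (𝓡 d) ∞ γ t) (hd : γ t ∈ dom d x₀) :
    ContDiffAt ℝ ∞ (curveCoord d x₀ γ) t :=
  ((contMDiffAt_extChartAt' hd).comp t hγ).contDiffAt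

lemma ofCoord_fieldCoord (hd : γ t ∈ dom d x₀) : ofCoord x₀ (γ t) (fieldCoord x₀ γ V t) = V t :=
  ofCoord_toCoord hd _

lemma smoothAlongAt_iff (hγ : ContMDiffAt 𝓘(ℝ, ℝ) (𝓡 d) ∞ γ t) (hd : γ t ∈ dom d x₀) :
    SmoothAlongAt γ V t ↔ ContDiffAt ℝ ∞ (fieldCoord x₀ γ V) t := by
  rw [SmoothAlongAt, Trivialization.contMDiffAt_iff
    (e := trivializationAt (EuclideanSpace ℝ (Fin d)) (fun x : M ↦ TangentSpace (𝓡 d) x) x₀)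
    (by rw [Trivialization.mem_source]; exact mem_base hd), and_iff_right hγ,
    ← contMDiffAt_iff_contDiffAt]
  refine Filter.EventuallyEq.contMDiffAt_iff ?_
  filter_upwards [eventually_mem_dom hγ.continuousAt hd] with s hs
  exact snd_triv hs _

lemma SmoothAlongAt.contMDiffAt (hV : SmoothAlongAt γ V t) : ContMDiffAt 𝓘(ℝ, ℝ) (𝓡 d) ∞ γ t :=
  (contMDiffAt_totalSpace.1 hV).1

lemma SmoothAlongAt.contDiffAt (hV : SmoothAlongAt γ V t) (hd : γ t ∈ dom d x₀) :
    ContDiffAt ℝ ∞ (fieldCoord x₀ γ V) t := (smoothAlongAt_iff hV.contMDiffAt hd).1 hV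

lemma eventually_mdifferentiableAt (hγ : ContMDiffAt 𝓘(ℝ, ℝ) (𝓡 d) ∞ γ t) :
    ∀ᶠ s in 𝓝 t, MDifferentiableAt 𝓘(ℝ, ℝ) (𝓡 d) γ s := by
  have : IsManifold (𝓡 d) 1 M := IsManifold.of_le (n := ∞) (by norm_cast)
  have h1 : ContMDiffAt 𝓘(ℝ, ℝ) (𝓡 d) 1 γ t := hγ.of_le (by norm_cast)
  filter_upwards [(contMDiffAt_iff_contMDiffAt_nhds (by simp)).1 h1] with s hs
  exact hs.mdifferentiableAt (by simp)

lemma velocity_eq (hγ : MDifferentiableAt 𝓘(ℝ, ℝ) (𝓡 d) γ t) (hd : γ t ∈ dom d x₀) :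
    velocity γ t = ofCoord x₀ (γ t) (deriv (curveCoord d x₀ γ) t) := by
  have h1 := (mdifferentiableAt_extChartAt (I := 𝓡 d) hd).hasMFDerivAt.comp t hγ.hasMFDerivAt
  rw [← toCoord_eq_mfderiv hd] at h1
  let A : ℝ →L[ℝ] EuclideanSpace ℝ (Fin d) :=
    toCoord x₀ (γ t) ∘L (mfderiv 𝓘(ℝ, ℝ) (𝓡 d) γ t : ℝ →L[ℝ] TangentSpace (𝓡 d) (γ t))
  have h2 : HasFDerivAt (curveCoord d x₀ γ) A t := h1.hasFDerivAt
  rw [h2.hasDerivAt.deriv]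
  exact (ofCoord_toCoord hd (velocity γ t)).symm

lemma fieldCoord_velocity (hγ : MDifferentiableAt 𝓘(ℝ, ℝ) (𝓡 d) γ t) (hd : γ t ∈ dom d x₀) :
    fieldCoord x₀ γ (velocity γ) t = deriv (curveCoord d x₀ γ) t := by
  rw [fieldCoord, velocity_eq hγ hd, toCoord_ofCoord hd]

lemma fieldCoord_velocity_eventuallyEq (hγ : ContMDiffAt 𝓘(ℝ, ℝ) (𝓡 d) ∞ γ t)
    (hd : γ t ∈ dom d x₀) :
    fieldCoord x₀ γ (velocity γ) =ᶠ[𝓝 t] deriv (curveCoord d x₀ γ) := by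
  filter_upwards [eventually_mdifferentiableAt hγ, eventually_mem_dom hγ.continuousAt hd]
    with s hs hs'
  exact fieldCoord_velocity hs hs'

lemma _root_.ContDiffAt.deriv_infty {F : Type*} [NormedAddCommGroup F] [NormedSpace ℝ F]
    {f : ℝ → F} {t : ℝ} (hf : ContDiffAt ℝ ∞ f t) : ContDiffAt ℝ ∞ (deriv f) t := by
  have h1 : ContDiffAt ℝ ∞ (fderiv ℝ f) t := hf.fderiv_right (by simp)
  exact h1.clm_apply contDiffAt_const

lemma smoothAlongAt_velocity (hγ : ContMDiffAt 𝓘(ℝ, ℝ) (𝓡 d) ∞ γ t) :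
    SmoothAlongAt (d := d) γ (velocity γ) t := by
  have hd : γ t ∈ dom d (γ t) := mem_chart_source _ _
  rw [smoothAlongAt_iff hγ hd]
  exact (contDiffAt_curveCoord hγ hd).deriv_infty.congr_of_eventuallyEq
    (fieldCoord_velocity_eventuallyEq hγ hd)

lemma SmoothAlongAt.congr (hV : SmoothAlongAt γ V t) (h : ∀ᶠ s in 𝓝 t, W s = V s) :
    SmoothAlongAt γ W t := by
  refine ContMDiffAt.congr_of_eventuallyEq hV ?_
  filter_upwards [h] with s hs
  rw [hs]

lemma SmoothAlongAt.add (hV : SmoothAlongAt γ V t) (hW : SmoothAlongAt γ W t) :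
    SmoothAlongAt γ (fun s ↦ V s + W s) t := by
  have hd : γ t ∈ dom d (γ t) := mem_chart_source _ _
  rw [smoothAlongAt_iff hV.contMDiffAt hd]
  exact ((hV.contDiffAt hd).add (hW.contDiffAt hd)).congr_of_eventuallyEq
    (Filter.Eventually.of_forall fun s ↦ map_add _ _ _)

lemma SmoothAlongAt.smul {f : ℝ → ℝ} (hf : ContDiffAt ℝ ∞ f t) (hV : SmoothAlongAt γ V t) :
    SmoothAlongAt γ (fun s ↦ f s • V s) t := by
  have hd : γ t ∈ dom d (γ t) := mem_chart_source _ _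
  rw [smoothAlongAt_iff hV.contMDiffAt hd]
  exact (hf.smul (hV.contDiffAt hd)).congr_of_eventuallyEq
    (Filter.Eventually.of_forall fun s ↦ map_smul _ _ _)

variable (cov : CovariantDerivative (𝓡 d) (EuclideanSpace ℝ (Fin d))
      (fun x : M ↦ TangentSpace (𝓡 d) x))

/-- The covariant derivative along a curve in an arbitrary chart. -/
lemma covAlong_eq (hV : SmoothAlongAt γ V t) (hd : γ t ∈ dom d x₀) :
    covAlong cov γ V t = ofCoord x₀ (γ t) (deriv (fieldCoord x₀ γ V) t +
      christoffel cov x₀ (curveCoord d x₀ γ t) (deriv (curveCoord d x₀ γ) t)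
        (fieldCoord x₀ γ V t)) := by
  have hγ := hV.contMDiffAt
  have hd₁ : γ t ∈ dom d (γ t) := mem_chart_source _ _
  set x₁ := γ t with hx₁
  set e := trivializationAt (EuclideanSpace ℝ (Fin d)) (fun x : M ↦ TangentSpace (𝓡 d) x) x₁
    with he
  set b := (EuclideanSpace.basisFun (Fin d) ℝ).toBasis with hb
  have hframe : ∀ i, ∀ z ∈ dom d x₁, e.localFrame b i z = ofCoord x₁ z (b i) := by
    intro i z hz
    rw [Trivialization.localFrame_apply_of_mem_baseSet _ _ (mem_base hz)]
    simp only [Trivialization.basisAt, Module.Basis.map_apply]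
    rw [ofCoord, Trivialization.symmL_apply _ (mem_base hz)]
    rfl
  have hcoeff : ∀ i, (fun u ↦ e.localFrameCoeff (𝓡 d) b i (γ u) (V u)) =ᶠ[𝓝 t]
      fun u ↦ fieldCoord x₁ γ V u i := by
    intro i
    filter_upwards [eventually_mem_dom hγ.continuousAt hd₁] with u hu
    have h1 := Trivialization.localFrameCoeff_eq_coeff (e := e) (I := 𝓡 d) (b := b)
      (s := fun z ↦ ofCoord x₁ z (toCoord x₁ (γ u) (V u))) (mem_base hu) (i := i)
    simp only [ofCoord_toCoord hu] at h1
    rw [h1, he, snd_triv hu]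
    simp [b, fieldCoord]
  have hc : ∀ i, DifferentiableAt ℝ (fun u ↦ fieldCoord x₁ γ V u i) t := fun i ↦
    ((EuclideanSpace.proj i : EuclideanSpace ℝ (Fin d) →L[ℝ] ℝ).contDiff.contDiffAt.comp t
      (hV.contDiffAt hd₁)).differentiableAt (by simp)
  set y := curveCoord d x₀ γ t with hy
  have hyt : y ∈ (extChartAt (𝓡 d) x₀).target := curveCoord_mem hd
  have hys : (extChartAt (𝓡 d) x₀).symm y = x₁ := symm_curveCoord hd
  -- The definition of `covAlong` uses the frame of the chart at γ t. Here are its components in the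
  -- chart at x₀; product and chain rule then compare the two expressions.
  let S : Fin d → EuclideanSpace ℝ (Fin d) → EuclideanSpace ℝ (Fin d) := fun i z ↦
    toCoord x₀ ((extChartAt (𝓡 d) x₀).symm z) (e.localFrame b i ((extChartAt (𝓡 d) x₀).symm z))
  have hS : ∀ i, ContDiffAt ℝ ∞ (S i) y := by
    intro i
    have h1 : SmoothFieldAt (e.localFrame b i) ((extChartAt (𝓡 d) x₀).symm y) := by
      rw [hys]
      exact contMDiffAt_localFrame_of_mem ∞ e b i (mem_base hd₁)
    exact (((smooth_section_iff (symm_mem_dom hyt)).1 h1).comp y (contMDiffAt_symm hyt)).contDiffAt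
  have hS1 : ∀ i w, cov (e.localFrame b i) x₁ (ofCoord x₀ x₁ w) =
      ofCoord x₀ x₁ (fderiv ℝ (S i) y w + christoffel cov x₀ y w (S i y)) := by
    intro i w
    have h1 := cov_eq_of_coord cov hyt (hS i) (fun z hz ↦ (ofCoord_toCoord (symm_mem_dom hz)
      (e.localFrame b i ((extChartAt (𝓡 d) x₀).symm z))).symm) w
    rwa [hys] at h1
  have hdec : fieldCoord x₀ γ V =ᶠ[𝓝 t]
      fun u ↦ ∑ i, fieldCoord x₁ γ V u i • S i (curveCoord d x₀ γ u) := by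
    filter_upwards [eventually_mem_dom hγ.continuousAt hd₁, eventually_mem_dom hγ.continuousAt hd]
      with u hu hu'
    have h1 : V u = ∑ i, fieldCoord x₁ γ V u i • e.localFrame b i (γ u) := by
      rw [← ofCoord_fieldCoord (V := V) hu]
      conv_lhs => rw [← b.sum_repr (fieldCoord x₁ γ V u)]
      rw [map_sum]
      refine Finset.sum_congr rfl fun i _ ↦ ?_
      rw [map_smul, hframe i _ hu]
      simp [b]
    rw [fieldCoord, h1, map_sum]
    refine Finset.sum_congr rfl fun i _ ↦ ?_
    rw [map_smul]
    simp only [S]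
    rw [symm_curveCoord hu']
  have hcd := (contDiffAt_curveCoord hγ hd).differentiableAt (by simp) |>.hasDerivAt
  have hderiv : deriv (fieldCoord x₀ γ V) t = ∑ i, (deriv (fun u ↦ fieldCoord x₁ γ V u i) t • S i y
      + fieldCoord x₁ γ V t i • fderiv ℝ (S i) y (deriv (curveCoord d x₀ γ) t)) := by
    rw [hdec.deriv_eq]
    refine HasDerivAt.deriv (HasDerivAt.fun_sum fun i _ ↦ ?_)
    rw [add_comm]
    exact (hc i).hasDerivAt.smul ((((hS i).differentiableAt (by simp)).hasFDerivAt).comp_hasDerivAt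
      (f := curveCoord d x₀ γ) t hcd)
  have hval : fieldCoord x₀ γ V t = ∑ i, fieldCoord x₁ γ V t i • S i y := hdec.self_of_nhds
  have hbase : ∀ i, e.localFrame b i x₁ = ofCoord x₀ x₁ (S i y) := by
    intro i
    simp only [S]
    rw [hys, ofCoord_toCoord hd]
  rw [hderiv, hval, map_sum, ← Finset.sum_add_distrib, map_sum]
  simp only [covAlong]
  refine Finset.sum_congr rfl fun i _ ↦ ?_
  have hvel : velocity γ t = ofCoord x₀ x₁ (deriv (curveCoord d x₀ γ) t) :=
    velocity_eq (hγ.mdifferentiableAt (by simp)) hd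
  have hval' : e.localFrameCoeff (𝓡 d) b i (γ t) (V t) = fieldCoord x₁ γ V t i :=
    (hcoeff i).self_of_nhds
  change deriv (fun u ↦ e.localFrameCoeff (𝓡 d) b i (γ u) (V u)) t • e.localFrame b i x₁ +
    e.localFrameCoeff (𝓡 d) b i (γ t) (V t) • cov (e.localFrame b i) x₁ (velocity γ t) = _
  rw [(hcoeff i).deriv_eq, hval', hvel, hS1, hbase]
  simp only [map_add, map_smul, smul_add]
  module

end Basic
end Along

/-! ### Leibniz rules along a curve for functions, the metric, φ and ξ -/

section AlongCalculus

variable {d : ℕ} {M : Type*} [TopologicalSpace M] [ChartedSpace (EuclideanSpace ℝ (Fin d)) M]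
  [IsManifold (𝓡 d) ∞ M] {γ : ℝ → M} {t : ℝ} {V W : ∀ t, TangentSpace (𝓡 d) (γ t)}

section Connection

variable (cov : CovariantDerivative (𝓡 d) (EuclideanSpace ℝ (Fin d))
      (fun x : M ↦ TangentSpace (𝓡 d) x))

lemma mem_dom_self (x : M) : x ∈ dom d x := mem_chart_source _ x

lemma covAlong_congr (h : ∀ᶠ s in 𝓝 t, V s = W s) : covAlong cov γ V t = covAlong cov γ W t := by
  simp only [covAlong]
  refine Finset.sum_congr rfl fun i _ ↦ ?_
  rw [h.self_of_nhds]
  congr 2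
  refine Filter.EventuallyEq.deriv_eq ?_
  filter_upwards [h] with s hs
  rw [hs]

lemma covAlong_zero : covAlong cov γ (fun s ↦ (0 : TangentSpace (𝓡 d) (γ s))) t = 0 := by
  simp [covAlong]

lemma covAlong_add (hV : SmoothAlongAt γ V t) (hW : SmoothAlongAt γ W t) :
    covAlong cov γ (fun s ↦ V s + W s) t = covAlong cov γ V t + covAlong cov γ W t := by
  have hd := mem_dom_self (d := d) (γ t)
  have h1 : HasDerivAt (fieldCoord (γ t) γ fun s ↦ V s + W s)
      (deriv (fieldCoord (γ t) γ V) t + deriv (fieldCoord (γ t) γ W) t) t :=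
    (((hV.contDiffAt hd).differentiableAt (by simp)).hasDerivAt.add
      ((hW.contDiffAt hd).differentiableAt (by simp)).hasDerivAt).congr_of_eventuallyEq
      (Filter.Eventually.of_forall fun s ↦ map_add _ _ _)
  have h2 : fieldCoord (γ t) γ (fun s ↦ V s + W s) t =
    fieldCoord (γ t) γ V t + fieldCoord (γ t) γ W t := map_add _ _ _
  rw [covAlong_eq cov (hV.add hW) hd, covAlong_eq cov hV hd, covAlong_eq cov hW hd, h1.deriv, h2]
  simp only [map_add]
  abel

lemma covAlong_smul {f : ℝ → ℝ} (hf : ContDiffAt ℝ ∞ f t) (hV : SmoothAlongAt γ V t) :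
    covAlong cov γ (fun s ↦ f s • V s) t = deriv f t • V t + f t • covAlong cov γ V t := by
  have hd := mem_dom_self (d := d) (γ t)
  have h1 : HasDerivAt (fieldCoord (γ t) γ fun s ↦ f s • V s)
      (f t • deriv (fieldCoord (γ t) γ V) t + deriv f t • fieldCoord (γ t) γ V t) t :=
    ((hf.differentiableAt (by simp)).hasDerivAt.smul
      ((hV.contDiffAt hd).differentiableAt (by simp)).hasDerivAt).congr_of_eventuallyEq
      (Filter.Eventually.of_forall fun s ↦ map_smul _ _ _)
  have h2 : fieldCoord (γ t) γ (fun s ↦ f s • V s) t = f t • fieldCoord (γ t) γ V t :=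
    map_smul _ _ _
  rw [covAlong_eq cov (hV.smul hf) hd, covAlong_eq cov hV hd, h1.deriv, h2]
  have h3 := ofCoord_fieldCoord (V := V) hd
  simp only [map_add, map_smul]
  rw [h3]
  module

lemma fieldCoord_covAlong {x₀ : M} (hV : SmoothAlongAt γ V t) (hd : γ t ∈ dom d x₀) :
    fieldCoord x₀ γ (covAlong cov γ V) t =
      flatCov (christoffel cov x₀) (curveCoord d x₀ γ) (fieldCoord x₀ γ V) t := by
  rw [flatCov, fieldCoord, covAlong_eq cov hV hd, toCoord_ofCoord hd]

end Connection

section Metric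

variable [RiemannianBundle (fun x : M ↦ TangentSpace (𝓡 d) x)]
  [IsContMDiffRiemannianBundle (𝓡 d) ∞ (EuclideanSpace ℝ (Fin d))
      (fun x : M ↦ TangentSpace (𝓡 d) x)] [T2Space M]
  {cov : CovariantDerivative (𝓡 d) (EuclideanSpace ℝ (Fin d))
      (fun x : M ↦ TangentSpace (𝓡 d) x)}

lemma coordMetric_fieldCoord {x₀ : M} (hd : γ t ∈ dom d x₀) :
    coordMetric x₀ (curveCoord d x₀ γ t) (fieldCoord x₀ γ V t) (fieldCoord x₀ γ W t) =
      ⟪V t, W t⟫ := by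
  rw [coordMetric_apply, symm_curveCoord hd, ofCoord_fieldCoord hd, ofCoord_fieldCoord hd]

lemma coordMetric_inner_eventuallyEq {x₀ : M} (hγ : ContinuousAt γ t) (hd : γ t ∈ dom d x₀) :
    (fun s ↦ ⟪V s, W s⟫) =ᶠ[𝓝 t] fun s ↦
      coordMetric x₀ (curveCoord d x₀ γ s) (fieldCoord x₀ γ V s) (fieldCoord x₀ γ W s) := by
  filter_upwards [eventually_mem_dom hγ hd] with s hs
  rw [coordMetric_fieldCoord hs]

lemma contDiffAt_inner (hV : SmoothAlongAt γ V t) (hW : SmoothAlongAt γ W t) :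
    ContDiffAt ℝ ∞ (fun s ↦ ⟪V s, W s⟫) t := by
  have hd := mem_dom_self (d := d) (γ t)
  have hg := (contDiffOn_coordMetric (γ t)).contDiffAt (target_mem_nhds (curveCoord_mem hd))
  exact (((hg.comp t (contDiffAt_curveCoord hV.contMDiffAt hd)).clm_apply
    (hV.contDiffAt hd)).clm_apply (hW.contDiffAt hd)).congr_of_eventuallyEq
    (coordMetric_inner_eventuallyEq hV.contMDiffAt.continuousAt hd)

lemma hasDerivAt_inner (hcov : IsLeviCivita cov) (hV : SmoothAlongAt γ V t)
    (hW : SmoothAlongAt γ W t) :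
    HasDerivAt (fun s ↦ ⟪V s, W s⟫) (⟪covAlong cov γ V t, W t⟫ + ⟪V t, covAlong cov γ W t⟫) t := by
  have hd := mem_dom_self (d := d) (γ t)
  have hl := isLocalMetric_coord hcov (γ t)
  have hy := curveCoord_mem hd
  have hc : HasDerivAt (curveCoord d (γ t) γ) (deriv (curveCoord d (γ t) γ) t) t :=
    ((contDiffAt_curveCoord hV.contMDiffAt hd).differentiableAt (by simp)).hasDerivAt
  have h1 := hl.hasDerivAt_metric hc.differentiableAt ((hV.contDiffAt hd).differentiableAt (by simp))
    ((hW.contDiffAt hd).differentiableAt (by simp)) hy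
  refine (h1.congr_of_eventuallyEq
    (coordMetric_inner_eventuallyEq hV.contMDiffAt.continuousAt hd)).congr_deriv ?_
  rw [← coordMetric_fieldCoord (x₀ := γ t) (V := covAlong cov γ V) hd,
    ← coordMetric_fieldCoord (x₀ := γ t) (W := covAlong cov γ W) hd,
    fieldCoord_covAlong cov hV hd, fieldCoord_covAlong cov hW hd]

lemma smoothAlong_covAlong {J : Set ℝ} (hJ : IsOpen J)
    (hcov : cov.ContMDiffCovariantDerivative ∞) (hV : SmoothAlong γ V J) :
    SmoothAlong γ (covAlong cov γ V) J := by
  intro t ht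
  refine ContMDiffAt.contMDiffWithinAt ?_
  have hV' := hV.at hJ ht
  have hd := mem_dom_self (d := d) (γ t)
  have hc := contDiffAt_curveCoord hV'.contMDiffAt hd
  refine (smoothAlongAt_iff hV'.contMDiffAt hd).2 ?_
  have hΓ := (contDiffOn_christoffel hcov (γ t)).contDiffAt (target_mem_nhds (curveCoord_mem hd))
  refine ((hV'.contDiffAt hd).deriv_infty.add (((hΓ.comp t hc).clm_apply hc.deriv_infty).clm_apply
    (hV'.contDiffAt hd))).congr_of_eventuallyEq ?_
  filter_upwards [eventually_mem_dom hV'.contMDiffAt.continuousAt hd, hJ.mem_nhds ht] with s hs hs'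
  exact fieldCoord_covAlong cov (hV.at hJ hs') hs

namespace AlmostContactMetric

variable (S : AlmostContactMetric d M)

lemma smoothAlongAt_φ (hV : SmoothAlongAt γ V t) : SmoothAlongAt γ (fun s ↦ S.φ (γ s) (V s)) t :=
  ContMDiffAt.clm_bundle_apply ((S.smooth_φ (γ t)).comp t hV.contMDiffAt) hV

lemma smoothAlongAt_ξ (hγ : ContMDiffAt 𝓘(ℝ, ℝ) (𝓡 d) ∞ γ t) :
    SmoothAlongAt γ (fun s ↦ S.ξ (γ s)) t :=
  (S.smooth_ξ (γ t)).comp t hγ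

lemma fieldCoord_φ {x₀ : M} (hd : γ t ∈ dom d x₀) :
    fieldCoord x₀ γ (fun s ↦ S.φ (γ s) (V s)) t =
      S.coordφ x₀ (curveCoord d x₀ γ t) (fieldCoord x₀ γ V t) := by
  have h1 := S.φ_ofCoord (curveCoord_mem hd) (fieldCoord x₀ γ V t)
  rw [symm_curveCoord hd, ofCoord_fieldCoord hd] at h1
  rw [fieldCoord, h1, toCoord_ofCoord hd]

lemma fieldCoord_ξ {x₀ : M} (hd : γ t ∈ dom d x₀) :
    fieldCoord x₀ γ (fun s ↦ S.ξ (γ s)) t = S.coordξ x₀ (curveCoord d x₀ γ t) := by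
  rw [fieldCoord, coordξ, symm_curveCoord hd]

lemma coordη_fieldCoord {x₀ : M} (hd : γ t ∈ dom d x₀) :
    S.coordη x₀ (curveCoord d x₀ γ t) (fieldCoord x₀ γ V t) = S.η (γ t) (V t) := by
  rw [← S.η_ofCoord, symm_curveCoord hd, ofCoord_fieldCoord hd]

variable {S}

/-- `∇_T (φ V) = g(T, V) ξ - η(V) T + φ ∇_T V`. -/
lemma IsSasakian.covAlong_φ (hS : S.IsSasakian) (hcov : IsLeviCivita cov)
    (hV : SmoothAlongAt γ V t) :
    covAlong cov γ (fun s ↦ S.φ (γ s) (V s)) t = ⟪velocity γ t, V t⟫ • S.ξ (γ t)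
      - S.η (γ t) (V t) • velocity γ t + S.φ (γ t) (covAlong cov γ V t) := by
  have hd := mem_dom_self (d := d) (γ t)
  have hl := S.isLocalSasakian_coord hcov hS (γ t)
  have hy := curveCoord_mem hd
  have hγ := hV.contMDiffAt
  have hT := fieldCoord_velocity (hγ.mdifferentiableAt (by simp)) hd
  have hc : HasDerivAt (curveCoord d (γ t) γ) (deriv (curveCoord d (γ t) γ) t) t :=
    ((contDiffAt_curveCoord hγ hd).differentiableAt (by simp)).hasDerivAt
  have hg : HasDerivAt (fun s ↦ S.coordφ (γ t) (curveCoord d (γ t) γ s)) _ t :=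
    ((hl.contDiffAt hl.smooth_φ hy).differentiableAt (by simp)).hasFDerivAt.comp_hasDerivAt t hc
  have h1 := (hg.clm_apply ((hV.contDiffAt hd).differentiableAt (by simp)).hasDerivAt)
  have h2 : fieldCoord (γ t) γ (fun s ↦ S.φ (γ s) (V s)) =ᶠ[𝓝 t] fun s ↦
      S.coordφ (γ t) (curveCoord d (γ t) γ s) (fieldCoord (γ t) γ V s) := by
    filter_upwards [eventually_mem_dom hγ.continuousAt hd] with s hs
    exact S.fieldCoord_φ hs
  have e1 : fieldCoord (γ t) γ (covAlong cov γ fun s ↦ S.φ (γ s) (V s)) t =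
      ⟪velocity γ t, V t⟫ • fieldCoord (γ t) γ (fun s ↦ S.ξ (γ s)) t
      - S.η (γ t) (V t) • fieldCoord (γ t) γ (velocity γ) t
      + fieldCoord (γ t) γ (fun s ↦ S.φ (γ s) (covAlong cov γ V s)) t := by
    rw [fieldCoord_covAlong cov (S.smoothAlongAt_φ hV) hd, flatCov, (h1.congr_of_eventuallyEq h2).deriv,
      S.fieldCoord_φ hd, S.fieldCoord_φ hd, S.fieldCoord_ξ hd, fieldCoord_covAlong cov hV hd, flatCov,
      hl.fderiv_φ hy, ← coordMetric_fieldCoord (x₀ := γ t) (V := velocity γ) (W := V) hd,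
      ← S.coordη_fieldCoord (x₀ := γ t) hd, hT]
    simp only [map_add]
    abel
  have e2 := congrArg (ofCoord (γ t) (γ t)) e1
  simpa only [map_add, map_sub, map_smul, ofCoord_fieldCoord hd] using e2

lemma IsSasakian.covAlong_ξ (hS : S.IsSasakian) (hcov : IsLeviCivita cov)
    (hγ : ContMDiffAt 𝓘(ℝ, ℝ) (𝓡 d) ∞ γ t) :
    covAlong cov γ (fun s ↦ S.ξ (γ s)) t = -S.φ (γ t) (velocity γ t) := by
  have hd := mem_dom_self (d := d) (γ t)
  have hl := S.isLocalSasakian_coord hcov hS (γ t)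
  have hy := curveCoord_mem hd
  have hT := fieldCoord_velocity (hγ.mdifferentiableAt (by simp)) hd
  have hc : HasDerivAt (curveCoord d (γ t) γ) (deriv (curveCoord d (γ t) γ) t) t :=
    ((contDiffAt_curveCoord hγ hd).differentiableAt (by simp)).hasDerivAt
  have h1 : HasDerivAt (fun s ↦ S.coordξ (γ t) (curveCoord d (γ t) γ s)) _ t :=
    ((hl.contDiffAt hl.smooth_ξ hy).differentiableAt (by simp)).hasFDerivAt.comp_hasDerivAt t hc
  have h2 : fieldCoord (γ t) γ (fun s ↦ S.ξ (γ s)) =ᶠ[𝓝 t] fun s ↦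
      S.coordξ (γ t) (curveCoord d (γ t) γ s) := by
    filter_upwards [eventually_mem_dom hγ.continuousAt hd] with s hs
    exact S.fieldCoord_ξ hs
  have e1 : fieldCoord (γ t) γ (covAlong cov γ fun s ↦ S.ξ (γ s)) t =
      -fieldCoord (γ t) γ (fun s ↦ S.φ (γ s) (velocity γ s)) t := by
    rw [fieldCoord_covAlong cov (S.smoothAlongAt_ξ hγ) hd, flatCov, (h1.congr_of_eventuallyEq h2).deriv,
      S.fieldCoord_φ hd, S.fieldCoord_ξ hd, hl.fderiv_ξ hy, hT]
    abel
  have e2 := congrArg (ofCoord (γ t) (γ t)) e1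
  simpa only [map_neg, ofCoord_fieldCoord hd] using e2

end AlmostContactMetric
end Metric
end AlongCalculus

/-- Differentiation under the integral sign over a compact interval, for a smooth integrand. -/
lemma hasDerivAt_integral_of_smooth {e : ℝ → ℝ → ℝ} {ε : ℝ} {J : Set ℝ} {a b : ℝ} (hε : 0 < ε)
    (hJ : IsOpen J) (he : ContDiffOn ℝ ∞ (Function.uncurry e) (Ioo (-ε) ε ×ˢ J)) (hab : a ≤ b)
    (hJab : Icc a b ⊆ J) :
    HasDerivAt (fun s ↦ ∫ t in a..b, e s t) (∫ t in a..b, deriv (fun s ↦ e s t) 0) 0 := by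
  have hU : IsOpen (Ioo (-ε) ε ×ˢ J) := isOpen_Ioo.prod hJ
  -- Halving ε gives a compact rectangle inside the domain; a bound for the s-derivative there
  -- serves as a constant dominating function.
  have hsub : Icc (-(ε / 2)) (ε / 2) ×ˢ Icc a b ⊆ Ioo (-ε) ε ×ˢ J := by
    refine prod_mono (fun s hs ↦ ⟨?_, ?_⟩) hJab
    · linarith [hs.1]
    · linarith [hs.2]
  have hd : ∀ s ∈ Ioo (-ε) ε, ∀ t ∈ J, HasDerivAt (fun s ↦ e s t)
      (fderiv ℝ (Function.uncurry e) (s, t) (1, 0)) s := fun s hs t ht ↦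
    hasDerivAt_fst (differentiableAt_of_mem hU he ⟨hs, ht⟩)
  have hc : ContinuousOn (fun q ↦ fderiv ℝ (Function.uncurry e) q (1, 0)) (Ioo (-ε) ε ×ˢ J) :=
    (contDiffOn_fderiv_plane hU he).continuousOn.clm_apply continuousOn_const
  obtain ⟨C, hC⟩ := (isCompact_Icc.prod isCompact_Icc).exists_bound_of_continuousOn (hc.mono hsub)
  have huIoc : uIoc a b ⊆ Icc a b := by rw [uIoc_of_le hab]; exact Ioc_subset_Icc_self
  have h0 : (0 : ℝ) ∈ Ioo (-ε) ε := ⟨by linarith, hε⟩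
  have hcont : ∀ s ∈ Ioo (-ε) ε, ContinuousOn (e s) (Icc a b) := fun s hs ↦
    he.continuousOn.comp (by fun_prop : ContinuousOn (fun t : ℝ ↦ (s, t)) (Icc a b))
      fun t ht ↦ ⟨hs, hJab ht⟩
  have key := intervalIntegral.hasDerivAt_integral_of_dominated_loc_of_deriv_le (μ := volume)
    (F := e) (F' := fun s t ↦ fderiv ℝ (Function.uncurry e) (s, t) (1, 0)) (x₀ := 0) (a := a)
    (b := b) (s := Ioo (-(ε / 2)) (ε / 2)) (bound := fun _ ↦ C)
    (Ioo_mem_nhds (by linarith) (by linarith)) ?_ ?_ ?_ ?_ ?_ ?_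
  · have h2 : ∫ t in a..b, fderiv ℝ (Function.uncurry e) (0, t) (1, 0) =
        ∫ t in a..b, deriv (fun s ↦ e s t) 0 := by
      refine intervalIntegral.integral_congr fun t ht ↦ ?_
      rw [uIcc_of_le hab] at ht
      exact (hd 0 h0 t (hJab ht)).deriv.symm
    rw [← h2]
    exact key.2
  · filter_upwards [Ioo_mem_nhds h0.1 h0.2] with s hs
    exact ((hcont s hs).mono huIoc).aestronglyMeasurable measurableSet_uIoc
  · exact ContinuousOn.intervalIntegrable (by rw [uIcc_of_le hab]; exact hcont 0 h0)
  · refine ContinuousOn.aestronglyMeasurable ?_ measurableSet_uIoc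
    exact hc.comp (by fun_prop : ContinuousOn (fun t : ℝ ↦ ((0 : ℝ), t)) (uIoc a b))
      fun t ht ↦ ⟨h0, hJab (huIoc ht)⟩
  · exact Filter.Eventually.of_forall fun t ht s hs ↦ hC (s, t) ⟨Ioo_subset_Icc_self hs, huIoc ht⟩
  · exact intervalIntegrable_const
  · refine Filter.Eventually.of_forall fun t ht s hs ↦ hd s ?_ t (hJab (huIoc ht))
    exact ⟨by linarith [hs.1], by linarith [hs.2]⟩

lemma flatCov_congr {V : Type*} [NormedAddCommGroup V] [NormedSpace ℝ V]
    (Γ : V → V →L[ℝ] V →L[ℝ] V) {c c' v v' : ℝ → V} {t : ℝ} (hc : c =ᶠ[𝓝 t] c')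
    (hv : v =ᶠ[𝓝 t] v') : flatCov Γ c v =ᶠ[𝓝 t] flatCov Γ c' v' := by
  filter_upwards [hc.eventually_nhds, hv.eventually_nhds] with s h1 h2
  rw [flatCov, flatCov, Filter.EventuallyEq.deriv_eq h1, Filter.EventuallyEq.deriv_eq h2,
    h1.self_of_nhds, h2.self_of_nhds]

/-! ### Variations of a curve and the derivatives of the two densities -/

section Variation

variable {d : ℕ} {M : Type*} [TopologicalSpace M] [ChartedSpace (EuclideanSpace ℝ (Fin d)) M]
  [IsManifold (𝓡 d) ∞ M]

lemma fieldCoord_tension (cov : CovariantDerivative (𝓡 d) (EuclideanSpace ℝ (Fin d))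
      (fun x : M ↦ TangentSpace (𝓡 d) x)) {γ : ℝ → M} {t : ℝ} {x₀ : M}
    (hγ : ContMDiffAt 𝓘(ℝ, ℝ) (𝓡 d) ∞ γ t) (hd : γ t ∈ dom d x₀) :
    fieldCoord x₀ γ (tension cov γ) t = flatCov (christoffel cov x₀) (curveCoord d x₀ γ)
      (deriv (curveCoord d x₀ γ)) t := by
  have h1 := fieldCoord_covAlong cov (smoothAlongAt_velocity hγ) hd
  rw [(flatCov_congr _ Filter.EventuallyEq.rfl
    (fieldCoord_velocity_eventuallyEq hγ hd)).self_of_nhds] at h1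
  exact h1

/-- The variation field `∂F/∂s` at `s = 0` of a variation `F` of `γ`. -/
def varField (d : ℕ) {M : Type*} [TopologicalSpace M] [ChartedSpace (EuclideanSpace ℝ (Fin d)) M]
    [IsManifold (𝓡 d) ∞ M] (F : ℝ → ℝ → M) (γ : ℝ → M) (t : ℝ) : TangentSpace (𝓡 d) (γ t) :=
  ofCoord (γ t) (γ t) (deriv (fun s ↦ extChartAt (𝓡 d) (γ t) (F s t)) 0)

/-- Both sides are the velocity of σ. Since `varField` uses the chart at γ t, which moves with t,
this is what allows smoothness in t to be checked in one fixed chart. -/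
lemma ofCoord_deriv_eq {σ : ℝ → M} {s : ℝ} {x x₀ : M} (hx : σ s = x)
    (hσ : MDifferentiableAt 𝓘(ℝ, ℝ) (𝓡 d) σ s) (hd : x ∈ dom d x₀) :
    ofCoord x x (deriv (fun s ↦ extChartAt (𝓡 d) x (σ s)) s) =
      ofCoord x₀ x (deriv (fun s ↦ extChartAt (𝓡 d) x₀ (σ s)) s) := by
  subst hx
  exact (velocity_eq hσ (mem_dom_self _)).symm.trans (velocity_eq hσ hd)

namespace IsVariation

variable {F : ℝ → ℝ → M} {ε : ℝ} {γ : ℝ → M} {J : Set ℝ} {a b : ℝ}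
  (hF : IsVariation (d := d) F ε γ J a b) (hJ : IsOpen J)
include hF hJ

/-- The part of the parameter domain which is mapped to the chart at `x₀`. -/
lemma isOpen_domain (x₀ : M) : IsOpen ((Ioo (-ε) ε ×ˢ J) ∩ Function.uncurry F ⁻¹' dom d x₀) :=
  hF.smooth.continuousOn.isOpen_inter_preimage (isOpen_Ioo.prod hJ)
    (chartAt (EuclideanSpace ℝ (Fin d)) x₀).open_source

lemma contMDiffAt {q : ℝ × ℝ} (hq : q ∈ Ioo (-ε) ε ×ˢ J) :
    ContMDiffAt 𝓘(ℝ, ℝ × ℝ) (𝓡 d) ∞ (Function.uncurry F) q :=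
  hF.smooth.contMDiffAt ((isOpen_Ioo.prod hJ).mem_nhds hq)

lemma contDiffOn_coord (x₀ : M) :
    ContDiffOn ℝ ∞ (fun q : ℝ × ℝ ↦ extChartAt (𝓡 d) x₀ (F q.1 q.2))
      ((Ioo (-ε) ε ×ˢ J) ∩ Function.uncurry F ⁻¹' dom d x₀) := fun q hq ↦
  ((contMDiffAt_extChartAt' (I := 𝓡 d) (x := x₀) hq.2).comp q
    (hF.contMDiffAt hJ hq.1)).contDiffAt.contDiffWithinAt

lemma contMDiffAt_curve {s t : ℝ} (hs : s ∈ Ioo (-ε) ε) (ht : t ∈ J) :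
    ContMDiffAt 𝓘(ℝ, ℝ) (𝓡 d) ∞ (F s) t := by
  have h1 : ContMDiffAt 𝓘(ℝ, ℝ) 𝓘(ℝ, ℝ × ℝ) ∞ (fun u : ℝ ↦ (s, u)) t :=
    (contDiff_prodMk_right s).contDiffAt.contMDiffAt
  exact (hF.contMDiffAt hJ (q := (s, t)) ⟨hs, ht⟩).comp t h1

lemma contMDiffAt_transversal {s t : ℝ} (hs : s ∈ Ioo (-ε) ε) (ht : t ∈ J) :
    ContMDiffAt 𝓘(ℝ, ℝ) (𝓡 d) ∞ (fun s ↦ F s t) s := by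
  have h1 : ContMDiffAt 𝓘(ℝ, ℝ) 𝓘(ℝ, ℝ × ℝ) ∞ (fun u : ℝ ↦ (u, t)) s :=
    (contDiff_prodMk_left t).contDiffAt.contMDiffAt
  exact (hF.contMDiffAt hJ (q := (s, t)) ⟨hs, ht⟩).comp s h1

omit hJ in
lemma zero_mem : (0 : ℝ) ∈ Ioo (-ε) ε := ⟨by linarith [hF.pos], hF.pos⟩

omit hJ in
lemma mem_domain {x₀ : M} {t : ℝ} (ht : t ∈ J) (hd : γ t ∈ dom d x₀) :
    ((0 : ℝ), t) ∈ (Ioo (-ε) ε ×ˢ J) ∩ Function.uncurry F ⁻¹' dom d x₀ :=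
  ⟨⟨hF.zero_mem, ht⟩, by simpa [Function.uncurry, hF.initial t ht] using hd⟩

lemma fieldCoord_varField {x₀ : M} {t : ℝ} (ht : t ∈ J) (hd : γ t ∈ dom d x₀) :
    fieldCoord x₀ γ (varField d F γ) t =
      fderiv ℝ (fun q : ℝ × ℝ ↦ extChartAt (𝓡 d) x₀ (F q.1 q.2)) (0, t) (1, 0) := by
  have h1 := ofCoord_deriv_eq (σ := fun s ↦ F s t) (hF.initial t ht)
    ((hF.contMDiffAt_transversal hJ hF.zero_mem ht).mdifferentiableAt (by simp)) hd
  have h2 := hasDerivAt_fst (differentiableAt_of_mem (hF.isOpen_domain hJ x₀)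
    (hF.contDiffOn_coord hJ x₀) (hF.mem_domain ht hd))
  rw [fieldCoord, varField, h1, toCoord_ofCoord hd]
  exact h2.deriv

lemma smoothAlong_varField (hγ : ContMDiffOn 𝓘(ℝ, ℝ) (𝓡 d) ∞ γ J) :
    SmoothAlong γ (varField d F γ) J := by
  intro t ht
  have hγt := hγ.contMDiffAt (hJ.mem_nhds ht)
  have hd := mem_dom_self (d := d) (γ t)
  refine ContMDiffAt.contMDiffWithinAt ((smoothAlongAt_iff hγt hd).2 ?_)
  have h1 := ((contDiffOn_fderiv_plane (hF.isOpen_domain hJ (γ t))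
    (hF.contDiffOn_coord hJ (γ t))).contDiffAt ((hF.isOpen_domain hJ (γ t)).mem_nhds
      (hF.mem_domain ht hd))).clm_apply (contDiffAt_const (c := ((1 : ℝ), (0 : ℝ))))
  have h2 : ContDiffAt ℝ ∞ (fun u : ℝ ↦ ((0 : ℝ), u)) t :=
    (contDiff_prodMk_right (0 : ℝ)).contDiffAt
  refine (h1.comp t h2).congr_of_eventuallyEq ?_
  filter_upwards [eventually_mem_dom hγt.continuousAt hd, hJ.mem_nhds ht] with u hu hu'
  exact hF.fieldCoord_varField hJ hu' hu

omit hJ in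
lemma varField_eq_zero {K : Set ℝ}
    (hK : ∀ s ∈ Ioo (-ε) ε, ∀ t ∈ J \ K, F s t = γ t) {t : ℝ} (ht : t ∈ J \ K) :
    varField d F γ t = 0 := by
  have h1 : (fun s ↦ extChartAt (𝓡 d) (γ t) (F s t)) =ᶠ[𝓝 0]
      fun _ ↦ extChartAt (𝓡 d) (γ t) (γ t) := by
    filter_upwards [Ioo_mem_nhds hF.zero_mem.1 hF.zero_mem.2] with s hs
    rw [hK s hs t ht]
  rw [varField, h1.deriv_eq, deriv_const, map_zero]

section Riemannian

variable [RiemannianBundle (fun x : M ↦ TangentSpace (𝓡 d) x)]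
  [IsContMDiffRiemannianBundle (𝓡 d) ∞ (EuclideanSpace ℝ (Fin d))
      (fun x : M ↦ TangentSpace (𝓡 d) x)] [T2Space M]
  {cov : CovariantDerivative (𝓡 d) (EuclideanSpace ℝ (Fin d))
      (fun x : M ↦ TangentSpace (𝓡 d) x)} 

lemma norm_velocity_sq {x₀ : M} {s t : ℝ}
    (h : (s, t) ∈ (Ioo (-ε) ε ×ˢ J) ∩ Function.uncurry F ⁻¹' dom d x₀) :
    ‖velocity (d := d) (F s) t‖ ^ 2 = coordMetric x₀ (extChartAt (𝓡 d) x₀ (F s t))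
      (fderiv ℝ (fun q : ℝ × ℝ ↦ extChartAt (𝓡 d) x₀ (F q.1 q.2)) (s, t) (0, 1))
      (fderiv ℝ (fun q : ℝ × ℝ ↦ extChartAt (𝓡 d) x₀ (F q.1 q.2)) (s, t) (0, 1)) := by
  have hd : F s t ∈ dom d x₀ := h.2
  have h1 := deriv_snd (hF.isOpen_domain hJ x₀) (hF.contDiffOn_coord hJ x₀) h
  rw [← real_inner_self_eq_norm_sq, ← coordMetric_fieldCoord (x₀ := x₀) hd,
    fieldCoord_velocity ((hF.contMDiffAt_curve hJ h.1.1 h.1.2).mdifferentiableAt (by simp)) hd,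
    ← h1]
  rfl

lemma norm_tension_sq {x₀ : M} {s t : ℝ}
    (h : (s, t) ∈ (Ioo (-ε) ε ×ˢ J) ∩ Function.uncurry F ⁻¹' dom d x₀) :
    ‖tension cov (F s) t‖ ^ 2 = coordMetric x₀ (extChartAt (𝓡 d) x₀ (F s t))
      (fderiv ℝ (fderiv ℝ (fun q : ℝ × ℝ ↦ extChartAt (𝓡 d) x₀ (F q.1 q.2))) (s, t) (0, 1) (0, 1)
        + christoffel cov x₀ (extChartAt (𝓡 d) x₀ (F s t))
          (fderiv ℝ (fun q : ℝ × ℝ ↦ extChartAt (𝓡 d) x₀ (F q.1 q.2)) (s, t) (0, 1))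
          (fderiv ℝ (fun q : ℝ × ℝ ↦ extChartAt (𝓡 d) x₀ (F q.1 q.2)) (s, t) (0, 1)))
      (fderiv ℝ (fderiv ℝ (fun q : ℝ × ℝ ↦ extChartAt (𝓡 d) x₀ (F q.1 q.2))) (s, t) (0, 1) (0, 1)
        + christoffel cov x₀ (extChartAt (𝓡 d) x₀ (F s t))
          (fderiv ℝ (fun q : ℝ × ℝ ↦ extChartAt (𝓡 d) x₀ (F q.1 q.2)) (s, t) (0, 1))
          (fderiv ℝ (fun q : ℝ × ℝ ↦ extChartAt (𝓡 d) x₀ (F q.1 q.2)) (s, t) (0, 1))) := by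
  have hd : F s t ∈ dom d x₀ := h.2
  have h1 := flatCov_deriv (hF.isOpen_domain hJ x₀) (hF.contDiffOn_coord hJ x₀) h
    (christoffel cov x₀)
  rw [← real_inner_self_eq_norm_sq, ← coordMetric_fieldCoord (x₀ := x₀) hd,
    fieldCoord_tension cov (hF.contMDiffAt_curve hJ h.1.1 h.1.2) hd, ← h1]
  rfl

lemma contDiffOn_norm_velocity_sq (hcov : IsLeviCivita cov) :
    ContDiffOn ℝ ∞ (Function.uncurry fun s t ↦ ‖velocity (d := d) (F s) t‖ ^ 2)
      (Ioo (-ε) ε ×ˢ J) := by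
  rintro ⟨s, t⟩ h
  have hd := mem_dom_self (d := d) (F s t)
  have hU := hF.isOpen_domain hJ (F s t)
  have h' : (s, t) ∈ (Ioo (-ε) ε ×ˢ J) ∩ Function.uncurry F ⁻¹' dom d (F s t) := ⟨h, hd⟩
  refine (((isLocalMetric_coord hcov (F s t)).contDiffAt_energy hU
    (hF.contDiffOn_coord hJ (F s t)) h' (curveCoord_mem (γ := F s) hd)).congr_of_eventuallyEq
      ?_).contDiffWithinAt
  filter_upwards [hU.mem_nhds h'] with q hq
  exact hF.norm_velocity_sq hJ hq

lemma contDiffOn_norm_tension_sq (hcov : IsLeviCivita cov) :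
    ContDiffOn ℝ ∞ (Function.uncurry fun s t ↦ ‖tension cov (F s) t‖ ^ 2)
      (Ioo (-ε) ε ×ˢ J) := by
  rintro ⟨s, t⟩ h
  have hd := mem_dom_self (d := d) (F s t)
  have hU := hF.isOpen_domain hJ (F s t)
  have h' : (s, t) ∈ (Ioo (-ε) ε ×ˢ J) ∩ Function.uncurry F ⁻¹' dom d (F s t) := ⟨h, hd⟩
  refine (((isLocalMetric_coord hcov (F s t)).contDiffAt_bienergy hU
    (hF.contDiffOn_coord hJ (F s t)) h' (curveCoord_mem (γ := F s) hd)).congr_of_eventuallyEq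
      ?_).contDiffWithinAt
  filter_upwards [hU.mem_nhds h'] with q hq
  exact hF.norm_tension_sq hJ hq

lemma coord_zero_eventuallyEq {x₀ : M} {t : ℝ} (ht : t ∈ J) :
    (fun u ↦ extChartAt (𝓡 d) x₀ (F 0 u)) =ᶠ[𝓝 t] curveCoord d x₀ γ := by
  filter_upwards [hJ.mem_nhds ht] with u hu
  rw [hF.initial u hu, curveCoord]

lemma deriv_norm_velocity_sq (hcov : IsLeviCivita cov) (hγ : ContMDiffOn 𝓘(ℝ, ℝ) (𝓡 d) ∞ γ J)
    {t : ℝ} (ht : t ∈ J) :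
    deriv (fun s ↦ ‖velocity (d := d) (F s) t‖ ^ 2) 0 =
      2 * ⟪covAlong cov γ (varField d F γ) t, velocity γ t⟫ := by
  have hd := mem_dom_self (d := d) (γ t)
  have hγt := hγ.contMDiffAt (hJ.mem_nhds ht)
  have hV := (hF.smoothAlong_varField hJ hγ).at hJ ht
  have hU := hF.isOpen_domain hJ (γ t)
  have hp := hF.mem_domain ht hd
  have hc := hF.coord_zero_eventuallyEq hJ (x₀ := γ t) ht
  have hval : extChartAt (𝓡 d) (γ t) (F 0 t) = curveCoord d (γ t) γ t := hc.self_of_nhds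
  have key := (isLocalMetric_coord hcov (γ t)).hasDerivAt_energy hU (hF.contDiffOn_coord hJ (γ t))
    hp (hval ▸ curveCoord_mem hd) (S := fieldCoord (γ t) γ (varField d F γ)) (by
      filter_upwards [hJ.mem_nhds ht, eventually_mem_dom hγt.continuousAt hd] with u hu hu'
      exact hF.fieldCoord_varField hJ hu hu')
  have key' := key.congr_of_eventuallyEq (f₁ := fun s ↦ ‖velocity (d := d) (F s) t‖ ^ 2) (by
    filter_upwards [eventually_mem_fst hU hp] with s hs
    exact hF.norm_velocity_sq hJ hs)
  rw [key'.deriv, hc.deriv_eq, hval,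
    (flatCov_congr _ hc Filter.EventuallyEq.rfl).self_of_nhds,
    ← fieldCoord_covAlong cov hV hd, ← fieldCoord_velocity (hγt.mdifferentiableAt (by simp)) hd,
    coordMetric_fieldCoord hd]

/-- The curvature term stays in the chart at γ t, because `curvature` acts on vector fields of M
while the variation field lives only along γ. -/
lemma deriv_norm_tension_sq (hcov : IsLeviCivita cov) (hγ : ContMDiffOn 𝓘(ℝ, ℝ) (𝓡 d) ∞ γ J)
    {t : ℝ} (ht : t ∈ J) :
    deriv (fun s ↦ ‖tension cov (F s) t‖ ^ 2) 0 =
      2 * (⟪covAlong cov γ (covAlong cov γ (varField d F γ)) t, tension cov γ t⟫ +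
        coordMetric (γ t) (curveCoord d (γ t) γ t) (localCurvature (christoffel cov (γ t))
          (curveCoord d (γ t) γ t) (fieldCoord (γ t) γ (varField d F γ) t)
          (fieldCoord (γ t) γ (velocity γ) t) (fieldCoord (γ t) γ (velocity γ) t))
          (fieldCoord (γ t) γ (tension cov γ) t)) := by
  have hd := mem_dom_self (d := d) (γ t)
  have hγt := hγ.contMDiffAt (hJ.mem_nhds ht)
  have hVJ := hF.smoothAlong_varField hJ hγ
  have hU := hF.isOpen_domain hJ (γ t)
  have hp := hF.mem_domain ht hd
  have hc := hF.coord_zero_eventuallyEq hJ (x₀ := γ t) ht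
  have hval : extChartAt (𝓡 d) (γ t) (F 0 t) = curveCoord d (γ t) γ t := hc.self_of_nhds
  have key := (isLocalMetric_coord hcov (γ t)).hasDerivAt_bienergy hU
    (hF.contDiffOn_coord hJ (γ t)) hp (hval ▸ curveCoord_mem hd)
    (S := fieldCoord (γ t) γ (varField d F γ)) (by
      filter_upwards [hJ.mem_nhds ht, eventually_mem_dom hγt.continuousAt hd] with u hu hu'
      exact hF.fieldCoord_varField hJ hu hu')
  have key' := key.congr_of_eventuallyEq (f₁ := fun s ↦ ‖tension cov (F s) t‖ ^ 2) (by
    filter_upwards [eventually_mem_fst hU hp] with s hs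
    exact hF.norm_tension_sq hJ hs)
  have hD : fieldCoord (γ t) γ (covAlong cov γ (varField d F γ)) =ᶠ[𝓝 t]
      flatCov (christoffel cov (γ t)) (curveCoord d (γ t) γ)
        (fieldCoord (γ t) γ (varField d F γ)) := by
    filter_upwards [hJ.mem_nhds ht, eventually_mem_dom hγt.continuousAt hd] with u hu hu'
    exact fieldCoord_covAlong cov (hVJ.at hJ hu) hu'
  have hDD := fieldCoord_covAlong cov ((smoothAlong_covAlong hJ hcov.smooth hVJ).at hJ ht) hd
  rw [(flatCov_congr _ Filter.EventuallyEq.rfl hD).self_of_nhds] at hDD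
  have hτ := fieldCoord_tension cov hγt hd
  rw [key'.deriv,
    (flatCov_congr _ hc (flatCov_congr _ hc Filter.EventuallyEq.rfl)).self_of_nhds, ← hDD,
    (flatCov_congr _ hc hc.deriv).self_of_nhds, ← hτ, hc.deriv_eq, hval,
    ← fieldCoord_velocity (hγt.mdifferentiableAt (by simp)) hd, coordMetric_fieldCoord hd]

end Riemannian
end IsVariation
end Variation

/-! ### The first variation formula -/

section EulerLagrange

variable {d : ℕ} {M : Type*} [TopologicalSpace M] [ChartedSpace (EuclideanSpace ℝ (Fin d)) M]
  [IsManifold (𝓡 d) ∞ M]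

/-- The Euler-Lagrange field `δ₂ (∇_T² τ + κ τ) - δ₁ τ` of a curve whose tension field `τ`
satisfies `R(τ, T) T = κ τ`. -/
def eulerLagrange (cov : CovariantDerivative (𝓡 d) (EuclideanSpace ℝ (Fin d))
      (fun x : M ↦ TangentSpace (𝓡 d) x)) (δ₁ δ₂ κ : ℝ) (γ : ℝ → M) (t : ℝ) :
    TangentSpace (𝓡 d) (γ t) :=
  δ₂ • covAlong cov γ (covAlong cov γ (tension cov γ)) t + (δ₂ * κ - δ₁) • tension cov γ t

variable [RiemannianBundle (fun x : M ↦ TangentSpace (𝓡 d) x)]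

/-- The tension field `τ` of `γ` satisfies `g(R(v, T) T, τ) = κ g(v, τ)` for all `v`. -/
def TensionIsJacobiEigenvector (cov : CovariantDerivative (𝓡 d) (EuclideanSpace ℝ (Fin d))
      (fun x : M ↦ TangentSpace (𝓡 d) x)) (κ : ℝ) (γ : ℝ → M) (t : ℝ) : Prop :=
  ∀ v : EuclideanSpace ℝ (Fin d),
    coordMetric (γ t) (curveCoord d (γ t) γ t) (localCurvature (christoffel cov (γ t))
      (curveCoord d (γ t) γ t) v (fieldCoord (γ t) γ (velocity γ) t)
      (fieldCoord (γ t) γ (velocity γ) t)) (fieldCoord (γ t) γ (tension cov γ) t) =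
    κ * coordMetric (γ t) (curveCoord d (γ t) γ t) v (fieldCoord (γ t) γ (tension cov γ) t)

variable [IsContMDiffRiemannianBundle (𝓡 d) ∞ (EuclideanSpace ℝ (Fin d))
      (fun x : M ↦ TangentSpace (𝓡 d) x)] [T2Space M]
  {cov : CovariantDerivative (𝓡 d) (EuclideanSpace ℝ (Fin d))
      (fun x : M ↦ TangentSpace (𝓡 d) x)} {δ₁ δ₂ κ : ℝ} {γ : ℝ → M} {J : Set ℝ}

lemma smoothAlong_velocity (hJ : IsOpen J) (hγ : ContMDiffOn 𝓘(ℝ, ℝ) (𝓡 d) ∞ γ J) :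
    SmoothAlong (d := d) γ (velocity γ) J := fun _ ht ↦
  ContMDiffAt.contMDiffWithinAt (smoothAlongAt_velocity (hγ.contMDiffAt (hJ.mem_nhds ht)))

lemma smoothAlong_tension (hJ : IsOpen J) (hγ : ContMDiffOn 𝓘(ℝ, ℝ) (𝓡 d) ∞ γ J)
    (hcov : IsLeviCivita cov) : SmoothAlong γ (tension cov γ) J :=
  smoothAlong_covAlong hJ hcov.smooth (smoothAlong_velocity hJ hγ)

lemma smoothAlong_eulerLagrange (hJ : IsOpen J) (hγ : ContMDiffOn 𝓘(ℝ, ℝ) (𝓡 d) ∞ γ J)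
    (hcov : IsLeviCivita cov) (δ₁ δ₂ κ : ℝ) :
    SmoothAlong γ (eulerLagrange cov δ₁ δ₂ κ γ) J := by
  intro t ht
  have hτ := smoothAlong_tension hJ hγ hcov
  have h2 := smoothAlong_covAlong hJ hcov.smooth (smoothAlong_covAlong hJ hcov.smooth hτ)
  exact ContMDiffAt.contMDiffWithinAt (((h2.at hJ ht).smul contDiffAt_const).add
    ((hτ.at hJ ht).smul contDiffAt_const))

lemma continuousOn_inner_along {V W : ∀ t, TangentSpace (𝓡 d) (γ t)} (hJ : IsOpen J)
    (hV : SmoothAlong γ V J) (hW : SmoothAlong γ W J) : ContinuousOn (fun t ↦ ⟪V t, W t⟫) J :=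
  fun _ ht ↦ (contDiffAt_inner (hV.at hJ ht) (hW.at hJ ht)).continuousAt.continuousWithinAt

/-- The first variation of the functional `δ₁ ∫ |dγ|² + δ₂ ∫ |τ(γ)|²`. -/
theorem IsVariation.hasDerivAt_sesquiEnergy {F : ℝ → ℝ → M} {ε a b : ℝ}
    (hF : IsVariation (d := d) F ε γ J a b) (hJ : IsOpen J) (hcov : IsLeviCivita cov)
    (hγ : ContMDiffOn 𝓘(ℝ, ℝ) (𝓡 d) ∞ γ J) (hab : a < b) (hJab : Icc a b ⊆ J)
    (hR : ∀ t ∈ J, TensionIsJacobiEigenvector cov κ γ t) :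
    HasDerivAt (fun s ↦ sesquiEnergy cov δ₁ δ₂ (F s) a b)
      (2 * ∫ t in a..b, ⟪varField d F γ t, eulerLagrange cov δ₁ δ₂ κ γ t⟫) 0 := by
  have hV := hF.smoothAlong_varField hJ hγ
  have hT := smoothAlong_velocity hJ hγ
  have hτ := smoothAlong_tension hJ hγ hcov
  have hDV := smoothAlong_covAlong hJ hcov.smooth hV
  have hDDV := smoothAlong_covAlong hJ hcov.smooth hDV
  have hDτ := smoothAlong_covAlong hJ hcov.smooth hτ
  have hDDτ := smoothAlong_covAlong hJ hcov.smooth hDτ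
  have hEL := smoothAlong_eulerLagrange hJ hγ hcov δ₁ δ₂ κ
  set V := varField d F γ with hVdef
  have key := ((hasDerivAt_integral_of_smooth hF.pos hJ (hF.contDiffOn_norm_velocity_sq hJ hcov)
    hab.le hJab).const_mul δ₁).add ((hasDerivAt_integral_of_smooth hF.pos hJ
    (hF.contDiffOn_norm_tension_sq hJ hcov) hab.le hJab).const_mul δ₂)
  refine key.congr_deriv ?_
  have hcont {A B : ∀ t, TangentSpace (𝓡 d) (γ t)} (hA : SmoothAlong γ A J)
      (hB : SmoothAlong γ B J) : ContinuousOn (fun t ↦ ⟪A t, B t⟫) (uIcc a b) := by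
    rw [uIcc_of_le hab.le]
    exact (continuousOn_inner_along hJ hA hB).mono hJab
  -- The boundary terms of all integrations by parts: one for the energy, two for the bienergy. Half
  -- of the integrand of the first variation is `B'` plus the pairing of V with the Euler-Lagrange
  -- field.
  let B : ℝ → ℝ := fun t ↦ δ₁ * ⟪V t, velocity γ t⟫
    + δ₂ * (⟪covAlong cov γ V t, tension cov γ t⟫ - ⟪V t, covAlong cov γ (tension cov γ) t⟫)
  let B' : ℝ → ℝ := fun t ↦ δ₁ * (⟪covAlong cov γ V t, velocity γ t⟫ + ⟪V t, tension cov γ t⟫)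
    + δ₂ * (⟪covAlong cov γ (covAlong cov γ V) t, tension cov γ t⟫
      - ⟪V t, covAlong cov γ (covAlong cov γ (tension cov γ)) t⟫)
  have hB : ∀ t ∈ uIcc a b, HasDerivAt B (B' t) t := by
    intro t ht
    rw [uIcc_of_le hab.le] at ht
    have htJ := hJab ht
    have h1 := hasDerivAt_inner hcov (hV.at hJ htJ) (hT.at hJ htJ)
    have h2 := hasDerivAt_inner hcov (hDV.at hJ htJ) (hτ.at hJ htJ)
    have h3 := hasDerivAt_inner hcov (hV.at hJ htJ) (hDτ.at hJ htJ)
    refine ((h1.const_mul δ₁).add ((h2.sub h3).const_mul δ₂)).congr_deriv ?_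
    simp only [B', tension]
    ring
  have hB'c : ContinuousOn B' (uIcc a b) :=
    (((hcont hDV hT).add (hcont hV hτ)).const_smul δ₁).add
      (((hcont hDDV hτ).sub (hcont hV hDDτ)).const_smul δ₂)
  have hint : ∫ t in a..b, B' t = B b - B a :=
    intervalIntegral.integral_eq_sub_of_hasDerivAt hB hB'c.intervalIntegrable
  obtain ⟨K, hKc, hKab, hK⟩ := hF.support
  have hend : ∀ t ∈ J, t ∉ K → B t = 0 := by
    intro t ht htK
    -- The complement of the compact set K is open, so V vanishes near t and ∇_T V vanishes at t
    -- too; `B` involves both.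
    have hev : ∀ᶠ u in 𝓝 t, V u = 0 := by
      filter_upwards [hJ.mem_nhds ht, hKc.isClosed.isOpen_compl.mem_nhds htK] with u hu hu'
      exact hF.varField_eq_zero hK ⟨hu, hu'⟩
    have h1 : covAlong cov γ V t = 0 := by
      rw [covAlong_congr cov (W := fun s ↦ (0 : TangentSpace (𝓡 d) (γ s))) hev, covAlong_zero]
    simp only [B, h1, hev.self_of_nhds, inner_zero_left]
    ring
  have hBa := hend a (hJab (left_mem_Icc.2 hab.le)) fun h ↦ lt_irrefl _ (hKab h).1
  have hBb := hend b (hJab (right_mem_Icc.2 hab.le)) fun h ↦ lt_irrefl _ (hKab h).2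
  rw [hBa, hBb, sub_zero] at hint
  have e1 : ∫ t in a..b, deriv (fun s ↦ ‖velocity (d := d) (F s) t‖ ^ 2) 0 =
      ∫ t in a..b, 2 * ⟪covAlong cov γ V t, velocity γ t⟫ := by
    refine intervalIntegral.integral_congr fun t ht ↦ ?_
    rw [uIcc_of_le hab.le] at ht
    exact hF.deriv_norm_velocity_sq hJ hcov hγ (hJab ht)
  have e2 : ∫ t in a..b, deriv (fun s ↦ ‖tension cov (F s) t‖ ^ 2) 0 =
      ∫ t in a..b, 2 * (⟪covAlong cov γ (covAlong cov γ V) t, tension cov γ t⟫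
        + κ * ⟪V t, tension cov γ t⟫) := by
    refine intervalIntegral.integral_congr fun t ht ↦ ?_
    rw [uIcc_of_le hab.le] at ht
    refine (hF.deriv_norm_tension_sq hJ hcov hγ (hJab ht)).trans ?_
    rw [hR t (hJab ht), coordMetric_fieldCoord (mem_dom_self _)]
  rw [e1, e2, ← intervalIntegral.integral_const_mul, ← intervalIntegral.integral_const_mul,
    ← intervalIntegral.integral_const_mul, ← intervalIntegral.integral_add]
  · have e3 : ∫ t in a..b, (2 * B' t + 2 * ⟪V t, eulerLagrange cov δ₁ δ₂ κ γ t⟫) =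
        ∫ t in a..b, 2 * ⟪V t, eulerLagrange cov δ₁ δ₂ κ γ t⟫ := by
      rw [intervalIntegral.integral_add (hB'c.intervalIntegrable.const_mul 2)
        ((hcont hV hEL).intervalIntegrable.const_mul 2), intervalIntegral.integral_const_mul,
        hint]
      ring
    rw [← e3]
    refine intervalIntegral.integral_congr fun t _ ↦ ?_
    simp only [B', eulerLagrange, inner_add_right, real_inner_smul_right]
    ring
  · exact ((hcont hDV hT).intervalIntegrable.const_mul 2).const_mul δ₁
  · exact (((hcont hDDV hτ).intervalIntegrable.add
      ((hcont hV hτ).intervalIntegrable.const_mul κ)).const_mul 2).const_mul δ₂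

end EulerLagrange

/-! ### The fundamental lemma of the calculus of variations -/

section Critical

variable {d : ℕ} {M : Type*} [TopologicalSpace M] [ChartedSpace (EuclideanSpace ℝ (Fin d)) M]
  [IsManifold (𝓡 d) ∞ M]

open scoped Classical in
/-- The variation which moves `γ` in the chart at `x₀` in the direction `f v` over the interval
of radius `δ` around `t₀`. -/
def chartVariation (x₀ : M) (γ : ℝ → M) (t₀ δ : ℝ) (f : ℝ → ℝ) (v : EuclideanSpace ℝ (Fin d))
    (s t : ℝ) : M :=
  if t ∈ Ioo (t₀ - δ) (t₀ + δ) then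
    (extChartAt (𝓡 d) x₀).symm (curveCoord d x₀ γ t + (s * f t) • v) else γ t

section ChartVariation

variable {x₀ : M} {γ : ℝ → M} {J : Set ℝ} {t₀ δ ρ : ℝ} {v : EuclideanSpace ℝ (Fin d)}

/-- Serves both for the initial curve, s = 0, and for parameters outside the support of the bump
function. -/
lemma chartVariation_eq {f : ℝ → ℝ} (hdom : ∀ t ∈ Ioo (t₀ - δ) (t₀ + δ), γ t ∈ dom d x₀) {s t : ℝ}
    (h : s * f t = 0) : chartVariation x₀ γ t₀ δ f v s t = γ t := by
  rw [chartVariation]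
  split_ifs with ht
  · rw [h, zero_smul, add_zero, symm_curveCoord (hdom t ht)]
  · rfl

/-- For |s| < ρ / (‖v‖ + 1) the displacement s f(t) v is shorter than ρ, so the curve stays in the
chart; the summand 1 admits v = 0. At the ends of the interval smoothness holds because the bump
function already vanishes nearby, so that the variation is γ there. -/
lemma isVariation_chartVariation (hJ : IsOpen J) (hγ : ContMDiffOn 𝓘(ℝ, ℝ) (𝓡 d) ∞ γ J)
    (hρ : 0 < ρ)
    (hdom : ∀ t ∈ Ioo (t₀ - δ) (t₀ + δ), γ t ∈ dom d x₀)
    (hball : ∀ t ∈ Ioo (t₀ - δ) (t₀ + δ), Metric.ball (curveCoord d x₀ γ t) ρ ⊆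
      (extChartAt (𝓡 d) x₀).target)
    (f : ContDiffBump t₀) (hf : f.rOut < δ) :
    IsVariation (d := d) (chartVariation x₀ γ t₀ δ f v) (ρ / (‖v‖ + 1)) γ J (t₀ - δ) (t₀ + δ) where
  pos := by positivity
  initial t _ := chartVariation_eq hdom (zero_mul _)
  support := by
    refine ⟨Metric.closedBall t₀ f.rOut, isCompact_closedBall _ _, ?_, ?_⟩
    · rw [Real.closedBall_eq_Icc]
      intro t ht
      exact ⟨by linarith [ht.1], by linarith [ht.2]⟩
    · rintro s - t ⟨-, ht⟩
      refine chartVariation_eq hdom ?_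
      rw [f.zero_of_le_dist (not_le.1 ht).le, mul_zero]
  smooth := by
    rintro ⟨s, t⟩ ⟨hs, ht⟩
    refine ContMDiffAt.contMDiffWithinAt ?_
    have hγt := hγ.contMDiffAt (hJ.mem_nhds ht)
    by_cases hm : t ∈ Ioo (t₀ - δ) (t₀ + δ)
    · have hmem : curveCoord d x₀ γ t + (s * f t) • v ∈ (extChartAt (𝓡 d) x₀).target := by
        refine hball t hm ?_
        rw [Metric.mem_ball, dist_eq_norm, add_sub_cancel_left, norm_smul, norm_mul,
          Real.norm_eq_abs, Real.norm_eq_abs, abs_of_nonneg f.nonneg]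
        have hs' : |s| < ρ / (‖v‖ + 1) := abs_lt.2 hs
        have h1 : |s| * f t ≤ |s| := mul_le_of_le_one_right (abs_nonneg _) f.le_one
        have h2 : |s| * (‖v‖ + 1) < ρ := (lt_div_iff₀ (by positivity)).1 hs'
        nlinarith [norm_nonneg v, abs_nonneg s]
      have h1 : ContDiffAt ℝ ∞ (fun q : ℝ × ℝ ↦ curveCoord d x₀ γ q.2 + (q.1 * f q.2) • v)
          (s, t) := by
        have h2 : ContDiffAt ℝ ∞ (fun q : ℝ × ℝ ↦ curveCoord d x₀ γ q.2) (s, t) :=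
          (contDiffAt_curveCoord hγt (hdom t hm)).comp (s, t) contDiffAt_snd
        have h3 : ContDiffAt ℝ ∞ (fun q : ℝ × ℝ ↦ f q.2) (s, t) :=
          ((f.contDiff : ContDiff ℝ ∞ f).comp contDiff_snd).contDiffAt
        exact h2.add ((contDiffAt_fst.mul h3).smul contDiffAt_const)
      have h4 := (contMDiffAt_symm hmem).comp (s, t) h1.contMDiffAt
      refine h4.congr_of_eventuallyEq ?_
      have h5 : ∀ᶠ q : ℝ × ℝ in 𝓝 (s, t), q.2 ∈ Ioo (t₀ - δ) (t₀ + δ) :=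
        continuousAt_snd.preimage_mem_nhds (isOpen_Ioo.mem_nhds hm)
      filter_upwards [h5] with q hq
      simp only [Function.uncurry, chartVariation, if_pos hq]
      rfl
    · have h1 : ContMDiffAt 𝓘(ℝ, ℝ × ℝ) (𝓡 d) ∞ (fun q : ℝ × ℝ ↦ γ q.2) (s, t) :=
        ContMDiffAt.comp (s, t) (g := γ) (f := fun q : ℝ × ℝ ↦ q.2) hγt
          contDiffAt_snd.contMDiffAt
      refine h1.congr_of_eventuallyEq ?_
      have h2 : ∀ᶠ q : ℝ × ℝ in 𝓝 (s, t), q.2 ∉ Metric.closedBall t₀ f.rOut := by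
        refine continuousAt_snd.preimage_mem_nhds
          (Metric.isClosed_closedBall.isOpen_compl.mem_nhds fun h3 ↦ hm ?_)
        rw [Real.closedBall_eq_Icc] at h3
        exact ⟨by linarith [h3.1], by linarith [h3.2]⟩
      filter_upwards [h2] with q hq
      refine chartVariation_eq hdom ?_
      rw [f.zero_of_le_dist (not_le.1 hq).le, mul_zero]

lemma varField_chartVariation (hJ : IsOpen J) (hγ : ContMDiffOn 𝓘(ℝ, ℝ) (𝓡 d) ∞ γ J)
    (hρ : 0 < ρ) (hδJ : Ioo (t₀ - δ) (t₀ + δ) ⊆ J)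
    (hdom : ∀ t ∈ Ioo (t₀ - δ) (t₀ + δ), γ t ∈ dom d x₀)
    (hball : ∀ t ∈ Ioo (t₀ - δ) (t₀ + δ), Metric.ball (curveCoord d x₀ γ t) ρ ⊆
      (extChartAt (𝓡 d) x₀).target)
    (f : ContDiffBump t₀) (hf : f.rOut < δ) {t : ℝ} (ht : t ∈ Ioo (t₀ - δ) (t₀ + δ)) :
    varField d (chartVariation x₀ γ t₀ δ f v) γ t = f t • ofCoord x₀ (γ t) v := by
  have hF := isVariation_chartVariation (v := v) hJ hγ hρ hdom hball f hf
  have h1 := ofCoord_deriv_eq (σ := fun s ↦ chartVariation x₀ γ t₀ δ f v s t)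
    (hF.initial t (hδJ ht))
    ((hF.contMDiffAt_transversal hJ hF.zero_mem (hδJ ht)).mdifferentiableAt (by simp)) (hdom t ht)
  rw [varField, h1, ← map_smul]
  congr 1
  have hc : ContinuousAt (fun s : ℝ ↦ curveCoord d x₀ γ t + (s * f t) • v) 0 := by fun_prop
  have hmem : (extChartAt (𝓡 d) x₀).target ∈
      𝓝 (curveCoord d x₀ γ t + ((0 : ℝ) * f t) • v) := by
    rw [zero_mul, zero_smul, add_zero]
    exact target_mem_nhds (curveCoord_mem (hdom t ht))
  have he : (fun s ↦ extChartAt (𝓡 d) x₀ (chartVariation x₀ γ t₀ δ f v s t)) =ᶠ[𝓝 0]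
      fun s ↦ curveCoord d x₀ γ t + (s * f t) • v := by
    filter_upwards [hc.preimage_mem_nhds hmem] with s hs
    rw [chartVariation, if_pos ht, (extChartAt (𝓡 d) x₀).right_inv hs]
  rw [he.deriv_eq]
  have h2 : HasDerivAt (fun s : ℝ ↦ curveCoord d x₀ γ t + (s * f t) • v) ((1 * f t) • v) 0 :=
    (((hasDerivAt_id (0 : ℝ)).mul_const (f t)).smul_const v).const_add _
  rw [h2.deriv, one_mul]

end ChartVariation

variable [RiemannianBundle (fun x : M ↦ TangentSpace (𝓡 d) x)]
  [IsContMDiffRiemannianBundle (𝓡 d) ∞ (EuclideanSpace ℝ (Fin d))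
      (fun x : M ↦ TangentSpace (𝓡 d) x)] [T2Space M]
  {cov : CovariantDerivative (𝓡 d) (EuclideanSpace ℝ (Fin d))
      (fun x : M ↦ TangentSpace (𝓡 d) x)} {δ₁ δ₂ κ : ℝ} {γ : ℝ → M} {J : Set ℝ}

/-- If the field were nonzero at t₀, vary γ in the direction f · P, with P the chart-constant
extension of its value at t₀ and f a narrow bump. The first variation would be the integral of a
nonnegative function that is positive at t₀. -/
lemma eulerLagrange_eq_zero_of_isSesquiHarmonic (hJ : IsOpen J) (hcov : IsLeviCivita cov)
    (hγ : ContMDiffOn 𝓘(ℝ, ℝ) (𝓡 d) ∞ γ J)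
    (hR : ∀ t ∈ J, TensionIsJacobiEigenvector cov κ γ t)
    (h : IsSesquiHarmonic cov δ₁ δ₂ γ J) {t₀ : ℝ} (ht₀ : t₀ ∈ J) :
    eulerLagrange cov δ₁ δ₂ κ γ t₀ = 0 := by
  by_contra hne
  have hd := mem_dom_self (d := d) (γ t₀)
  have hγt := hγ.contMDiffAt (hJ.mem_nhds ht₀)
  have hEL := smoothAlong_eulerLagrange hJ hγ hcov δ₁ δ₂ κ
  set x₀ := γ t₀ with hx₀
  set v := fieldCoord x₀ γ (eulerLagrange cov δ₁ δ₂ κ γ) t₀ with hv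
  let P : ∀ t, TangentSpace (𝓡 d) (γ t) := fun t ↦ ofCoord x₀ (γ t) v
  have hP : ∀ t ∈ J, γ t ∈ dom d x₀ → SmoothAlongAt γ P t := by
    intro t ht htd
    refine (smoothAlongAt_iff (hγ.contMDiffAt (hJ.mem_nhds ht)) htd).2
      ((contDiffAt_const (c := v)).congr_of_eventuallyEq ?_)
    filter_upwards [eventually_mem_dom (hγ.contMDiffAt (hJ.mem_nhds ht)).continuousAt htd] with u hu
    exact toCoord_ofCoord hu v
  let H : ℝ → ℝ := fun t ↦ ⟪P t, eulerLagrange cov δ₁ δ₂ κ γ t⟫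
  have hH : ∀ t ∈ J, γ t ∈ dom d x₀ → ContinuousAt H t := fun t ht htd ↦
    (contDiffAt_inner (hP t ht htd) (hEL.at hJ ht)).continuousAt
  have hH0 : 0 < H t₀ := by
    have h1 : P t₀ = eulerLagrange cov δ₁ δ₂ κ γ t₀ := ofCoord_fieldCoord hd
    simp only [H]
    rw [h1]
    exact real_inner_self_pos.2 hne
  obtain ⟨ρ, hρ, hρt⟩ := Metric.isOpen_iff.1 (isOpen_extChartAt_target (I := 𝓡 d) x₀) _
    (curveCoord_mem (γ := γ) hd)
  have hcc := (contDiffAt_curveCoord hγt hd).continuousAt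
  have hJn : ∀ᶠ t in 𝓝 t₀, t ∈ J := hJ.mem_nhds ht₀
  obtain ⟨r, hr, hrt⟩ := Metric.eventually_nhds_iff.1 (hJn.and
    ((eventually_mem_dom hγt.continuousAt hd).and (((hH t₀ ht₀ hd).eventually (lt_mem_nhds hH0)).and
      (hcc.preimage_mem_nhds (Metric.ball_mem_nhds _ (half_pos hρ))))))
  set δ := r / 2 with hδ
  have hδ0 : 0 < δ := by positivity
  have hI : ∀ t ∈ Icc (t₀ - δ) (t₀ + δ), dist t t₀ < r := by
    intro t ht
    rw [Real.dist_eq, abs_lt]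
    constructor <;> linarith [ht.1, ht.2]
  have hIJ : Icc (t₀ - δ) (t₀ + δ) ⊆ J := fun t ht ↦ (hrt (hI t ht)).1
  have hdom : ∀ t ∈ Icc (t₀ - δ) (t₀ + δ), γ t ∈ dom d x₀ := fun t ht ↦ (hrt (hI t ht)).2.1
  have hball : ∀ t ∈ Icc (t₀ - δ) (t₀ + δ), Metric.ball (curveCoord d x₀ γ t) (ρ / 2) ⊆
      (extChartAt (𝓡 d) x₀).target := by
    intro t ht
    refine Subset.trans (Metric.ball_subset_ball' ?_) hρt
    have h1 : dist (curveCoord d x₀ γ t) (curveCoord d x₀ γ t₀) < ρ / 2 := (hrt (hI t ht)).2.2.2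
    linarith
  let f : ContDiffBump t₀ := ⟨δ / 4, δ / 2, by positivity, by linarith⟩
  have hf : f.rOut < δ := half_lt_self hδ0
  have hsub := Ioo_subset_Icc_self (a := t₀ - δ) (b := t₀ + δ)
  have hF := isVariation_chartVariation (v := v) hJ hγ (half_pos hρ)
    (fun t ht ↦ hdom t (hsub ht)) (fun t ht ↦ hball t (hsub ht)) f hf
  have hab : t₀ - δ < t₀ + δ := by linarith
  have h1 := hF.hasDerivAt_sesquiEnergy (δ₁ := δ₁) (δ₂ := δ₂) hJ hcov hγ hab hIJ hR
  have h2 := h _ _ hab hIJ _ _ hF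
  have h3 := h1.unique h2
  have h4 : ∫ t in (t₀ - δ)..(t₀ + δ), ⟪varField d (chartVariation x₀ γ t₀ δ f v) γ t,
      eulerLagrange cov δ₁ δ₂ κ γ t⟫ = ∫ t in (t₀ - δ)..(t₀ + δ), f t * H t := by
    -- The variation field is known on the open interval only, so the right endpoint is dropped as a
    -- null set.
    rw [intervalIntegral.integral_of_le hab.le, intervalIntegral.integral_of_le hab.le,
      integral_Ioc_eq_integral_Ioo, integral_Ioc_eq_integral_Ioo]
    refine setIntegral_congr_fun measurableSet_Ioo fun t ht ↦ ?_
    have := varField_chartVariation (v := v) hJ hγ (half_pos hρ) (hsub.trans hIJ)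
      (fun t ht ↦ hdom t (hsub ht)) (fun t ht ↦ hball t (hsub ht)) f hf ht
    simp only [this, real_inner_smul_left, H, P]
  have h5 : 0 < ∫ t in (t₀ - δ)..(t₀ + δ), f t * H t := by
    refine intervalIntegral.integral_pos hab ?_ ?_ ⟨t₀, ⟨by linarith, by linarith⟩, ?_⟩
    · exact f.continuous.continuousOn.mul fun t ht ↦
        (hH t (hIJ ht) (hdom t ht)).continuousWithinAt
    · intro t ht
      exact mul_nonneg f.nonneg (hrt (hI t (Ioc_subset_Icc_self ht))).2.2.1.le
    · rw [f.one_of_mem_closedBall (Metric.mem_closedBall_self f.rIn_pos.le), one_mul]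
      exact hH0
  rw [h4] at h3
  linarith

/-- A curve whose tension field satisfies `R(τ, T) T = κ τ` is interpolating sesqui-harmonic if
and only if `δ₂ (∇_T² τ + κ τ) = δ₁ τ`. -/
theorem isSesquiHarmonic_iff (hJ : IsOpen J) (hcov : IsLeviCivita cov)
    (hγ : ContMDiffOn 𝓘(ℝ, ℝ) (𝓡 d) ∞ γ J)
    (hR : ∀ t ∈ J, TensionIsJacobiEigenvector cov κ γ t) :
    IsSesquiHarmonic cov δ₁ δ₂ γ J ↔ ∀ t ∈ J, eulerLagrange cov δ₁ δ₂ κ γ t = 0 := by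
  refine ⟨fun h t ht ↦ eulerLagrange_eq_zero_of_isSesquiHarmonic hJ hcov hγ hR h ht, ?_⟩
  intro h a b hab hJab F ε hF
  refine (hF.hasDerivAt_sesquiEnergy hJ hcov hγ hab hJab hR).congr_deriv ?_
  have h0 : ∫ t in a..b, ⟪varField d F γ t, eulerLagrange cov δ₁ δ₂ κ γ t⟫ = ∫ t in a..b, (0 : ℝ) := by
    refine intervalIntegral.integral_congr fun t ht ↦ ?_
    rw [uIcc_of_le hab.le] at ht
    simp only [h t (hJab ht), inner_zero_right]
  rw [h0]
  simp

end Critical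

/-! ### The Euler-Lagrange equation in the Frenet frame -/

section Frenet

variable {d : ℕ} {M : Type*} [TopologicalSpace M] [ChartedSpace (EuclideanSpace ℝ (Fin d)) M]
  [IsManifold (𝓡 d) ∞ M] [RiemannianBundle (fun x : M ↦ TangentSpace (𝓡 d) x)]

namespace AlmostContactMetric

variable (S : AlmostContactMetric d M) (x : M)

lemma φ_ξ : S.φ x (S.ξ x) = 0 := by
  have h1 : S.φ x (S.φ x (S.ξ x)) = 0 := by rw [S.φ_φ, S.η_ξ]; simp
  have h2 := S.inner_φ_φ x (S.φ x (S.ξ x)) (S.φ x (S.ξ x))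
  have h3 := S.inner_φ_φ x (S.ξ x) (S.ξ x)
  have h4 := S.φ_φ x (S.φ x (S.ξ x))
  rw [h1, map_zero, eq_comm, neg_add_eq_zero] at h4
  obtain ⟨a, ha⟩ : ∃ a : ℝ, S.φ x (S.ξ x) = a • S.ξ x := ⟨_, h4⟩
  rw [ha, map_smul, ha, smul_smul] at h1
  have h5 := congrArg (S.η x) h1
  rw [map_smul, S.η_ξ, map_zero, smul_eq_mul, mul_one, mul_self_eq_zero] at h5
  rw [ha, h5, zero_smul]

lemma inner_ξ (v : TangentSpace (𝓡 d) x) : ⟪v, S.ξ x⟫ = S.η x v := by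
  have h1 := S.inner_φ_φ x v (S.ξ x)
  rw [S.φ_ξ, inner_zero_right, S.η_ξ] at h1
  linarith

lemma η_φ (v : TangentSpace (𝓡 d) x) : S.η x (S.φ x v) = 0 := by
  have h1 := S.φ_φ x (S.φ x v)
  rw [S.φ_φ x v, map_add, map_neg, map_smul, S.φ_ξ, smul_zero, add_zero, left_eq_add] at h1
  have h2 := congrArg (S.η x) h1
  rwa [map_smul, S.η_ξ, map_zero, smul_eq_mul, mul_one] at h2

lemma inner_φ_left (v w : TangentSpace (𝓡 d) x) : ⟪S.φ x v, w⟫ = -⟪v, S.φ x w⟫ := by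
  have h1 := S.inner_φ_φ x (S.φ x v) w
  rw [S.η_φ, S.φ_φ, inner_add_left, inner_neg_left, real_inner_smul_left, real_inner_comm _ (S.ξ x),
    S.inner_ξ, S.η_φ] at h1
  linarith

lemma inner_φ_self (v : TangentSpace (𝓡 d) x) : ⟪v, S.φ x v⟫ = 0 := by
  have h1 := S.inner_φ_left x v v
  rw [real_inner_comm] at h1
  linarith

end AlmostContactMetric

variable {γ : ℝ → M} {J : Set ℝ}

lemma smoothAlong_zero (hJ : IsOpen J) (hγ : ContMDiffOn 𝓘(ℝ, ℝ) (𝓡 d) ∞ γ J) :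
    SmoothAlong γ (fun t ↦ (0 : TangentSpace (𝓡 d) (γ t))) J := by
  intro t ht
  refine ContMDiffAt.contMDiffWithinAt ((smoothAlongAt_iff (hγ.contMDiffAt (hJ.mem_nhds ht))
    (mem_dom_self _)).2 ((contDiffAt_const (c := 0)).congr_of_eventuallyEq
    (Filter.Eventually.of_forall fun s ↦ map_zero _)))

lemma deriv_eq_zero_of_eqOn_const {f : ℝ → ℝ} {f' a t : ℝ} (hJ : IsOpen J) (ht : t ∈ J)
    (hf : ∀ s ∈ J, f s = a) (h : HasDerivAt f f' t) : f' = 0 := by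
  refine h.unique ((hasDerivAt_const t a).congr_of_eventuallyEq ?_)
  filter_upwards [hJ.mem_nhds ht] with s hs
  exact hf s hs

/-- The Frenet frame, extended by zero. -/
def extFrame (r : ℕ) (E : ℕ → ∀ t, TangentSpace (𝓡 d) (γ t)) (i : ℕ) (t : ℝ) :
    TangentSpace (𝓡 d) (γ t) :=
  if 1 ≤ i ∧ i ≤ r then E i t else 0

/-- The Frenet curvatures, extended by zero. -/
def extCurv (r : ℕ) (k : ℕ → ℝ → ℝ) (i : ℕ) (t : ℝ) : ℝ := if 1 ≤ i ∧ i < r then k i t else 0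

variable [IsContMDiffRiemannianBundle (𝓡 d) ∞ (EuclideanSpace ℝ (Fin d))
      (fun x : M ↦ TangentSpace (𝓡 d) x)] [T2Space M]
  {cov : CovariantDerivative (𝓡 d) (EuclideanSpace ℝ (Fin d))
      (fun x : M ↦ TangentSpace (𝓡 d) x)} {S : AlmostContactMetric d M} {c : ℝ}

/-- In a Sasakian space form, a horizontal tension field which is orthogonal to `φ T` is an
eigenvector of the Jacobi operator. -/
lemma AlmostContactMetric.IsSasakianSpaceForm.tensionIsJacobiEigenvector
    (hM : S.IsSasakianSpaceForm cov c) (hcov : IsLeviCivita cov) {t : ℝ}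
    (hT : ⟪velocity (d := d) γ t, velocity γ t⟫ = 1) (hηT : S.η (γ t) (velocity γ t) = 0)
    (hTτ : ⟪velocity γ t, tension cov γ t⟫ = 0) (hητ : S.η (γ t) (tension cov γ t) = 0)
    (hφ : ⟪tension cov γ t, S.φT γ t⟫ = 0) :
    TensionIsJacobiEigenvector cov ((c + 3) / 4) γ t := by
  intro v
  have hd := mem_dom_self (d := d) (γ t)
  have hl := S.isLocalSasakian_coord hcov hM.sasakian (γ t)
  have hy := curveCoord_mem (γ := γ) hd
  rw [hl.curvature_eq_of_phiSectional hy
    (fun u hu hu' ↦ S.coord_phiSectional hcov hM.curvature_eq hy u hu hu')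
    (by rw [S.coordη_fieldCoord hd, hηT]) (by rw [S.coordη_fieldCoord hd, hητ])
    (by rw [← S.fieldCoord_φ hd, coordMetric_fieldCoord hd]; exact hφ) v,
    coordMetric_fieldCoord hd, coordMetric_fieldCoord hd, hT, hTτ]
  ring

/-- `∇_T² τ` in terms of the Frenet frame. -/
lemma covAlong_covAlong_tension_of_frenet {e : ℕ → ∀ t, TangentSpace (𝓡 d) (γ t)}
    {K : ℕ → ℝ → ℝ} (hJ : IsOpen J) (he : ∀ i, SmoothAlong γ (e i) J)
    (hK : ∀ i, ContDiffOn ℝ ∞ (K i) J)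
    (h0 : ∀ t ∈ J, tension cov γ t = K 1 t • e 2 t)
    (h1 : ∀ t ∈ J, covAlong cov γ (e 1) t = K 1 t • e 2 t)
    (h2 : ∀ t ∈ J, covAlong cov γ (e 2) t = -(K 1 t • e 1 t) + K 2 t • e 3 t)
    (h3 : ∀ t ∈ J, covAlong cov γ (e 3) t = -(K 2 t • e 2 t) + K 3 t • e 4 t) {t : ℝ}
    (ht : t ∈ J) :
    covAlong cov γ (covAlong cov γ (tension cov γ)) t =
      (-3 * K 1 t * deriv (K 1) t) • e 1 t
      + (deriv (deriv (K 1)) t - K 1 t ^ 3 - K 1 t * K 2 t ^ 2) • e 2 t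
      + (2 * deriv (K 1) t * K 2 t + K 1 t * deriv (K 2) t) • e 3 t
      + (K 1 t * K 2 t * K 3 t) • e 4 t := by
  have hn {s : ℝ} (hs : s ∈ J) : J ∈ 𝓝 s := hJ.mem_nhds hs
  have sK (i : ℕ) {s : ℝ} (hs : s ∈ J) : ContDiffAt ℝ ∞ (K i) s := (hK i).contDiffAt (hn hs)
  have dK (i : ℕ) : HasDerivAt (K i) (deriv (K i) t) t :=
    ((sK i ht).differentiableAt (by simp)).hasDerivAt
  have hD : ∀ s ∈ J, covAlong cov γ (tension cov γ) s =
      deriv (K 1) s • e 2 s + ((-(K 1 s * K 1 s)) • e 1 s + (K 1 s * K 2 s) • e 3 s) := by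
    intro s hs
    rw [covAlong_congr cov (W := fun s ↦ K 1 s • e 2 s) (by filter_upwards [hn hs] with u hu
                                                            exact h0 u hu),
      covAlong_smul cov (sK 1 hs) ((he 2).at hJ hs), h2 s hs]
    module
  have s1 := (sK 1 ht).deriv_infty
  have s2 : ContDiffAt ℝ ∞ (fun s ↦ -(K 1 s * K 1 s)) t := ((sK 1 ht).mul (sK 1 ht)).neg
  have s3 : ContDiffAt ℝ ∞ (fun s ↦ K 1 s * K 2 s) t := (sK 1 ht).mul (sK 2 ht)
  have d2 : deriv (fun s ↦ -(K 1 s * K 1 s)) t =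
      -(deriv (K 1) t * K 1 t + K 1 t * deriv (K 1) t) := ((dK 1).mul (dK 1)).neg.deriv
  have d3 : deriv (fun s ↦ K 1 s * K 2 s) t =
      deriv (K 1) t * K 2 t + K 1 t * deriv (K 2) t := ((dK 1).mul (dK 2)).deriv
  have E (i : ℕ) := (he i).at hJ ht
  rw [covAlong_congr cov (W := fun s ↦ deriv (K 1) s • e 2 s +
      ((-(K 1 s * K 1 s)) • e 1 s + (K 1 s * K 2 s) • e 3 s)) (by filter_upwards [hn ht] with u hu
                                                                  exact hD u hu),
    covAlong_add cov ((E 2).smul s1) (((E 1).smul s2).add ((E 3).smul s3)),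
    covAlong_add cov ((E 1).smul s2) ((E 3).smul s3), covAlong_smul cov s1 (E 2),
    covAlong_smul cov s2 (E 1), covAlong_smul cov s3 (E 3), d2, d3, h1 t ht, h2 t ht, h3 t ht]
  module

namespace IsFrenetCurve

variable {r : ℕ} {E : ℕ → ∀ t, TangentSpace (𝓡 d) (γ t)} {k : ℕ → ℝ → ℝ}
  (hγ : IsFrenetCurve cov γ J r E k) (hJ : IsOpen J)
include hγ hJ

lemma smoothAt {i : ℕ} (h1 : 1 ≤ i) (hr : i ≤ r) {t : ℝ} (ht : t ∈ J) :
    SmoothAlongAt γ (E i) t := (hγ.smooth_frame i h1 hr).at hJ ht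

lemma tension_eq {t : ℝ} (ht : t ∈ J) :
    tension cov γ t = if 1 < r then k 1 t • E 2 t else 0 := by
  have h1 : tension cov γ t = covAlong cov γ (E 1) t := by
    refine covAlong_congr cov ?_
    filter_upwards [hJ.mem_nhds ht] with s hs
    exact (hγ.frame_one s hs).symm
  rw [h1, hγ.frenet t ht 1 le_rfl hγ.one_le]
  simp

omit hJ in
lemma inner_self_eq {i : ℕ} (h1 : 1 ≤ i) (hr : i ≤ r) {t : ℝ} (ht : t ∈ J) :
    ⟪E i t, E i t⟫ = 1 := by
  rw [hγ.orthonormal t ht i i h1 hr h1 hr, if_pos rfl]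

/-- A Frenet curve is a geodesic if and only if its osculating order is `1`. -/
lemma isGeodesicOn_iff (hJn : J.Nonempty) : IsGeodesicOn cov γ J ↔ r = 1 := by
  constructor
  · intro h
    by_contra hr
    have hr : 1 < r := lt_of_le_of_ne hγ.one_le (Ne.symm hr)
    obtain ⟨t, ht⟩ := hJn
    have h1 := h t ht
    rw [hγ.tension_eq hJ ht, if_pos hr, smul_eq_zero] at h1
    rcases h1 with h1 | h1
    · exact (hγ.curvature_pos t ht 1 le_rfl hr).ne' h1
    · have h2 := hγ.inner_self_eq (i := 2) (by norm_num) hr ht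
      rw [h1, inner_zero_left] at h2
      exact zero_ne_one h2
  · rintro rfl t ht
    rw [hγ.tension_eq hJ ht, if_neg (lt_irrefl _)]

omit hJ in
lemma inner_extFrame {i j : ℕ} (hi : 1 ≤ i) (hir : i ≤ r) {t : ℝ} (ht : t ∈ J) :
    ⟪E i t, extFrame r E j t⟫ = if i = j then (1 : ℝ) else 0 := by
  rw [extFrame]
  split_ifs with h1 h2 h2
  · rw [hγ.orthonormal t ht i j hi hir h1.1 h1.2, if_pos h2]
  · rw [hγ.orthonormal t ht i j hi hir h1.1 h1.2, if_neg h2]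
  · exact absurd ⟨h2 ▸ hi, h2 ▸ hir⟩ h1
  · exact inner_zero_right _

lemma smoothAlong_extFrame (i : ℕ) : SmoothAlong γ (extFrame r E i) J := by
  by_cases h : 1 ≤ i ∧ i ≤ r
  · have h1 : extFrame r E i = E i := by funext t; rw [extFrame, if_pos h]
    rw [h1]
    exact hγ.smooth_frame i h.1 h.2
  · have h1 : extFrame r E i = fun t ↦ (0 : TangentSpace (𝓡 d) (γ t)) := by
      funext t; rw [extFrame, if_neg h]
    rw [h1]
    exact smoothAlong_zero hJ hγ.smooth_curve

omit hJ in
lemma contDiffOn_extCurv (i : ℕ) : ContDiffOn ℝ ∞ (extCurv r k i) J := by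
  by_cases h : 1 ≤ i ∧ i < r
  · have h1 : extCurv r k i = k i := by funext t; rw [extCurv, if_pos h]
    rw [h1]
    exact hγ.smooth_curvature i h.1 h.2
  · have h1 : extCurv r k i = fun _ ↦ 0 := by funext t; rw [extCurv, if_neg h]
    rw [h1]
    exact contDiffOn_const

omit hJ in
-- After the extension by zero the Frenet equations have one uniform shape for all i ≥ 1, so ∇_T²τ
-- can be expanded in E₁, …, E₄ whatever r is. For i = 1 the backward term vanishes because
-- `extCurv` is zero at index 0.
lemma covAlong_extFrame {i : ℕ} (hi : 1 ≤ i) {t : ℝ} (ht : t ∈ J) :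
    covAlong cov γ (extFrame r E i) t =
      -(extCurv r k (i - 1) t • extFrame r E (i - 1) t) + extCurv r k i t • extFrame r E (i + 1) t := by
  by_cases h : i ≤ r
  · have h1 : extFrame r E i = E i := by funext t; rw [extFrame, if_pos ⟨hi, h⟩]
    rw [h1, hγ.frenet t ht i hi h]
    congr 1
    · split_ifs with h2
      · rw [extCurv, extFrame, if_pos ⟨by omega, by omega⟩, if_pos ⟨by omega, by omega⟩]
      · rw [extCurv, if_neg (by omega), zero_smul, neg_zero]
    · split_ifs with h2
      · rw [extCurv, extFrame, if_pos ⟨by omega, by omega⟩, if_pos ⟨by omega, by omega⟩]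
      · rw [extCurv, if_neg (by omega), zero_smul]
  · have h1 : extFrame r E i = fun t ↦ (0 : TangentSpace (𝓡 d) (γ t)) := by
      funext t; rw [extFrame, if_neg (by omega)]
    rw [h1, covAlong_zero, extCurv, if_neg (by omega), extCurv, if_neg (by omega)]
    simp

/-- The Euler-Lagrange field of a Frenet curve. -/
lemma eulerLagrange_eq (δ₁ δ₂ κ : ℝ) {t : ℝ} (ht : t ∈ J) :
    eulerLagrange cov δ₁ δ₂ κ γ t =
      (δ₂ * (-3 * extCurv r k 1 t * deriv (extCurv r k 1) t)) • extFrame r E 1 t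
      + (δ₂ * (deriv (deriv (extCurv r k 1)) t - extCurv r k 1 t ^ 3
          - extCurv r k 1 t * extCurv r k 2 t ^ 2) + (δ₂ * κ - δ₁) * extCurv r k 1 t)
          • extFrame r E 2 t
      + (δ₂ * (2 * deriv (extCurv r k 1) t * extCurv r k 2 t
          + extCurv r k 1 t * deriv (extCurv r k 2) t)) • extFrame r E 3 t
      + (δ₂ * (extCurv r k 1 t * extCurv r k 2 t * extCurv r k 3 t)) • extFrame r E 4 t := by
  have h1 : ∀ s ∈ J, covAlong cov γ (extFrame r E 1) s = extCurv r k 1 s • extFrame r E 2 s := by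
    intro s hs
    rw [hγ.covAlong_extFrame le_rfl hs, extCurv, if_neg (by omega), zero_smul, neg_zero, zero_add]
  have h0 : ∀ s ∈ J, tension cov γ s = extCurv r k 1 s • extFrame r E 2 s := by
    intro s hs
    rw [← h1 s hs]
    refine covAlong_congr cov ?_
    filter_upwards [hJ.mem_nhds hs] with u hu
    rw [extFrame, if_pos ⟨le_rfl, hγ.one_le⟩, hγ.frame_one u hu]
  rw [eulerLagrange, covAlong_covAlong_tension_of_frenet hJ (hγ.smoothAlong_extFrame hJ)
    hγ.contDiffOn_extCurv h0 h1 (fun s hs ↦ hγ.covAlong_extFrame (by norm_num) hs)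
    (fun s hs ↦ hγ.covAlong_extFrame (by norm_num) hs) ht, h0 t ht]
  module

/-- Compare components, using k₁ > 0. Along E₁: k₁k₁' = 0. Along E₃: 2k₁'k₂ + k₁k₂' = 0, hence k₂' =
0. Along E₄: k₁k₂k₃ = 0, impossible for r ≥ 4. Along E₂, once k₁'' = 0: the relation for k₁² + k₂².
Connectedness of J turns zero derivatives into constants. -/
lemma eulerLagrange_eq_zero_iff (hJc : J.OrdConnected) (hJn : J.Nonempty)
    (hr : 2 ≤ r) {δ₁ δ₂ κ : ℝ} (hδ : δ₂ ≠ 0) :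
    (∀ t ∈ J, eulerLagrange cov δ₁ δ₂ κ γ t = 0) ↔
      r ≤ 3 ∧ (∃ a, ∀ t ∈ J, extCurv r k 1 t = a) ∧ (∃ a, ∀ t ∈ J, extCurv r k 2 t = a) ∧
        ∀ t ∈ J, extCurv r k 1 t ^ 2 + extCurv r k 2 t ^ 2 = κ - δ₁ / δ₂ := by
  have hpos : ∀ i, 1 ≤ i → i < r → ∀ t ∈ J, 0 < extCurv r k i t := by
    intro i h1 h2 t ht
    rw [extCurv, if_pos ⟨h1, h2⟩]
    exact hγ.curvature_pos t ht i h1 h2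
  have hdiff (i : ℕ) : DifferentiableOn ℝ (extCurv r k i) J :=
    (hγ.contDiffOn_extCurv i).differentiableOn (by simp)
  have hderiv (i : ℕ) {t : ℝ} (ht : t ∈ J) :
      HasDerivAt (extCurv r k i) (deriv (extCurv r k i) t) t :=
    ((hdiff i).differentiableAt (hJ.mem_nhds ht)).hasDerivAt
  have hderiv2 (h1 : ∀ t ∈ J, deriv (extCurv r k 1) t = 0) {t : ℝ} (ht : t ∈ J) :
      deriv (deriv (extCurv r k 1)) t = 0 :=
    deriv_eq_zero_of_eqOn_const hJ ht h1 ((((hγ.contDiffOn_extCurv 1).contDiffAt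
      (hJ.mem_nhds ht)).deriv_infty.differentiableAt (by simp)).hasDerivAt)
  constructor
  · intro h
    have hin (t : ℝ) (ht : t ∈ J) (i : ℕ) (h1 : 1 ≤ i) (h2 : i ≤ r) := by
      have h3 := congrArg (fun w ↦ ⟪E i t, w⟫) ((hγ.eulerLagrange_eq hJ δ₁ δ₂ κ ht).symm.trans (h t ht))
      simp only [inner_add_right, real_inner_smul_right, hγ.inner_extFrame h1 h2 ht,
        inner_zero_right] at h3
      exact h3
    have hk1 : ∀ t ∈ J, deriv (extCurv r k 1) t = 0 := by
      intro t ht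
      have h1 := hin t ht 1 le_rfl (by omega)
      have h2 := (hpos 1 le_rfl (by omega) t ht).ne'
      simp at h1
      simpa [hδ, h2] using h1
    have hk2 : ∀ t ∈ J, deriv (extCurv r k 2) t = 0 := by
      intro t ht
      by_cases h3 : 2 < r
      · have h1 := hin t ht 3 (by norm_num) h3
        have h2 := (hpos 1 le_rfl (by omega) t ht).ne'
        simp [hk1 t ht] at h1
        simpa [hδ, h2] using h1
      -- For r = 2 there is no component along E₃, but then the extended k₂ is identically zero.
      · refine deriv_eq_zero_of_eqOn_const (a := 0) hJ ht (fun s _ ↦ ?_) (hderiv 2 ht)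
        rw [extCurv, if_neg (by omega)]
    have hconst (i : ℕ) (hi : ∀ t ∈ J, deriv (extCurv r k i) t = 0) :
        ∃ a, ∀ t ∈ J, extCurv r k i t = a :=
      hJ.exists_is_const_of_deriv_eq_zero hJc.isPreconnected (hdiff i) hi
    refine ⟨?_, hconst 1 hk1, hconst 2 hk2, ?_⟩
    · by_contra hr4
      obtain ⟨t, ht⟩ := hJn
      have h1 := hin t ht 4 (by norm_num) (by omega)
      have p1 := (hpos 1 le_rfl (by omega) t ht).ne'
      have p2 := (hpos 2 (by norm_num) (by omega) t ht).ne'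
      have p3 := (hpos 3 (by norm_num) (by omega) t ht).ne'
      simp [hδ, p1, p2, p3] at h1
    · intro t ht
      have h1 := hin t ht 2 (by norm_num) hr
      have p1 := (hpos 1 le_rfl (by omega) t ht).ne'
      simp [hderiv2 hk1 ht] at h1
      -- The E₂-component has the factor k₁, which is positive and can be cancelled.
      have h2 : extCurv r k 1 t * (δ₂ * (extCurv r k 1 t ^ 2 + extCurv r k 2 t ^ 2)
          - (δ₂ * κ - δ₁)) = 0 := by linear_combination -h1
      have h3 := (mul_eq_zero.1 h2).resolve_left p1
      field_simp
      linear_combination h3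
  · rintro ⟨hr3, ⟨a, ha⟩, ⟨b, hb⟩, h⟩ t ht
    have hk1 : ∀ t ∈ J, deriv (extCurv r k 1) t = 0 := fun s hs ↦
      deriv_eq_zero_of_eqOn_const hJ hs ha (hderiv 1 hs)
    have hk2 : deriv (extCurv r k 2) t = 0 := deriv_eq_zero_of_eqOn_const hJ ht hb (hderiv 2 ht)
    have hk3 : extCurv r k 3 t = 0 := by rw [extCurv, if_neg (by omega)]
    have h1 : δ₂ * (0 - extCurv r k 1 t ^ 3 - extCurv r k 1 t * extCurv r k 2 t ^ 2)
        + (δ₂ * κ - δ₁) * extCurv r k 1 t = 0 := by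
      have h2 := h t ht
      field_simp at h2
      linear_combination (-extCurv r k 1 t) * h2
    rw [hγ.eulerLagrange_eq hJ δ₁ δ₂ κ ht, hk1 t ht, hk2, hk3, hderiv2 hk1 ht, h1]
    simp

end IsFrenetCurve

end Frenet

/-! ### Orthogonality relations and linear independence along Legendre Frenet curves -/

section Legendre

variable {d : ℕ} {M : Type*} [TopologicalSpace M] [ChartedSpace (EuclideanSpace ℝ (Fin d)) M]
  [IsManifold (𝓡 d) ∞ M] [RiemannianBundle (fun x : M ↦ TangentSpace (𝓡 d) x)]
  [IsContMDiffRiemannianBundle (𝓡 d) ∞ (EuclideanSpace ℝ (Fin d))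
      (fun x : M ↦ TangentSpace (𝓡 d) x)] [T2Space M]
  {cov : CovariantDerivative (𝓡 d) (EuclideanSpace ℝ (Fin d))
      (fun x : M ↦ TangentSpace (𝓡 d) x)} {S : AlmostContactMetric d M} {c : ℝ}
  {γ : ℝ → M} {J : Set ℝ}

/-- Each orthogonality relation for E₂ and E₃ below arises by differentiating, with this lemma, one
that is already known. -/
lemma inner_covAlong_add_eq_zero (hcov : IsLeviCivita cov) (hJ : IsOpen J)
    {V W : ∀ t, TangentSpace (𝓡 d) (γ t)} {t : ℝ} (ht : t ∈ J) (hV : SmoothAlongAt γ V t)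
    (hW : SmoothAlongAt γ W t) (h : ∀ s ∈ J, ⟪V s, W s⟫ = 0) :
    ⟪covAlong cov γ V t, W t⟫ + ⟪V t, covAlong cov γ W t⟫ = 0 :=
  deriv_eq_zero_of_eqOn_const hJ ht h (hasDerivAt_inner hcov hV hW)

lemma eulerLagrange_eq_zero_of_isGeodesicOn {δ₁ δ₂ κ : ℝ} (hJ : IsOpen J)
    (h : IsGeodesicOn cov γ J) {t : ℝ} (ht : t ∈ J) : eulerLagrange cov δ₁ δ₂ κ γ t = 0 := by
  have h1 : ∀ s ∈ J, covAlong cov γ (tension cov γ) s = 0 := fun s hs ↦ by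
    rw [covAlong_congr cov (W := fun s ↦ (0 : TangentSpace (𝓡 d) (γ s)))
      (by filter_upwards [hJ.mem_nhds hs] with u hu using h u hu), covAlong_zero]
  rw [eulerLagrange, h t ht, covAlong_congr cov (W := fun s ↦ (0 : TangentSpace (𝓡 d) (γ s)))
      (by filter_upwards [hJ.mem_nhds ht] with u hu using h1 u hu), covAlong_zero, smul_zero,
    smul_zero, add_zero]

namespace AlmostContactMetric

variable (S) (x : M) {u v w : TangentSpace (𝓡 d) x} {a : ℝ}

/-- Pairing a vanishing combination with u, v, φu, φv and ξ in this order gives a triangular system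
for the coefficients, with diagonal 1, 1, 1, a, 1. The fourth vector has the shape of ∇_T φT, with a
= k₁. -/
lemma linearIndependent_five (huu : ⟪u, u⟫ = 1) (hvv : ⟪v, v⟫ = 1) (huv : ⟪u, v⟫ = 0)
    (hu : S.η x u = 0) (hv : S.η x v = 0) (h : ⟪S.φ x u, v⟫ = 0) (ha : a ≠ 0) :
    LinearIndependent ℝ ![u, v, S.φ x u, S.ξ x + a • S.φ x v, S.ξ x] := by
  have hvu : ⟪v, u⟫ = 0 := by rw [real_inner_comm, huv]
  have huv' : ⟪u, S.φ x v⟫ = 0 := by rw [S.inner_φ_left] at h; linarith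
  have hvu' : ⟪v, S.φ x u⟫ = 0 := by rw [real_inner_comm, h]
  rw [Fintype.linearIndependent_iff]
  intro g hg
  simp only [Fin.sum_univ_five, Matrix.cons_val] at hg
  have ip (w : TangentSpace (𝓡 d) x) := congrArg (fun v ↦ ⟪w, v⟫) hg
  have h0 : g 0 = 0 := by
    have h' := ip u
    simp only [inner_add_right, real_inner_smul_right, S.inner_ξ, S.inner_φ_self, huu, huv, hu, huv', inner_zero_right] at h'
    simpa using h'
  have h1 : g 1 = 0 := by
    have h' := ip v
    simp only [inner_add_right, real_inner_smul_right, S.inner_ξ, S.inner_φ_self, hvv, hvu, hv, hvu', inner_zero_right] at h'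
    simpa using h'
  have h2 : g 2 = 0 := by
    have h' := ip (S.φ x u)
    simp only [inner_add_right, real_inner_smul_right, S.inner_ξ, S.inner_φ_φ, S.η_φ, huu, hu, h,
      huv, h0, inner_zero_right] at h'
    simpa using h'
  have h3 : g 3 = 0 := by
    have h' := ip (S.φ x v)
    simp only [inner_add_right, real_inner_smul_right, S.inner_ξ, S.inner_φ_φ, S.η_φ, hvv, hv, hvu,
      h0, h1, h2, inner_zero_right] at h'
    simpa [ha] using h'
  have h4 : g 4 = 0 := by
    have h' := ip (S.ξ x)
    simp only [inner_add_right, real_inner_smul_right, S.inner_ξ, S.η_ξ, h0, h1, h2, h3, inner_zero_right] at h'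
    simpa using h'
  intro i
  fin_cases i <;> assumption

/-- The additional vector w is orthogonal to the other five, so its coefficient vanishes and
`linearIndependent_five` applies to the rest. -/
lemma linearIndependent_six (huu : ⟪u, u⟫ = 1) (hvv : ⟪v, v⟫ = 1) (hww : ⟪w, w⟫ = 1)
    (huv : ⟪u, v⟫ = 0) (huw : ⟪u, w⟫ = 0) (hvw : ⟪v, w⟫ = 0)
    (hu : S.η x u = 0) (hv : S.η x v = 0) (hw : S.η x w = 0) (h : ⟪S.φ x u, v⟫ = 0)
    (hwu : ⟪w, S.φ x u⟫ = 0) (hwv : ⟪w, S.φ x v⟫ = 0) (ha : a ≠ 0) :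
    LinearIndependent ℝ ![u, v, w, S.φ x u, S.ξ x + a • S.φ x v, S.ξ x] := by
  have h5 := S.linearIndependent_five x huu hvv huv hu hv h ha
  rw [Fintype.linearIndependent_iff] at h5 ⊢
  intro g hg
  simp only [Fin.sum_univ_six, Matrix.cons_val] at hg
  have h2 : g 2 = 0 := by
    have h3 := congrArg (fun v ↦ ⟪w, v⟫) hg
    have h' := h3
    simp only [inner_add_right, real_inner_smul_right, S.inner_ξ, hww, (real_inner_comm _ _).trans huw,
      (real_inner_comm _ _).trans hvw, hw, hwu, hwv, inner_zero_right] at h'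
    simpa using h'
  have h6 := h5 ![g 0, g 1, g 3, g 4, g 5] (by
    simp only [Fin.sum_univ_five, Matrix.cons_val]
    rwa [h2, zero_smul, add_zero] at hg)
  intro i
  fin_cases i
  exacts [h6 0, h6 1, h2, h6 2, h6 3, h6 4]

end AlmostContactMetric

namespace IsFrenetCurve

variable {r : ℕ} {E : ℕ → ∀ t, TangentSpace (𝓡 d) (γ t)} {k : ℕ → ℝ → ℝ}
  (hγ : IsFrenetCurve cov γ J r E k) (hJ : IsOpen J) (hcov : IsLeviCivita cov)
  (hS : S.IsSasakian) (hleg : S.IsLegendre γ J)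
  (hperp : 2 ≤ r → ∀ t ∈ J, ⟪S.φT γ t, E 2 t⟫ = 0)
include hγ

lemma inner_velocity_self {t : ℝ} (ht : t ∈ J) :
    ⟪velocity (d := d) γ t, velocity γ t⟫ = 1 := by
  rw [← hγ.frame_one t ht, hγ.orthonormal t ht 1 1 le_rfl hγ.one_le le_rfl hγ.one_le, if_pos rfl]

lemma inner_velocity_frame {i : ℕ} (hi : 2 ≤ i) (hir : i ≤ r) {t : ℝ} (ht : t ∈ J) :
    ⟪velocity γ t, E i t⟫ = 0 := by
  rw [← hγ.frame_one t ht, hγ.orthonormal t ht 1 i le_rfl hγ.one_le (by omega) hir,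
    if_neg (by omega)]

include hJ

lemma smoothAlongAt_velocity {t : ℝ} (ht : t ∈ J) :
    SmoothAlongAt γ (velocity (d := d) γ) t :=
  (smoothAlong_velocity hJ hγ.smooth_curve).at hJ ht

lemma tension_eq_of_two_le (hr : 2 ≤ r) {t : ℝ} (ht : t ∈ J) :
    covAlong cov γ (velocity γ) t = k 1 t • E 2 t := by
  have h := hγ.tension_eq hJ ht
  rwa [if_pos (by omega : 1 < r)] at h

include hcov hS hleg

/-- Differentiate g(T, ξ) = 0: the term g(T, ∇_T ξ) = −g(T, φT) vanishes, which leaves k₁ η(E₂) = 0.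
-/
lemma η_frame_two (hr : 2 ≤ r) {t : ℝ} (ht : t ∈ J) : S.η (γ t) (E 2 t) = 0 := by
  have hc := hγ.smooth_curve.contMDiffAt (hJ.mem_nhds ht)
  have h := inner_covAlong_add_eq_zero hcov hJ ht (hγ.smoothAlongAt_velocity hJ ht)
    (S.smoothAlongAt_ξ hc) (fun s hs ↦ by rw [S.inner_ξ, hleg s hs])
  rw [hS.covAlong_ξ hcov hc, hγ.tension_eq_of_two_le hJ hr ht, inner_neg_right, S.inner_φ_self,
    S.inner_ξ, map_smul, smul_eq_mul, neg_zero, add_zero] at h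
  exact (mul_eq_zero.1 h).resolve_left (hγ.curvature_pos t ht 1 le_rfl hr).ne'

lemma covAlong_φT (hr : 2 ≤ r) {t : ℝ} (ht : t ∈ J) :
    covAlong cov γ (S.φT γ) t = S.ξ (γ t) + k 1 t • S.φ (γ t) (E 2 t) := by
  have h := hS.covAlong_φ hcov (hγ.smoothAlongAt_velocity hJ ht)
  rw [hγ.tension_eq_of_two_le hJ hr ht, hγ.inner_velocity_self ht, hleg t ht, map_smul, one_smul,
    zero_smul, sub_zero] at h
  exact h

lemma smoothAlongAt_φT {t : ℝ} (ht : t ∈ J) : SmoothAlongAt γ (S.φT γ) t :=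
  S.smoothAlongAt_φ (hγ.smoothAlongAt_velocity hJ ht)

include hperp

/-- Differentiate g(E₂, ξ) = 0: the term with ∇_T ξ = −φT vanishes because φT ⊥ E₂, and T is
horizontal, so k₂ η(E₃) = 0. -/
lemma η_frame_three (hr : 3 ≤ r) {t : ℝ} (ht : t ∈ J) : S.η (γ t) (E 3 t) = 0 := by
  have hc := hγ.smooth_curve.contMDiffAt (hJ.mem_nhds ht)
  have h := inner_covAlong_add_eq_zero hcov hJ ht (hγ.smoothAt hJ (i := 2) (by norm_num) (by omega) ht)
    (S.smoothAlongAt_ξ hc)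
    (fun s hs ↦ by rw [S.inner_ξ, hγ.η_frame_two hJ hcov hS hleg (by omega) hs])
  have hp : ⟪S.φ (γ t) (velocity γ t), E 2 t⟫ = 0 := hperp (by omega) t ht
  rw [hS.covAlong_ξ hcov hc, hγ.frenet t ht 2 (by norm_num) (by omega), if_pos (by norm_num),
    if_pos (by omega), inner_neg_right, real_inner_comm _ (E 2 t), hp, S.inner_ξ, map_add, map_neg, map_smul,
    map_smul, hγ.frame_one t ht, hleg t ht] at h
  have h1 : k 2 t * S.η (γ t) (E 3 t) = 0 := by simpa using h
  exact (mul_eq_zero.1 h1).resolve_left (hγ.curvature_pos t ht 2 (by norm_num) hr).ne'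

/-- Differentiate g(E₂, φT) = 0: in ∇_T φT = ξ + k₁ φE₂ both terms are orthogonal to E₂, and T ⊥ φT.
-/
lemma inner_frame_three_φT (hr : 3 ≤ r) {t : ℝ} (ht : t ∈ J) : ⟪E 3 t, S.φT γ t⟫ = 0 := by
  have h := inner_covAlong_add_eq_zero hcov hJ ht (hγ.smoothAt hJ (i := 2) (by norm_num) (by omega) ht)
    (hγ.smoothAlongAt_φT hJ hcov hS hleg ht)
    (fun s hs ↦ by rw [real_inner_comm]; exact hperp (by omega) s hs)
  rw [hγ.covAlong_φT hJ hcov hS hleg (by omega) ht, hγ.frenet t ht 2 (by norm_num) (by omega),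
    if_pos (by norm_num), if_pos (by omega), inner_add_left, inner_add_right, inner_neg_left,
    real_inner_smul_left, real_inner_smul_left, real_inner_smul_right, S.inner_φ_self, S.inner_ξ,
    hγ.η_frame_two hJ hcov hS hleg (by omega) ht, hγ.frame_one t ht, AlmostContactMetric.φT,
    S.inner_φ_self] at h
  have h1 : k 2 t * ⟪E 3 t, S.φT γ t⟫ = 0 := by simpa [AlmostContactMetric.φT] using h
  exact (mul_eq_zero.1 h1).resolve_left (hγ.curvature_pos t ht 2 (by norm_num) hr).ne'

/-- Differentiate g(E₃, φT) = 0. For r = 3 the derivative of E₃ is a multiple of E₂, which is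
orthogonal to φT; a larger r would add a term k₃ g(E₄, φT). -/
lemma inner_frame_three_φ_frame_two (hr : r = 3) {t : ℝ} (ht : t ∈ J) :
    ⟪E 3 t, S.φ (γ t) (E 2 t)⟫ = 0 := by
  have h := inner_covAlong_add_eq_zero hcov hJ ht (hγ.smoothAt hJ (by norm_num) (by omega) ht)
    (hγ.smoothAlongAt_φT hJ hcov hS hleg ht)
    (fun s hs ↦ hγ.inner_frame_three_φT hJ hcov hS hleg hperp hr.ge hs)
  have hp : ⟪E 2 t, S.φT γ t⟫ = 0 := by rw [real_inner_comm]; exact hperp (by omega) t ht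
  rw [hγ.covAlong_φT hJ hcov hS hleg (by omega) ht, hγ.frenet t ht 3 (by norm_num) (by omega),
    if_pos (by norm_num), if_neg (by omega), inner_add_left, inner_add_right, inner_neg_left,
    real_inner_smul_left, real_inner_smul_right, S.inner_ξ,
    hγ.η_frame_three hJ hcov hS hleg hperp hr.ge ht] at h
  have h1 : k 1 t * ⟪E 3 t, S.φ (γ t) (E 2 t)⟫ = 0 := by simpa [hp] using h
  exact (mul_eq_zero.1 h1).resolve_left (hγ.curvature_pos t ht 1 le_rfl (by omega)).ne'

omit hS in
lemma tensionIsJacobiEigenvector (hM : S.IsSasakianSpaceForm cov c) {t : ℝ} (ht : t ∈ J) :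
    TensionIsJacobiEigenvector cov ((c + 3) / 4) γ t := by
  have hτ := hγ.tension_eq hJ ht
  refine hM.tensionIsJacobiEigenvector hcov (hγ.inner_velocity_self ht) (hleg t ht) ?_ ?_ ?_ <;>
    rw [hτ] <;> split_ifs with hr
  · rw [real_inner_smul_right, hγ.inner_velocity_frame le_rfl hr ht, mul_zero]
  · exact inner_zero_right _
  · rw [map_smul, hγ.η_frame_two hJ hcov hM.sasakian hleg hr ht, smul_zero]
  · exact map_zero _
  · rw [real_inner_smul_left, real_inner_comm, hperp hr t ht, mul_zero]
  · exact inner_zero_left _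

/-- The vectors `T, E₂, φ T, ∇_T φ T, ξ` are linearly independent. -/
lemma linearIndependent_five (hr : 2 ≤ r) {t : ℝ} (ht : t ∈ J) :
    LinearIndependent ℝ
      ![velocity γ t, E 2 t, S.φT γ t, covAlong cov γ (S.φT γ) t, S.ξ (γ t)] := by
  have hE := hγ.orthonormal t ht 2 2 (by norm_num) hr (by norm_num) hr
  rw [if_pos rfl] at hE
  rw [hγ.covAlong_φT hJ hcov hS hleg hr ht]
  exact S.linearIndependent_five (γ t) (hγ.inner_velocity_self ht) hE
    (hγ.inner_velocity_frame le_rfl hr ht) (hleg t ht) (hγ.η_frame_two hJ hcov hS hleg hr ht)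
    (hperp hr t ht) (hγ.curvature_pos t ht 1 le_rfl hr).ne'

/-- The vectors `T, E₂, E₃, φ T, ∇_T φ T, ξ` are linearly independent. -/
lemma linearIndependent_six (hr : r = 3) {t : ℝ} (ht : t ∈ J) :
    LinearIndependent ℝ
      ![velocity γ t, E 2 t, E 3 t, S.φT γ t, covAlong cov γ (S.φT γ) t, S.ξ (γ t)] := by
  have h2 : 2 ≤ r := by omega
  have hE (i j : ℕ) (hi : 2 ≤ i) (hir : i ≤ r) (hj : 2 ≤ j) (hjr : j ≤ r) :=
    hγ.orthonormal t ht i j (by omega) hir (by omega) hjr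
  have h22 := hE 2 2 le_rfl h2 le_rfl h2
  have h23 := hE 2 3 le_rfl h2 (by norm_num) hr.ge
  have h33 := hE 3 3 (by norm_num) hr.ge (by norm_num) hr.ge
  rw [if_pos rfl] at h22 h33
  rw [if_neg (by norm_num)] at h23
  rw [hγ.covAlong_φT hJ hcov hS hleg h2 ht]
  exact S.linearIndependent_six (γ t) (hγ.inner_velocity_self ht) h22 h33
    (hγ.inner_velocity_frame le_rfl h2 ht) (hγ.inner_velocity_frame (by norm_num) hr.ge ht) h23
    (hleg t ht) (hγ.η_frame_two hJ hcov hS hleg h2 ht)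
    (hγ.η_frame_three hJ hcov hS hleg hperp hr.ge ht) (hperp h2 t ht)
    (hγ.inner_frame_three_φT hJ hcov hS hleg hperp hr.ge ht)
    (hγ.inner_frame_three_φ_frame_two hJ hcov hS hleg hperp hr ht)
    (hγ.curvature_pos t ht 1 le_rfl h2).ne'

end IsFrenetCurve

end Legendre

end Sasaki

end

/-! ### The case distinction by osculating order and the dimension count -/

theorem mainTheorem5 {n : ℕ} {M : Type*} [TopologicalSpace M] [T2Space M]
    [SecondCountableTopology M]
    [ChartedSpace (EuclideanSpace ℝ (Fin (2 * n + 1))) M]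
    [IsManifold (𝓡 (2 * n + 1)) ∞ M]
    [RiemannianBundle (fun x : M ↦ TangentSpace (𝓡 (2 * n + 1)) x)]
    [IsContMDiffRiemannianBundle (𝓡 (2 * n + 1)) ∞ (EuclideanSpace ℝ (Fin (2 * n + 1)))
      (fun x : M ↦ TangentSpace (𝓡 (2 * n + 1)) x)]
    (cov : CovariantDerivative (𝓡 (2 * n + 1)) (EuclideanSpace ℝ (Fin (2 * n + 1)))
      (fun x : M ↦ TangentSpace (𝓡 (2 * n + 1)) x))
    (hcov : Sasaki.IsLeviCivita cov)
    (S : Sasaki.AlmostContactMetric (2 * n + 1) M) (c : ℝ)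
    (hM : S.IsSasakianSpaceForm cov c) (hc : c ≠ 1)
    (J : Set ℝ) (hJ : IsOpen J) (hJc : J.OrdConnected) (hJn : J.Nonempty)
    (γ : ℝ → M) (r : ℕ) (E : ℕ → ∀ t, TangentSpace (𝓡 (2 * n + 1)) (γ t)) (k : ℕ → ℝ → ℝ)
    (hγ : Sasaki.IsFrenetCurve cov γ J r E k) (hleg : S.IsLegendre γ J)
    (hperp : 2 ≤ r → ∀ t ∈ J, ⟪S.φT γ t, E 2 t⟫ = 0)
    (δ₁ δ₂ : ℝ) (hδ : δ₂ ≠ 0) :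
    (c ≤ -3 → 0 ≤ δ₁ / δ₂ →
      (Sasaki.IsSesquiHarmonic cov δ₁ δ₂ γ J ↔ Sasaki.IsGeodesicOn cov γ J)) ∧
    (-3 < c → δ₁ / δ₂ < 0 → ¬ Sasaki.IsGeodesicOn cov γ J →
      (Sasaki.IsSesquiHarmonic cov δ₁ δ₂ γ J ↔
        (r = 2 ∧ 2 ≤ n ∧ Sasaki.IsCircle J r k ∧
          ∀ t ∈ J, k 1 t ^ 2 = (c + 3) / 4 - δ₁ / δ₂) ∨
        (r = 3 ∧ 3 ≤ n ∧ Sasaki.IsHelix J r k ∧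
          ∀ t ∈ J, k 1 t ^ 2 + k 2 t ^ 2 = (c + 3) / 4 - δ₁ / δ₂)) ∧
      (r = 2 ∧ 2 ≤ n ∧ Sasaki.IsCircle J r k ∧
          (∀ t ∈ J, k 1 t ^ 2 = (c + 3) / 4 - δ₁ / δ₂) →
        ∀ t ∈ J, LinearIndependent ℝ
          ![Sasaki.velocity γ t, E 2 t, S.φT γ t, Sasaki.covAlong cov γ (S.φT γ) t, S.ξ (γ t)]) ∧
      (r = 3 ∧ 3 ≤ n ∧ Sasaki.IsHelix J r k ∧
          (∀ t ∈ J, k 1 t ^ 2 + k 2 t ^ 2 = (c + 3) / 4 - δ₁ / δ₂) →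
        ∀ t ∈ J, LinearIndependent ℝ
          ![Sasaki.velocity γ t, E 2 t, E 3 t, S.φT γ t,
            Sasaki.covAlong cov γ (S.φT γ) t, S.ξ (γ t)])) := by
  have hS := hM.sasakian
  have hEL := Sasaki.isSesquiHarmonic_iff hJ hcov (δ₁ := δ₁) (δ₂ := δ₂) hγ.smooth_curve
    (fun t ht ↦ hγ.tensionIsJacobiEigenvector hJ hcov hleg hperp hM ht)
  have hgeo := hγ.isGeodesicOn_iff hJ hJn
  have hr1 := hγ.one_le
  obtain ⟨t₀, ht₀⟩ := hJn
  refine ⟨fun hc3 hδ0 ↦ ⟨fun h ↦ ?_, fun h ↦ hEL.2 fun t ht ↦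
    Sasaki.eulerLagrange_eq_zero_of_isGeodesicOn hJ h ht⟩, fun _ _ hng ↦ ⟨?_, ?_, ?_⟩⟩
  · by_contra hng
    have hr : 2 ≤ r := by rw [hgeo] at hng; omega
    have h1 := ((hγ.eulerLagrange_eq_zero_iff hJ hJc ⟨t₀, ht₀⟩ hr hδ).1 (hEL.1 h)).2.2.2 t₀ ht₀
    have h2 : 0 < Sasaki.extCurv r k 1 t₀ := by
      rw [Sasaki.extCurv, if_pos ⟨le_rfl, hr⟩]
      exact hγ.curvature_pos t₀ ht₀ 1 le_rfl hr
    -- The sum k₁² + k₂² is positive, but it equals (c + 3)/4 − δ₁/δ₂, which is at most 0 here.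
    nlinarith [sq_nonneg (Sasaki.extCurv r k 2 t₀)]
  · have hr : 2 ≤ r := by rw [hgeo] at hng; omega
    have hk1 : Sasaki.extCurv r k 1 = k 1 := by
      funext t; rw [Sasaki.extCurv, if_pos ⟨le_rfl, hr⟩]
    have hfin : Module.finrank ℝ (TangentSpace (𝓡 (2 * n + 1)) (γ t₀)) = 2 * n + 1 :=
      finrank_euclideanSpace_fin
    have : Module.Finite ℝ (TangentSpace (𝓡 (2 * n + 1)) (γ t₀)) :=
      inferInstanceAs (Module.Finite ℝ (EuclideanSpace ℝ (Fin (2 * n + 1))))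
    rw [hEL, hγ.eulerLagrange_eq_zero_iff hJ hJc ⟨t₀, ht₀⟩ hr hδ, hk1]
    constructor
    · rintro ⟨hr3, h1, h2, h⟩
      rcases (by omega : r = 2 ∨ r = 3) with h' | h'
      · have hk2 : ∀ t, Sasaki.extCurv r k 2 t = 0 := fun t ↦ by
          rw [Sasaki.extCurv, if_neg (by omega)]
        refine Or.inl ⟨h', ?_, ⟨h', h1⟩, fun t ht ↦ by simpa [hk2] using h t ht⟩
        -- Five independent tangent vectors force 5 ≤ 2n + 1, that is n ≥ 2.
        have h3 := (hγ.linearIndependent_five hJ hcov hS hleg hperp hr ht₀).fintype_card_le_finrank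
        rw [hfin, Fintype.card_fin] at h3
        omega
      · have hk2 : Sasaki.extCurv r k 2 = k 2 := by
          funext t; rw [Sasaki.extCurv, if_pos ⟨by norm_num, by omega⟩]
        rw [hk2] at h2 h
        refine Or.inr ⟨h', ?_, ⟨h'.ge, fun i hi hir ↦ ?_⟩, h⟩
        -- Six independent tangent vectors force 6 ≤ 2n + 1, and by parity n ≥ 3.
        · have h3 :=
            (hγ.linearIndependent_six hJ hcov hS hleg hperp h' ht₀).fintype_card_le_finrank
          rw [hfin, Fintype.card_fin] at h3
          omega
        · rcases (by omega : i = 1 ∨ i = 2) with rfl | rfl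
          exacts [h1, h2]
    · rintro (⟨h', -, hk, h⟩ | ⟨h', -, hk, h⟩)
      · have hk2 : ∀ t, Sasaki.extCurv r k 2 t = 0 := fun t ↦ by
          rw [Sasaki.extCurv, if_neg (by omega)]
        exact ⟨by omega, hk.2, ⟨0, fun t _ ↦ hk2 t⟩, fun t ht ↦ by simpa [hk2] using h t ht⟩
      · have hk2 : Sasaki.extCurv r k 2 = k 2 := by
          funext t; rw [Sasaki.extCurv, if_pos ⟨by norm_num, by omega⟩]
        rw [hk2]
        exact ⟨by omega, hk.2 1 le_rfl (by omega), hk.2 2 (by norm_num) (by omega), h⟩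
  · rintro ⟨h, -⟩ t ht
    exact hγ.linearIndependent_five hJ hcov hS hleg hperp h.ge ht
  · rintro ⟨h, -⟩ t ht
    exact hγ.linearIndependent_six hJ hcov hS hleg hperp h ht
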